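/- **Setting.** All registers are finite dimensional and $\log=\log_2$. For $N$ even, a *noiseless protocol* $\Pi$ of length $N$ consists of unitaries $U_1,\dots,U_{N+1}$, where $U_j$ acts on $A\otimes C$ (Alice) for odd $j$ and on $B\otimes C$ (Bob) for even $j$; $C$ is a single qubit and $A,B$ have arbitrary finite dimension. For every reference register $E$, $\Pi$ induces the channel $\rho\mapsto \mathrm{Tr}_E\big(U_{N+1}\cdots U_1\,\rho\,U_1^\dagger\cdots U_{N+1}^\dagger\big)$ from $ABCE$ to $ABC$. A *universal simulator* $S$ of length $N'$ over an alphabet of size $q$ in the shared entanglement model works as follows. Alice and Bob share a pure state on $T_A\otimes T_B$ fixed in advance, have local classical and quantum registers, and alternately send each other $N'$ classical symbols in total (Alice sends the first one, receives the last one and acts once more after it). In each turn the acting party performs a finite sequence of local quantum instruments that do not depend on $\Pi$, classically controlled black-box applications of her or his own unitaries $U_j$ or $U_j^{-1}$, and classically controlled swaps of the register $A$ (resp. $B$) with a local dummy copy $\tilde A$ (resp. $\tilde B$). The output consists of $\tilde A,\tilde B$ and a qubit $\tilde C$ of Alice. The communication rate of $S$ is $\frac{N}{N'\log q}$ and its entanglement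 consumption rate is $\frac{\log\min(\dim T_A,\dim T_B)}{N'\log q}$. An *adversary* holds $E$, a quantum scratch register and a classical register $Z$; at the $i$-th transmission she applies a quantum instrument to her registers and the classical symbol in transit (so she may read all symbols and be adaptive and probabilistic). She belongs to $\mathcal A_\delta$ if, for every sequence $z$ of values of $Z$ that can occur, there are at most $\delta N'$ transmissions $i$ at which her instrument, conditioned on $z$, may turn some symbol into a different one. Against an adversary $\mathcal A$, the simulation of $\Pi$ induces a channel $S^\Pi(\mathcal A)$ from $ABCE$ to $\tilde A\tilde B\tilde C\cong ABC$. The simulator *succeeds with error $\eta$ against $\mathcal A_\delta$* if $\|\Pi-S^\Pi(\mathcal A)\|_\diamond\le\eta$ for all noiseless protocols $\Pi$ of length $N$ (with $A,B,E$ of arbitrary finite dimension) and all adversaries $\mathcal A\in\mathcal A_\delta$, where $\|\cdot\|_\diamond$ is the diamond norm based on the trace norm (without a factor $\frac12$). **Theorem.** There is a constant $c>0$ such that for every $\epsilon>0$ there exist a communication rate $R_C>0$, an alphabet size $q\ge 2$ and an entanglement consumption rate $R_E\ge0$ such that for every even $N\ge2$ there is a universal simulator $S$ for noiseless protocols of length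 $N$ in the shared entanglement model, with alphabet size $q$, communication rate $R_C$ and entanglement consumption rate $R_E$, whose preshared state consists of EPR pairs $\frac1{\sqrt2}(|00\rangle+|11\rangle)$, and which succeeds with error $2^{-cN}$ against $\mathcal A_{\frac12-\epsilon}$. -/

import Mathlib

open scoped Kronecker Matrix ENNReal ComplexOrder

noncomputable section

namespace NoisyQC

/-! ### Norms, channels, instruments -/

/-- Trace norm `‖O‖₁ = Tr (O†O)^{1/2}`: the sum of the square roots of the eigenvalues of `O†O`. -/
def traceNorm {I : Type} [Fintype I] [DecidableEq I] (O : Matrix I I ℂ) : ℝ :=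
  ∑ i, √((Matrix.isHermitian_conjTranspose_mul_self O).eigenvalues i)

/-- Density operators: positive semidefinite of unit trace. -/
def IsDensity {I : Type} [Fintype I] (ρ : Matrix I I ℂ) : Prop :=
  ρ.PosSemidef ∧ ρ.trace = 1

/-- `Φ ⊗ id_R`, acting blockwise on operators on `I ⊗ R`. -/
def ampliate {I O R : Type} (Φ : Matrix I I ℂ → Matrix O O ℂ) (σ : Matrix (I × R) (I × R) ℂ) :
    Matrix (O × R) (O × R) ℂ :=
  Matrix.of fun p p' => Φ (Matrix.of fun i i' => σ (i, p.2) (i', p'.2)) p.1 p'.1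

/-- Diamond norm: the supremum of `‖(Φ ⊗ id_R) σ‖₁` over density operators `σ` on the input
system together with a reference system `R` of the same dimension. -/
def diamondNorm {I O : Type} [Fintype I] [DecidableEq I] [Fintype O] [DecidableEq O]
    (Φ : Matrix I I ℂ → Matrix O O ℂ) : ℝ≥0∞ :=
  ⨆ σ : {σ : Matrix (I × I) (I × I) ℂ // IsDensity σ},
    ENNReal.ofReal (traceNorm (ampliate Φ σ.1))

/-- A family of Kraus operators on a classical register with values in `X` and a quantum register
with basis `Q`: `K x x' j` is applied when the classical value moves from `x` to `x'`. -/
structure KrausFamily (X Q : Type) where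
  k : ℕ
  K : X → X → Fin k → Matrix Q Q ℂ

/-- The action of a Kraus family on a classical-quantum operator `∑ x, |x⟩⟨x| ⊗ ρ x`. -/
def KrausFamily.apply {X Q : Type} [Fintype X] [Fintype Q] (F : KrausFamily X Q)
    (ρ : X → Matrix Q Q ℂ) : X → Matrix Q Q ℂ :=
  fun x' => ∑ x, ∑ j, F.K x x' j * ρ x * (F.K x x' j)ᴴ

/-- A quantum instrument: a trace-preserving Kraus family. -/
structure Instrument (X Q : Type) [Fintype X] [Fintype Q] [DecidableEq Q] extends
    KrausFamily X Q where
  trace_preserving : ∀ x, ∑ x', ∑ j, (K x x' j)ᴴ * K x x' j = 1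

abbrev Qubit : Type := Fin 2

/-! ### Noiseless protocols -/

/-- A noiseless protocol of length `2 n`: `alice r` is `U_{2r+1}`, acting on `A ⊗ C`, and `bob r`
is `U_{2r+2}`, acting on `B ⊗ C`, where `C` is a single qubit. -/
structure NoiselessProtocol (n : ℕ) (A B : Type) [Fintype A] [DecidableEq A] [Fintype B]
    [DecidableEq B] where
  alice : Fin (n + 1) → Matrix.unitaryGroup (A × Qubit) ℂ
  bob : Fin n → Matrix.unitaryGroup (B × Qubit) ℂ

section Noiseless

variable {n : ℕ} {A B : Type} [Fintype A] [DecidableEq A] [Fintype B] [DecidableEq B]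

/-- `U^{AC}` as an operator on `A ⊗ B ⊗ C`. -/
def onAC (U : Matrix (A × Qubit) (A × Qubit) ℂ) : Matrix (A × B × Qubit) (A × B × Qubit) ℂ :=
  Matrix.of fun p p' => if p.2.1 = p'.2.1 then U (p.1, p.2.2) (p'.1, p'.2.2) else 0

/-- `U^{BC}` as an operator on `A ⊗ B ⊗ C`. -/
def onBC (U : Matrix (B × Qubit) (B × Qubit) ℂ) : Matrix (A × B × Qubit) (A × B × Qubit) ℂ :=
  Matrix.of fun p p' => if p.1 = p'.1 then U p.2 p'.2 else 0

/-- `U_{2n+1} U_{2n} ⋯ U_2 U_1`. -/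
def NoiselessProtocol.unitary (P : NoiselessProtocol n A B) :
    Matrix (A × B × Qubit) (A × B × Qubit) ℂ :=
  onAC (P.alice (Fin.last n)).1 *
    Fin.foldl n (fun V r => onBC (P.bob r).1 * (onAC (P.alice r.castSucc).1 * V)) 1

/-- The channel from `ABCE` to `ABC` induced by the protocol: apply the unitaries, trace out
`E`. -/
def NoiselessProtocol.channel (P : NoiselessProtocol n A B) (E : Type) [Fintype E] [DecidableEq E]
    (ρ : Matrix ((A × B × Qubit) × E) ((A × B × Qubit) × E) ℂ) :
    Matrix (A × B × Qubit) (A × B × Qubit) ℂ :=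
  Matrix.of fun i i' => ∑ e : E,
    ((P.unitary ⊗ₖ (1 : Matrix E E ℂ)) * ρ * (P.unitary ⊗ₖ (1 : Matrix E E ℂ))ᴴ) (i, e) (i', e)

end Noiseless

/-! ### Simulation with black-box access -/

/-- One elementary operation of a party in a simulation. The party holds a data register `D` of
unknown dimension, a safe register isomorphic to `D`, a qubit on which (together with `D`) the
black-box unitaries act, and a workspace `W`. `X` is its classical register (including the symbol
of the classical communication register).
* `loc M`: an instrument on everything but the data register and the safe register;
* `call f`: depending on the classical value, do nothing or query the black box, i.e. apply the
  `j`-th unitary, `f x = some (j, false)`, or its inverse, `f x = some (j, true)`, on `D` and the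
  qubit;
* `swap f`: if `f x` holds, swap the data register with the safe register.
Nothing here depends on the protocol in the black box. -/
inductive Instruction (J X W : Type) [Fintype X] [Fintype W] [DecidableEq W] where
  | loc (M : Instrument X (Qubit × W))
  | call (f : X → Option (J × Bool))
  | swap (f : X → Bool)

section Black

variable {J X W D : Type} [Fintype X] [DecidableEq X] [Fintype W] [DecidableEq W]
  [Fintype D] [DecidableEq D]

/-- A unitary of the black box, acting on the data register and the qubit. -/
def onData (U : Matrix (D × Qubit) (D × Qubit) ℂ) :
    Matrix (D × D × Qubit × W) (D × D × Qubit × W) ℂ :=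
  Matrix.of fun p p' =>
    if p.2.1 = p'.2.1 ∧ p.2.2.2 = p'.2.2.2 then U (p.1, p.2.2.1) (p'.1, p'.2.2.1) else 0

/-- The swap of the data register and the safe register. -/
def swapData : Matrix (D × D × Qubit × W) (D × D × Qubit × W) ℂ :=
  Matrix.of fun p p' => if p.1 = p'.2.1 ∧ p.2.1 = p'.1 ∧ p.2.2 = p'.2.2 then 1 else 0

/-- The operation performed by an instruction when the black box contains the unitaries `V`. -/
def Instruction.kraus (V : J → Matrix (D × Qubit) (D × Qubit) ℂ) :
    Instruction J X W → KrausFamily X (D × D × Qubit × W)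
  | .loc M => ⟨M.k, fun x x' j =>
      (1 : Matrix D D ℂ) ⊗ₖ ((1 : Matrix D D ℂ) ⊗ₖ M.K x x' j)⟩
  | .call f => ⟨1, fun x x' _ => if x = x' then
      (match f x with
        | none => 1
        | some (j, false) => onData (V j)
        | some (j, true) => onData (V j)ᴴ) else 0⟩
  | .swap f => ⟨1, fun x x' _ => if x = x' then (if f x then swapData else 1) else 0⟩

end Black

/-- A simulation protocol in the shared entanglement model, of length `N' = 2 m`, over an alphabet
of size `q`, for noiseless protocols of length `2 n`. Alice has a classical register `X`, a scratch
register `SA` and the entanglement register `TA`, Bob has `Y`, `SB`, `TB`, with the given initial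
basis states, and `phi` is the state preshared on `TA ⊗ TB`. The instruments
`M_1, M_3, …, M_{2m+1}` of Alice and `M_2, M_4, …, M_{2m}` of Bob are finite sequences of
instructions. Alice's workspace starts with the qubit that is part of her output. -/
structure Simulator (n m q : ℕ) where
  (X Y SA SB TA TB : Type)
  [fX : Fintype X] [dX : DecidableEq X]
  [fY : Fintype Y] [dY : DecidableEq Y]
  [fSA : Fintype SA] [dSA : DecidableEq SA]
  [fSB : Fintype SB] [dSB : DecidableEq SB]
  [fTA : Fintype TA] [dTA : DecidableEq TA]
  [fTB : Fintype TB] [dTB : DecidableEq TB]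
  x0 : X
  y0 : Y
  sA0 : SA
  sB0 : SB
  msg0 : Fin q
  phi : TA → TB → ℂ
  phi_unit : ∑ a, ∑ b, ‖phi a b‖ ^ 2 = 1
  alice : Fin (m + 1) → List (Instruction (Fin (n + 1)) (X × Fin q) (Qubit × SA × TA))
  bob : Fin m → List (Instruction (Fin n) (Y × Fin q) (SB × TB))

attribute [instance] Simulator.fX Simulator.dX Simulator.fY Simulator.dY Simulator.fSA
  Simulator.dSA Simulator.fSB Simulator.dSB Simulator.fTA Simulator.dTA Simulator.fTB Simulator.dTB

/-- Communication rate `N / (N' log q)`, with `N = 2 n` and `N' = 2 m`. -/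
def Simulator.commRate {n m q : ℕ} (_S : Simulator n m q) : ℝ :=
  ((2 * n : ℕ) : ℝ) / (((2 * m : ℕ) : ℝ) * Real.logb 2 q)

/-- Entanglement consumption rate `log (min (dim TA) (dim TB)) / (N' log q)`. -/
def Simulator.entRate {n m q : ℕ} (S : Simulator n m q) : ℝ :=
  Real.logb 2 ((min (Fintype.card S.TA) (Fintype.card S.TB) : ℕ) : ℝ) /
    (((2 * m : ℕ) : ℝ) * Real.logb 2 q)

/-- Amplitudes of the EPR pair `(|00⟩ + |11⟩) / √2`. -/
def eprPair (s t : Qubit) : ℂ := if s = t then ((1 / √2 : ℝ) : ℂ) else 0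

/-- The preshared state consists of `k` EPR pairs, one qubit of each held by either party. -/
def Simulator.UsesEPRPairs {n m q : ℕ} (S : Simulator n m q) (k : ℕ) : Prop :=
  ∃ (eA : S.TA ≃ (Fin k → Qubit)) (eB : S.TB ≃ (Fin k → Qubit)),
    ∀ a b, S.phi a b = ∏ i, eprPair (eA a i) (eB b i)

/-! ### Adversaries -/

/-- An adversary: she holds a classical register `Z` and the quantum registers `E` (the reference
register of the input) and `F` (scratch), and acts by an instrument on `Z`, `E ⊗ F` and the
classical symbol in transit on each of the `N' = 2 m` transmissions. -/
structure Adversary (m q : ℕ) (E : Type) [Fintype E] [DecidableEq E] where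
  (Z F : Type)
  [fZ : Fintype Z] [dZ : DecidableEq Z]
  [fF : Fintype F] [dF : DecidableEq F]
  z0 : Z
  f0 : F
  act : Fin (2 * m) → Instrument (Z × Fin q) (E × F)

attribute [instance] Adversary.fZ Adversary.dZ Adversary.fF Adversary.dF

section Corruption

variable {m q : ℕ} {E : Type} [Fintype E] [DecidableEq E]

/-- The sequence `z` of values of Eve's classical register can occur: for some symbols and Kraus
labels, the product of the corresponding Kraus operators of Eve is non-zero. -/
def Adversary.Possible (𝒜 : Adversary m q E) (z : Fin (2 * m + 1) → 𝒜.Z) : Prop :=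
  z 0 = 𝒜.z0 ∧ ∃ (c c' : Fin (2 * m) → Fin q) (j : ∀ i, Fin (𝒜.act i).k),
    (List.ofFn fun i => (𝒜.act i).K (z i.castSucc, c i) (z i.succ, c' i) (j i)).reverse.prod ≠ 0

/-- The transmissions on which, conditioned on the classical record `z`, Eve's action does not
transmit the classical symbol noiselessly: it may turn some symbol into a different one. (She may
read the symbol, and her action on `E ⊗ F` may depend on it.) -/
def Adversary.corrupted (𝒜 : Adversary m q E) (z : Fin (2 * m + 1) → 𝒜.Z) : Set (Fin (2 * m)) :=
  {i | ∃ c c' j, c ≠ c' ∧ (𝒜.act i).K (z i.castSucc, c) (z i.succ, c') j ≠ 0}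

/-- The class of adversaries that corrupt at most a fraction `δ` of the transmissions: for every
possible classical record, the number of corrupted transmissions is at most `δ N'`. -/
def Adversary.InClass (𝒜 : Adversary m q E) (δ : ℝ) : Prop :=
  ∀ z, 𝒜.Possible z → ((𝒜.corrupted z).ncard : ℝ) ≤ δ * ((2 * m : ℕ) : ℝ)

end Corruption

/-! ### Execution -/

section Execution

variable {n m q : ℕ} {A B E : Type} [Fintype A] [DecidableEq A] [Fintype B]
  [DecidableEq B] [Fintype E] [DecidableEq E]

/-- Alice's quantum registers: data, safe copy, black-box qubit, output qubit, scratch,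
entanglement. -/
abbrev Simulator.QA (S : Simulator n m q) (A : Type) : Type :=
  A × A × Qubit × (Qubit × S.SA × S.TA)

/-- Bob's quantum registers: data, safe copy, black-box qubit, scratch, entanglement. -/
abbrev Simulator.QB (S : Simulator n m q) (B : Type) : Type :=
  B × B × Qubit × (S.SB × S.TB)

/-- All classical registers: those of Alice, Bob and Eve, and the communication register. -/
abbrev Config (S : Simulator n m q) (𝒜 : Adversary m q E) : Type :=
  S.X × S.Y × 𝒜.Z × Fin q

/-- All quantum registers: those of Alice, Bob and Eve. -/
abbrev QAll (S : Simulator n m q) (𝒜 : Adversary m q E) (A B : Type) : Type :=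
  S.QA A × S.QB B × (E × 𝒜.F)

/-- Global classical-quantum states. -/
abbrev GState (S : Simulator n m q) (𝒜 : Adversary m q E) (A B : Type) : Type :=
  Config S 𝒜 → Matrix (QAll S 𝒜 A B) (QAll S 𝒜 A B) ℂ

variable (S : Simulator n m q) (𝒜 : Adversary m q E)

/-- An operation of Alice on the global system. -/
def liftAlice (F : KrausFamily (S.X × Fin q) (S.QA A)) :
    KrausFamily (Config S 𝒜) (QAll S 𝒜 A B) where
  k := F.k
  K := fun (x, y, z, c) (x', y', z', c') j =>
    if y = y' ∧ z = z' then
      F.K (x, c) (x', c') j ⊗ₖ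
        ((1 : Matrix (S.QB B) (S.QB B) ℂ) ⊗ₖ (1 : Matrix (E × 𝒜.F) (E × 𝒜.F) ℂ))
    else 0

/-- An operation of Bob on the global system. -/
def liftBob (F : KrausFamily (S.Y × Fin q) (S.QB B)) :
    KrausFamily (Config S 𝒜) (QAll S 𝒜 A B) where
  k := F.k
  K := fun (x, y, z, c) (x', y', z', c') j =>
    if x = x' ∧ z = z' then
      (1 : Matrix (S.QA A) (S.QA A) ℂ) ⊗ₖ
        (F.K (y, c) (y', c') j ⊗ₖ (1 : Matrix (E × 𝒜.F) (E × 𝒜.F) ℂ))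
    else 0

/-- An operation of Eve on the global system. -/
def liftEve (F : KrausFamily (𝒜.Z × Fin q) (E × 𝒜.F)) :
    KrausFamily (Config S 𝒜) (QAll S 𝒜 A B) where
  k := F.k
  K := fun (x, y, z, c) (x', y', z', c') j =>
    if x = x' ∧ y = y' then
      (1 : Matrix (S.QA A) (S.QA A) ℂ) ⊗ₖ
        ((1 : Matrix (S.QB B) (S.QB B) ℂ) ⊗ₖ F.K (z, c) (z', c') j)
    else 0

/-- Alice's instrument `M_{2r+1}`, given the black box. -/
def aliceTurn (P : NoiselessProtocol n A B) (r : Fin (m + 1)) (σ : GState S 𝒜 A B) :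
    GState S 𝒜 A B :=
  (S.alice r).foldl
    (fun τ I => (liftAlice S 𝒜 (I.kraus fun j => (P.alice j).1)).apply τ) σ

/-- Bob's instrument `M_{2r+2}`, given the black box. -/
def bobTurn (P : NoiselessProtocol n A B) (r : Fin m) (σ : GState S 𝒜 A B) : GState S 𝒜 A B :=
  (S.bob r).foldl (fun τ I => (liftBob S 𝒜 (I.kraus fun j => (P.bob j).1)).apply τ) σ

/-- Eve's instrument on transmission number `i`. -/
def eveTurn (i : Fin (2 * m)) (σ : GState S 𝒜 A B) : GState S 𝒜 A B :=
  (liftEve S 𝒜 (𝒜.act i).toKrausFamily).apply σ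

/-- The isometry that adjoins to the input registers `A`, `B`, `C`, `E` (with `C` in Alice's
black-box qubit) the shared entanglement and all other registers in their initial state. -/
def initIsometry [Inhabited A] [Inhabited B] :
    Matrix (QAll S 𝒜 A B) ((A × B × Qubit) × E) ℂ :=
  Matrix.of fun ((a, sa, c, c', s, t), (b, sb, cB, s', t'), (e, f)) ((a₁, b₁, c₁), e₁) =>
    if (a = a₁ ∧ b = b₁ ∧ c = c₁ ∧ e = e₁) ∧
        (sa = default ∧ c' = 0 ∧ s = S.sA0) ∧ (sb = default ∧ cB = 0 ∧ s' = S.sB0) ∧ f = 𝒜.f0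
    then S.phi t t' else 0

/-- The initial global state on input `ρ`. -/
def initState [Inhabited A] [Inhabited B]
    (ρ : Matrix ((A × B × Qubit) × E) ((A × B × Qubit) × E) ℂ) : GState S 𝒜 A B :=
  fun x => if x = (S.x0, S.y0, 𝒜.z0, S.msg0) then
    initIsometry (A := A) (B := B) S 𝒜 * ρ * (initIsometry (A := A) (B := B) S 𝒜)ᴴ else 0

/-- The output: Alice's and Bob's safe registers and Alice's output qubit; everything else is traced
out. -/
def outputState (σ : GState S 𝒜 A B) : Matrix (A × B × Qubit) (A × B × Qubit) ℂ :=
  Matrix.of fun (a, b, c) (a', b', c') =>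
    ∑ x : Config S 𝒜, ∑ dA : A, ∑ cA : Qubit, ∑ wA : S.SA × S.TA,
      ∑ dB : B, ∑ cB : Qubit, ∑ wB : S.SB × S.TB, ∑ e : E × 𝒜.F,
        σ x ((dA, a, cA, c, wA), (dB, b, cB, wB), e) ((dA, a', cA, c', wA), (dB, b', cB, wB), e)

/-- The channel from `ABCE` to `ABC` induced by the simulation of the protocol `P` against the
adversary: `M_1, N_1, M_2, N_2, …, M_{2m}, N_{2m}, M_{2m+1}` in this order. -/
def simChannel [Inhabited A] [Inhabited B] (P : NoiselessProtocol n A B)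
    (ρ : Matrix ((A × B × Qubit) × E) ((A × B × Qubit) × E) ℂ) :
    Matrix (A × B × Qubit) (A × B × Qubit) ℂ :=
  outputState S 𝒜 (aliceTurn S 𝒜 P (Fin.last m)
    (Fin.foldl m (fun σ r =>
      eveTurn S 𝒜 ⟨2 * r.1 + 1, by omega⟩ (bobTurn S 𝒜 P r
        (eveTurn S 𝒜 ⟨2 * r.1, by omega⟩ (aliceTurn S 𝒜 P r.castSucc σ))))
      (initState S 𝒜 ρ)))

end Execution

/-- The simulation protocol succeeds with error `err` at simulating all noiseless protocols of
length `2 n` against all adversaries that corrupt at most a fraction `δ` of the transmissions. The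
registers `A`, `B`, `E` have arbitrary finite dimension, with `default` as the basis state `|0⟩` of
`A` and `B`. -/
def Simulator.Succeeds {n m q : ℕ} (S : Simulator n m q) (δ err : ℝ) : Prop :=
  ∀ (A B E : Type) [Fintype A] [DecidableEq A] [Inhabited A] [Fintype B] [DecidableEq B]
    [Inhabited B] [Fintype E] [DecidableEq E] (P : NoiselessProtocol n A B)
    (𝒜 : Adversary m q E), 𝒜.InClass δ →
      diamondNorm (fun ρ => P.channel E ρ - simChannel S 𝒜 P ρ) ≤ ENNReal.ofReal err

end NoisyQC

end

/-! No quantum data crosses the channel. The qubit `C` is teleported back and forth with preshared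
EPR pairs, and the messages are classical. In each turn a party makes a Pauli correction, then
applies its next unitary, undoes its last one or does nothing, and finally performs the Bell
measurement of the teleportation. These entries form a log, and each turn transmits one symbol of
the tree code encoding of the sender's log. Mistakes are reversible: up to sign the joint operator
is the one denoted by a word in the moves made so far (`unitaryAfter_eq`), and a party that knows
the word can extend a correct prefix or cancel a wrong last letter of its own (`bestAction`).

The threshold 1/2 comes from secret keys. Further EPR pairs, measured in the computational basis,
give a fresh key for each transmission. It serves as a one-time pad on the code symbol `y` and on
its tag `T * y`. The symbol in transit is independent of `T`, so a change passes the test with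
probability at most 1/|F|; any other change becomes an erasure. An erasure costs at most one unit of
progress, and a round consists of two transmissions. Hence m rounds with (1/2 - ε) 2m erasures still
gain about 2εm. An undetected change can mislead the decoder, but the number of misled turns is
controlled by the number of such changes (`card_misled_le`). Together this gives
`potential_wordAfter_ge`.

Once the potential reaches 2n + 4, the protocol has been run and its last qubit swapped into the
output qubit; whatever else was done acts on the abandoned qubit `C` only
(`wordUnitary_of_potential`).

For the diamond norm, an execution is expanded into pure branches, the runs. Each has an operator
that is a common amplitude times a unitary on `A`, `B`, `C` and the output, tensored with an
operator `N` of the adversary (`simChannel_eq`). With the ideal unitary in place of the simulated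
one, the same runs add up to the ideal channel (`krausMap_bind_ideal`), and a run with enough
progress contributes equally to both sums (`Run.Valid.krausMap_kraus`). Only bad runs remain, and
their traces bound the diamond norm (`diamondNorm_le`). Bad runs have more than `k` undetected
changes; Markov's inequality applied to the exponential moment in `sum_weight_runs_le` bounds their
weight by 4^m / |F|^(k+1), which a large field makes exponentially small. -/

open scoped Kronecker Matrix ENNReal ComplexOrder

noncomputable section

namespace NoisyQC

set_option linter.unusedSectionVars false
set_option synthInstance.maxSize 10000
set_option synthInstance.maxHeartbeats 1000000

/-! ### Tree codes -/

section TreeCode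

variable {F D : Type} [Field F]

/-- Symbol number `r` of the convolution of the sequence `x`, relabelled by `ι`, with `G`. -/
def treeEncode (G : ℕ → F) (ι : D → F) (x : ℕ → D) (r : ℕ) : F :=
  ∑ i ∈ Finset.range (r + 1), G (r - i) * ι (x i)

lemma treeEncode_congr (G : ℕ → F) (ι : D → F) {x x' : ℕ → D} {r : ℕ}
    (h : ∀ i ≤ r, x i = x' i) : treeEncode G ι x r = treeEncode G ι x' r := by
  refine Finset.sum_congr rfl fun i hi => ?_
  rw [h i (by simpa [Nat.lt_succ_iff] using hi)]

/-- Any two sequences that differ at position `s` for the first time have encodings that agree on at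
most a fraction `1 / a` of each interval starting at `s`. -/
def IsTreeCode [DecidableEq F] (a M : ℕ) (G : ℕ → F) (ι : D → F) : Prop :=
  ∀ (x x' : ℕ → D) (s ℓ : ℕ), (∀ i < s, x i = x' i) → x s ≠ x' s → s + ℓ ≤ M →
    a * ((Finset.range ℓ).filter
      fun j => treeEncode G ι x (s + j) = treeEncode G ι x' (s + j)).card ≤ ℓ

/-- Truncated convolution. -/
def conv (G δ : ℕ → F) (j : ℕ) : F := ∑ i ∈ Finset.range (j + 1), G (j - i) * δ i

/-- Extension of a finite sequence by a default value. -/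
def extend {α : Type} {M : ℕ} (d : α) (g : Fin M → α) (i : ℕ) : α :=
  if h : i < M then g ⟨i, h⟩ else d

lemma extend_of_lt {α : Type} {M : ℕ} (d : α) (g : Fin M → α) {i : ℕ} (h : i < M) :
    extend d g i = g ⟨i, h⟩ := dif_pos h

lemma extend_val {α : Type} {M : ℕ} (d : α) (g : Fin M → α) (i : Fin M) :
    extend d g i = g i := by simp [extend]

/-- The convolution is triangular in `g` with the non-zero diagonal entry `δ 0`, so the coefficients
can be recovered one after the other. -/
lemma conv_injective {M : ℕ} {δ : ℕ → F} (h0 : δ 0 ≠ 0) {g g' : Fin M → F}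
    (h : ∀ j < M, conv (extend 0 g) δ j = conv (extend 0 g') δ j) : g = g' := by
  have key : ∀ j, j < M → extend 0 g j = extend 0 g' j := by
    intro j
    induction j using Nat.strong_induction_on with
    | _ j ih =>
      intro hj
      have h1 := h j hj
      unfold conv at h1
      rw [Finset.sum_range_succ', Finset.sum_range_succ'] at h1
      have h2 : ∑ k ∈ Finset.range j, extend 0 g (j - (k + 1)) * δ (k + 1) =
          ∑ k ∈ Finset.range j, extend 0 g' (j - (k + 1)) * δ (k + 1) := by
        refine Finset.sum_congr rfl fun k hk => ?_
        have : k < j := by simpa using hk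
        rw [ih (j - (k + 1)) (by omega) (by omega)]
      rw [h2] at h1
      exact mul_right_cancel₀ h0 (add_left_cancel h1)
  funext j
  simpa [extend] using key j j.2

variable [Fintype F] [DecidableEq F] [Fintype D]

/-- For uniformly random `g` the convolution is uniformly distributed as well, so it vanishes on `S`
with probability |F|^(-|S|); only the upper bound is needed. -/
lemma card_conv_eq_zero_mul_le {M : ℕ} {δ : ℕ → F} (h0 : δ 0 ≠ 0) (S : Finset (Fin M)) :
    (Finset.univ.filter fun g : Fin M → F => ∀ j ∈ S, conv (extend 0 g) δ j = 0).card *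
      Fintype.card F ^ S.card ≤ Fintype.card F ^ M := by
  classical
  set Z := Finset.univ.filter fun g : Fin M → F => ∀ j ∈ S, conv (extend 0 g) δ j = 0
  have hcard : Fintype.card (Z × (S → F)) = Z.card * Fintype.card F ^ S.card := by
    simp
  have hM : Fintype.card (Fin M → F) = Fintype.card F ^ M := by simp
  rw [← hcard, ← hM]
  -- Overwrite the zeros on `S` by an arbitrary vector. The result determines that vector, and by
  -- triangularity also `g`.
  refine Fintype.card_le_of_injective
    (fun p j => if h : j ∈ S then p.2 ⟨j, h⟩ else conv (extend 0 p.1.1) δ j) ?_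
  rintro ⟨⟨g, hg⟩, u⟩ ⟨⟨g', hg'⟩, u'⟩ h
  have hg := (Finset.mem_filter.1 hg).2
  have hg' := (Finset.mem_filter.1 hg').2
  have hu : u = u' := by
    funext j
    have := congrFun h j.1
    simpa [j.2] using this
  have hgg : g = g' := by
    refine conv_injective h0 fun j hj => ?_
    by_cases hS : (⟨j, hj⟩ : Fin M) ∈ S
    · rw [hg _ hS, hg' _ hS]
    · have := congrFun h ⟨j, hj⟩
      simpa [hS] using this
  subst hu; subst hgg; rfl

lemma sum_inv_four_pow_lt (M : ℕ) : ∑ ℓ ∈ Finset.range M, ((1 : ℝ) / 4) ^ (ℓ + 1) < 1 := by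
  have : ∀ M : ℕ, ∑ ℓ ∈ Finset.range M, ((1 : ℝ) / 4) ^ (ℓ + 1) = (1 - (1 / 4) ^ M) / 3 := by
    intro M
    induction M with
    | zero => simp
    | succ k ih => rw [Finset.sum_range_succ, ih]; ring
  rw [this]
  have : (0 : ℝ) < (1 / 4) ^ M := by positivity
  linarith

/-- Tree codes of any depth exist over a large enough field. -/
theorem exists_treeCode (a M : ℕ) (ι : D → F) (hι : Function.Injective ι)
    (hF : (8 * Fintype.card D ^ 2) ^ a ≤ Fintype.card F) :
    ∃ G : ℕ → F, IsTreeCode a M G ι := by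
  classical
  let q := Fintype.card F
  let δ : {ℓ : ℕ} → (Fin ℓ → D × D) → ℕ → F :=
    fun w => extend 0 fun i => ι (w i).1 - ι (w i).2
  -- The events of a union bound: two sequences that run through the pairs `w` from their first
  -- difference on have encodings that agree on the set `S`, which is larger than ℓ / a.
  let bad : (ℓ : ℕ) → (Fin ℓ → D × D) → Finset ℕ → Finset (Fin M → F) := fun ℓ w S =>
    Finset.univ.filter fun g => δ w 0 ≠ 0 ∧ ℓ ≤ M ∧ ℓ < a * S.card ∧
      ∀ j ∈ S, conv (extend 0 g) (δ w) j = 0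
  have hq : 0 < q := Fintype.card_pos
  have hbad : ∀ (ℓ : ℕ) (w : Fin ℓ → D × D), ∀ S ∈ (Finset.range ℓ).powerset,
      (bad ℓ w S).card * (8 * Fintype.card D ^ 2) ^ ℓ ≤ q ^ M := by
    intro ℓ w S hS
    have hS' : S ⊆ Finset.range ℓ := by simpa using hS
    by_cases hc : δ w 0 ≠ 0 ∧ ℓ ≤ M ∧ ℓ < a * S.card
    · obtain ⟨h0, hM, hcard⟩ := hc
      have hD : 0 < Fintype.card D := by
        by_contra h
        have hE : IsEmpty D := Fintype.card_eq_zero_iff.1 (by omega)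
        apply h0
        simp only [δ, extend]
        split_ifs with h
        · exact (hE.false (w ⟨0, h⟩).1).elim
        · rfl
      have hlt : ∀ j ∈ S, j < M := fun j hj =>
        lt_of_lt_of_le (Finset.mem_range.1 (hS' hj)) hM
      have h1 := card_conv_eq_zero_mul_le (M := M) h0 (S.attachFin hlt)
      rw [Finset.card_attachFin] at h1
      -- The size of the field enters here: each of the more than ℓ / a agreements costs a factor of
      -- at least (8 |D|²)^a.
      have h2 : (8 * Fintype.card D ^ 2) ^ ℓ ≤ q ^ S.card := by
        calc (8 * Fintype.card D ^ 2) ^ ℓ ≤ (8 * Fintype.card D ^ 2) ^ (a * S.card) :=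
              Nat.pow_le_pow_right (by positivity) hcard.le
          _ = ((8 * Fintype.card D ^ 2) ^ a) ^ S.card := by rw [pow_mul]
          _ ≤ q ^ S.card := Nat.pow_le_pow_left hF _
      refine le_trans (Nat.mul_le_mul ?_ h2) h1
      refine Finset.card_le_card fun g hg => ?_
      simp only [bad, Finset.mem_filter, Finset.mem_univ, true_and] at hg ⊢
      intro j hj
      exact hg.2.2.2 j (by simpa using hj)
    · have : bad ℓ w S = ∅ := by
        refine Finset.filter_eq_empty_iff.2 fun g _ h => hc ⟨h.1, h.2.1, h.2.2.1⟩
      rw [this]; simp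
  let Bad : Finset (Fin M → F) := (Finset.range M).biUnion fun l =>
    Finset.univ.biUnion fun w : Fin (l + 1) → D × D =>
      (Finset.range (l + 1)).powerset.biUnion fun S => bad (l + 1) w S
  have hBad : (Bad.card : ℝ) < (q : ℝ) ^ M := by
    have h1 : ∀ l ∈ Finset.range M, ((Finset.univ.biUnion fun w : Fin (l + 1) → D × D =>
        (Finset.range (l + 1)).powerset.biUnion fun S => bad (l + 1) w S).card : ℝ) ≤
        (q : ℝ) ^ M * (1 / 4) ^ (l + 1) := by
      intro l _
      by_cases hD0 : Fintype.card D = 0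
      · have : IsEmpty D := Fintype.card_eq_zero_iff.1 hD0
        have hE : IsEmpty (Fin (l + 1) → D × D) := ⟨fun w => this.false (w 0).1⟩
        rw [Finset.univ_eq_empty, Finset.biUnion_empty]
        simp only [Finset.card_empty, Nat.cast_zero]
        positivity
      have hD : 0 < (Fintype.card D : ℝ) := by exact_mod_cast Nat.pos_of_ne_zero hD0
      have hle : ∀ w ∈ (Finset.univ : Finset (Fin (l + 1) → D × D)),
          ∀ S ∈ (Finset.range (l + 1)).powerset, ((bad (l + 1) w S).card : ℝ) ≤
            (q : ℝ) ^ M / (8 * (Fintype.card D : ℝ) ^ 2) ^ (l + 1) := by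
        intro w _ S hS
        rw [le_div_iff₀ (by positivity)]
        exact_mod_cast hbad (l + 1) w S hS
      calc ((Finset.univ.biUnion fun w : Fin (l + 1) → D × D =>
            (Finset.range (l + 1)).powerset.biUnion fun S => bad (l + 1) w S).card : ℝ)
          ≤ ∑ w : Fin (l + 1) → D × D, ∑ S ∈ (Finset.range (l + 1)).powerset,
              ((bad (l + 1) w S).card : ℝ) := by
            refine (Nat.cast_le.2 Finset.card_biUnion_le).trans ?_
            push_cast
            refine Finset.sum_le_sum fun w _ => ?_
            exact_mod_cast Finset.card_biUnion_le
        _ ≤ ∑ w : Fin (l + 1) → D × D, ∑ S ∈ (Finset.range (l + 1)).powerset,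
              (q : ℝ) ^ M / (8 * (Fintype.card D : ℝ) ^ 2) ^ (l + 1) :=
            Finset.sum_le_sum fun w hw => Finset.sum_le_sum fun S hS => hle w hw S hS
        -- The |D|^(2ℓ) choices of `w` and the 2^ℓ choices of `S` use up all but 4^ℓ of the factor
        -- (8 |D|²)^ℓ, where ℓ = l + 1.
        _ = (q : ℝ) ^ M * (1 / 4) ^ (l + 1) := by
            simp only [Finset.sum_const, Finset.card_univ, Fintype.card_fun, Fintype.card_prod,
              Fintype.card_fin, Finset.card_powerset, Finset.card_range, nsmul_eq_mul]
            push_cast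
            have : (8 * (Fintype.card D : ℝ) ^ 2) ^ (l + 1) =
                2 ^ (l + 1) * ((Fintype.card D : ℝ) * Fintype.card D) ^ (l + 1) * 4 ^ (l + 1) := by
              rw [← mul_pow, ← mul_pow]; congr 1; ring
            rw [this, one_div, inv_pow]
            field_simp
    calc (Bad.card : ℝ) ≤ ∑ l ∈ Finset.range M, (q : ℝ) ^ M * (1 / 4) ^ (l + 1) := by
          refine (Nat.cast_le.2 Finset.card_biUnion_le).trans ?_
          push_cast
          exact Finset.sum_le_sum h1
      _ = (q : ℝ) ^ M * ∑ l ∈ Finset.range M, (1 / 4) ^ (l + 1) := by rw [Finset.mul_sum]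
      _ < (q : ℝ) ^ M * 1 := by
          have : (0 : ℝ) < (q : ℝ) ^ M := by positivity
          exact mul_lt_mul_of_pos_left (sum_inv_four_pow_lt M) this
      _ = _ := mul_one _
  obtain ⟨g, hg⟩ : ∃ g, g ∉ Bad := by
    by_contra! h
    have : Bad = Finset.univ := Finset.eq_univ_iff_forall.2 h
    rw [this, Finset.card_univ] at hBad
    simp [q] at hBad
  refine ⟨extend 0 g, ?_⟩
  intro x x' s ℓ hlt hne hℓ
  by_contra hcon
  push Not at hcon
  obtain ⟨l, rfl⟩ : ∃ l, ℓ = l + 1 := by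
    cases ℓ with
    | zero => simp at hcon
    | succ l => exact ⟨l, rfl⟩
  apply hg
  set S := (Finset.range (l + 1)).filter fun j =>
    treeEncode (extend 0 g) ι x (s + j) = treeEncode (extend 0 g) ι x' (s + j) with hS
  let w : Fin (l + 1) → D × D := fun i => (x (s + i), x' (s + i))
  simp only [Bad, Finset.mem_biUnion, Finset.mem_range, Finset.mem_univ, true_and]
  refine ⟨l, by omega, w, S, Finset.mem_powerset.2 (Finset.filter_subset _ _), ?_⟩
  simp only [bad, Finset.mem_filter, Finset.mem_univ, true_and]
  refine ⟨?_, by omega, hcon, ?_⟩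
  · simp only [δ, extend, w, Nat.succ_pos, dif_pos, add_zero]
    exact sub_ne_zero.2 fun h => hne (hι h)
  · intro j hj
    obtain ⟨hj1, hj2⟩ := Finset.mem_filter.1 hj
    have hj1 := Finset.mem_range.1 hj1
    -- By linearity the common prefix drops out, and since a convolution is invariant under time
    -- shifts, the difference only depends on the symbols from `s` on. Hence the events need not be
    -- indexed by `s`.
    have h3 : treeEncode (extend 0 g) ι x (s + j) - treeEncode (extend 0 g) ι x' (s + j) =
        conv (extend 0 g) (δ w) j := by
      unfold treeEncode conv
      rw [← Finset.sum_sub_distrib, show s + j + 1 = s + (j + 1) by ring, Finset.sum_range_add]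
      rw [Finset.sum_eq_zero fun i hi => by rw [hlt i (Finset.mem_range.1 hi)]; ring, zero_add]
      refine Finset.sum_congr rfl fun i hi => ?_
      have hi := Finset.mem_range.1 hi
      rw [show s + j - (s + i) = j - i by omega]
      simp only [δ, w]
      rw [extend_of_lt _ _ (show i < l + 1 by omega)]
      ring
    rw [← h3, hj2, sub_self]

end TreeCode

/-! ### Minimum distance decoding and the number of decoding errors. -/

section TreeDecode

variable {F D : Type} [Field F] [DecidableEq F]

/-- The indices in `S` at which the received symbol is neither erased nor the encoding of `x`. -/
def mismatches (G : ℕ → F) (ι : D → F) (S : Finset ℕ) (o : ℕ → Option F) (x : ℕ → D) : Finset ℕ :=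
  S.filter fun i => o i ≠ none ∧ o i ≠ some (treeEncode G ι x i)

lemma card_mismatches_split (G : ℕ → F) (ι : D → F) {s k : ℕ} (h : s ≤ k) (o : ℕ → Option F)
    (x : ℕ → D) : (mismatches G ι (Finset.range k) o x).card =
      (mismatches G ι (Finset.range s) o x).card + (mismatches G ι (Finset.Ico s k) o x).card := by
  unfold mismatches
  rw [← Finset.card_union_of_disjoint, ← Finset.filter_union, Finset.range_eq_Ico,
    Finset.range_eq_Ico, Finset.Ico_union_Ico_eq_Ico (Nat.zero_le _) h]
  refine Finset.disjoint_filter_filter ?_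
  rw [Finset.range_eq_Ico]
  exact Finset.Ico_disjoint_Ico_consecutive 0 s k

variable [Nonempty D]

/-- Minimum distance decoding of the first `k` received symbols. -/
def treeDecode (G : ℕ → F) (ι : D → F) (k : ℕ) (o : ℕ → Option F) : ℕ → D :=
  Function.argmin fun x => (mismatches G ι (Finset.range k) o x).card

lemma treeDecode_congr (G : ℕ → F) (ι : D → F) {k : ℕ} {o o' : ℕ → Option F}
    (h : ∀ i < k, o i = o' i) : treeDecode G ι k o = treeDecode G ι k o' := by
  have : (fun x => (mismatches G ι (Finset.range k) o x).card) =
      fun x => (mismatches G ι (Finset.range k) o' x).card := by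
    funext x
    congr 1
    refine Finset.filter_congr fun i hi => ?_
    rw [h i (Finset.mem_range.1 hi)]
  unfold treeDecode
  simp only [this]

lemma card_mismatches_treeDecode_le (G : ℕ → F) (ι : D → F) (k : ℕ) (o : ℕ → Option F)
    (x : ℕ → D) : (mismatches G ι (Finset.range k) o (treeDecode G ι k o)).card ≤
      (mismatches G ι (Finset.range k) o x).card :=
  Function.argmin_le (fun x => (mismatches G ι (Finset.range k) o x).card) x

/-- Symbol number `i` is received, but the received symbols do not decode to `x`. -/
def Misled (G : ℕ → F) (ι : D → F) (o : ℕ → Option F) (x : ℕ → D) (i : ℕ) : Prop :=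
  o i ≠ none ∧ ∃ j ≤ i, treeDecode G ι (i + 1) o j ≠ x j

open Classical in
/-- The number of decoding errors is small if few symbols are corrupted, however many are erased. -/
theorem card_misled_le {a M : ℕ} {G : ℕ → F} {ι : D → F} (hG : IsTreeCode a M G ι)
    (o : ℕ → Option F) (x : ℕ → D) {k : ℕ} (hk : k ≤ M) :
    a * ((Finset.range k).filter (Misled G ι o x)).card ≤
      k + 2 * a * (mismatches G ι (Finset.range k) o x).card := by
  induction k using Nat.strong_induction_on with
  | _ k ih =>
    rcases k with _ | k
    · simp
    -- If the last index is misled, the interval from the first wrongly decoded position `s` is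
    -- estimated at once and induction is used below `s`; otherwise the last index is dropped.
    by_cases hb : Misled G ι o x k
    · obtain ⟨hu, hj⟩ := hb
      set y := treeDecode G ι (k + 1) o with hy
      let s := Nat.find hj
      have hs : s ≤ k ∧ y s ≠ x s := Nat.find_spec hj
      have hlt : ∀ i < s, x i = y i := by
        intro i hi
        have := Nat.find_min hj hi
        push Not at this
        exact (this (by omega)).symm
      have h1 := hG x y s (k + 1 - s) hlt hs.2.symm (by omega)
      have h2 := ih s (by omega) (by omega)
      have hagree : ((Finset.Ico s (k + 1)).filter
          fun i => treeEncode G ι x i = treeEncode G ι y i).card ≤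
          ((Finset.range (k + 1 - s)).filter
            fun j => treeEncode G ι x (s + j) = treeEncode G ι y (s + j)).card := by
        refine Finset.card_le_card_of_injOn (fun i => i - s) ?_ ?_
        · intro i hi
          simp only [Finset.coe_filter, Finset.mem_Ico, Set.mem_ofPred_eq, Finset.mem_range] at hi ⊢
          rw [show s + (i - s) = i by omega]
          exact ⟨by omega, hi.2⟩
        · intro i hi i' hi' h
          simp only [Finset.coe_filter, Finset.mem_Ico, Set.mem_ofPred_eq] at hi hi' h
          omega
      -- Before `s` the codewords of `x` and `y` coincide, so optimality of `y` on the whole range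
      -- is optimality on the interval.
      have hmis : (mismatches G ι (Finset.Ico s (k + 1)) o y).card ≤
          (mismatches G ι (Finset.Ico s (k + 1)) o x).card := by
        have h3 := card_mismatches_treeDecode_le G ι (k + 1) o x
        rw [← hy, card_mismatches_split G ι (show s ≤ k + 1 by omega),
          card_mismatches_split G ι (show s ≤ k + 1 by omega) o x] at h3
        have h4 : mismatches G ι (Finset.range s) o y = mismatches G ι (Finset.range s) o x := by
          refine Finset.filter_congr fun i hi => ?_
          rw [treeEncode_congr G ι (x := x) (x' := y) fun j hj => hlt j (by
            have := Finset.mem_range.1 hi; omega)]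
        rw [h4] at h3
        omega
      -- At an unerased index either the two codewords agree, or the received symbol differs from at
      -- least one of them. Whether the index is misled plays no further role.
      have hcov : ((Finset.Ico s (k + 1)).filter (Misled G ι o x)).card ≤
          ((Finset.Ico s (k + 1)).filter
            fun i => treeEncode G ι x i = treeEncode G ι y i).card +
          (mismatches G ι (Finset.Ico s (k + 1)) o y).card +
          (mismatches G ι (Finset.Ico s (k + 1)) o x).card := by
        refine le_trans (Finset.card_le_card (t := ((Finset.Ico s (k + 1)).filter
            fun i => treeEncode G ι x i = treeEncode G ι y i) ∪
            mismatches G ι (Finset.Ico s (k + 1)) o y ∪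
            mismatches G ι (Finset.Ico s (k + 1)) o x) ?_) ?_
        · intro i hi
          obtain ⟨hi1, hi2⟩ := Finset.mem_filter.1 hi
          have hi3 := hi2.1
          simp only [mismatches, Finset.mem_union, Finset.mem_filter, hi1, true_and]
          by_cases h5 : o i = some (treeEncode G ι y i)
          · by_cases h6 : treeEncode G ι x i = treeEncode G ι y i
            · exact Or.inl (Or.inl h6)
            · exact Or.inr ⟨hi3, fun h => h6 (Option.some_injective _ (h.symm.trans h5))⟩
          · exact Or.inl (Or.inr ⟨hi3, h5⟩)
        · exact (Finset.card_union_le _ _).trans (Nat.add_le_add_right (Finset.card_union_le _ _) _)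
      have hsplit : ((Finset.range (k + 1)).filter (Misled G ι o x)).card ≤
          ((Finset.range s).filter (Misled G ι o x)).card +
          ((Finset.Ico s (k + 1)).filter (Misled G ι o x)).card := by
        rw [Finset.range_eq_Ico,
          ← Finset.Ico_union_Ico_eq_Ico (Nat.zero_le s) (show s ≤ k + 1 by omega),
          Finset.filter_union, ← Finset.range_eq_Ico]
        exact Finset.card_union_le _ _
      have hm := card_mismatches_split G ι (show s ≤ k + 1 by omega) o x
      have e1 := Nat.mul_le_mul_left a (hsplit.trans (Nat.add_le_add_left
        (hcov.trans (Nat.add_le_add_right (Nat.add_le_add hagree hmis) _)) _))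
      rw [hm]
      have hs1 := hs.1
      have e2 : s + (k + 1 - s) = k + 1 := by omega
      nlinarith [e1, h1, h2, e2]
    · rw [Finset.range_add_one, Finset.filter_insert, if_neg hb, ← Finset.range_add_one]
      have h2 := ih k (by omega) (by omega)
      have hm := card_mismatches_split G ι (show k ≤ k + 1 by omega) o x
      rw [hm]
      nlinarith [h2]

end TreeDecode

/-! ### Reduced words of operations -/

/-- Labels of Pauli operators up to phase. -/
abbrev Pauli : Type := Fin 2 × Fin 2

lemma Pauli.add_self (P : Pauli) : P + P = 0 := by revert P; decide

/-- What a party does in one turn: a Pauli correction, the next unitary, the inverse of the last one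
or nothing, and the outcome of the Bell measurement of the teleportation. -/
abbrev TurnLog : Type := (Pauli × Option Bool) × Pauli

/-- A letter of a word: a Pauli operator followed by the next unitary, or the inverse of the last
one, of a party. -/
abbrev Letter : Type := Pauli × Bool × Bool

/-- A word, last letter first, and a pending Pauli operator. -/
abbrev Word : Type := List Letter × Pauli

/-- A cancellation requires that no Pauli operator stands between a move and its inverse. The Pauli
operator of the cancelled letter then becomes the pending one. -/
def Word.applyOp (p : Bool) : Option Bool → Word → Word
  | none, w => w
  | some d, (e :: l, P) =>
    if P = 0 ∧ e.2.1 = p ∧ e.2.2 = !d then (l, e.1) else ((P, p, d) :: e :: l, 0)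
  | some d, ([], P) => ([(P, p, d)], 0)

/-- The word after a turn of party `p`. -/
def Word.step (p : Bool) (x : TurnLog) (w : Word) : Word :=
  let w' := Word.applyOp p x.1.2 (w.1, w.2 + x.1.1)
  (w'.1, w'.2 + x.2)

/-- The words that are a prefix of the noiseless protocol. -/
def Clean : List Letter → Prop
  | [] => True
  | e :: l => e = (0, l.length.bodd, true) ∧ Clean l

open Classical in
/-- The length of the longest clean prefix. -/
def cleanLength : List Letter → ℕ
  | [] => 0
  | e :: l => if Clean (e :: l) then l.length + 1 else cleanLength l

lemma cleanLength_of_clean {l : List Letter} (h : Clean l) : cleanLength l = l.length := by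
  cases l with
  | nil => rfl
  | cons e l => simp [cleanLength, h]

lemma cleanLength_of_not_clean {e : Letter} {l : List Letter} (h : ¬ Clean (e :: l)) :
    cleanLength (e :: l) = cleanLength l := by simp [cleanLength, h]

lemma cleanLength_le (l : List Letter) : cleanLength l ≤ l.length := by
  induction l with
  | nil => simp [cleanLength]
  | cons e l ih =>
    unfold cleanLength
    split_ifs
    · simp
    · simp; omega

lemma le_cleanLength_cons (e : Letter) (l : List Letter) : cleanLength l ≤ cleanLength (e :: l) := by
  by_cases h : Clean (e :: l)
  · rw [cleanLength_of_clean h, List.length_cons]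
    have := cleanLength_le l
    omega
  · rw [cleanLength_of_not_clean h]

/-- The length of the clean prefix minus three times the length of the rest. -/
def potential (l : List Letter) : ℤ := 4 * cleanLength l - 3 * l.length

lemma potential_cons_ge (e : Letter) (l : List Letter) :
    potential l - 3 ≤ potential (e :: l) := by
  have := le_cleanLength_cons e l
  simp only [potential, List.length_cons]; push_cast; omega

lemma potential_cons_of_clean {e : Letter} {l : List Letter} (h : Clean (e :: l)) :
    potential (e :: l) = potential l + 1 := by
  have h2 : Clean l := h.2
  simp only [potential, cleanLength_of_clean h, cleanLength_of_clean h2, List.length_cons]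
  push_cast; ring

lemma potential_cons_of_not_clean {e : Letter} {l : List Letter} (h : ¬ Clean (e :: l)) :
    potential (e :: l) = potential l - 3 := by
  simp only [potential, cleanLength_of_not_clean h, List.length_cons]
  push_cast; ring

/-- The worst step is a wrong new letter, which costs 3. Cancelling a letter of a clean word costs
only 1. -/
lemma potential_step_ge (p : Bool) (x : TurnLog) (w : Word) :
    potential w.1 - 3 ≤ potential (w.step p x).1 := by
  obtain ⟨l, P⟩ := w
  obtain ⟨⟨Q, o⟩, R⟩ := x
  cases o with
  | none => simp [Word.step, Word.applyOp]
  | some d =>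
    cases l with
    | nil => exact potential_cons_ge _ _
    | cons e l =>
      simp only [Word.step, Word.applyOp]
      split_ifs with h
      · by_cases hc : Clean (e :: l)
        · rw [potential_cons_of_clean hc]; simp
        · rw [potential_cons_of_not_clean hc]; simp only []; omega
      · exact potential_cons_ge _ _

open Classical in
/-- The action of party `p` that makes progress. -/
def bestAction (p : Bool) (w : Word) : Pauli × Option Bool :=
  (w.2, if Clean w.1 then (if p = w.1.length.bodd then some true else none) else
    match w.1 with
    | e :: _ => if e.2.1 = p then some (!e.2.2) else none
    | [] => none)

lemma step_fst_of_none {p : Bool} {x : TurnLog} {w : Word} (h : x.1.2 = none) :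
    (w.step p x).1 = w.1 := by
  simp [Word.step, h, Word.applyOp]

/-- The correction makes the pending Pauli operator trivial. The move then extends a clean word, a
gain of 1, or cancels a letter outside the clean prefix, a gain of 3. -/
lemma potential_step_bestAction {p : Bool} {x : TurnLog} {w : Word} (hx : x.1 = bestAction p w)
    (h : (bestAction p w).2 ≠ none) : potential w.1 + 1 ≤ potential (w.step p x).1 := by
  obtain ⟨l, P⟩ := w
  obtain ⟨x1, R⟩ := x
  simp only at hx
  subst hx
  by_cases hc : Clean l
  · simp only [bestAction, hc, if_true] at h ⊢
    have hp : p = l.length.bodd := by by_contra hp; simp [hp] at h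
    rw [if_pos hp]
    have : (Word.step p ((P, some true), R) (l, P)).1 = (0, p, true) :: l := by
      cases l with
      | nil => simp [Word.step, Word.applyOp, Pauli.add_self]
      | cons e l =>
        have h1 : e = (0, l.length.bodd, true) := hc.1
        simp [Word.step, Word.applyOp, Pauli.add_self, h1]
    rw [this, potential_cons_of_clean ⟨by rw [hp], hc⟩]
  · cases l with
    | nil => exact absurd trivial hc
    | cons e l =>
      simp only [bestAction, hc, if_false] at h ⊢
      have hp : e.2.1 = p := by by_contra hp; simp [hp] at h
      rw [if_pos hp]
      have : (Word.step p ((P, some (!e.2.2)), R) (e :: l, P)).1 = l := by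
        simp [Word.step, Word.applyOp, Pauli.add_self, hp]
      rw [this, potential_cons_of_not_clean hc]
      omega
    
lemma potential_step_bestAction_ge {p : Bool} {x : TurnLog} {w : Word}
    (hx : x.1 = bestAction p w) : potential w.1 ≤ potential (w.step p x).1 := by
  by_cases h : (bestAction p w).2 = none
  · rw [step_fst_of_none (by rw [hx, h])]
  · linarith [potential_step_bestAction hx h]

/-- Either party can make progress on any word. -/
lemma bestAction_ne_none_or (p : Bool) (l : List Letter) (P P' : Pauli)
    (h : (bestAction p (l, P)).2 = none) : (bestAction (!p) (l, P')).2 ≠ none := by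
  by_cases hc : Clean l
  · simp only [bestAction, hc, if_true] at h ⊢
    revert h
    cases p <;> cases l.length.bodd <;> simp
  · cases l with
    | nil => exact absurd trivial hc
    | cons e l =>
      simp only [bestAction, hc, if_false] at h ⊢
      revert h
      cases p <;> cases e.2.1 <;> simp

/-- The word after `r` turns of either party. -/
def wordAfter (a b : ℕ → TurnLog) : ℕ → Word
  | 0 => ([], 0)
  | r + 1 => Word.step true (b r) (Word.step false (a r) (wordAfter a b r))

/-- The word before turn `r` of party `p`. -/
def wordBefore (a b : ℕ → TurnLog) (p : Bool) (r : ℕ) : Word :=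
  if p then Word.step false (a r) (wordAfter a b r) else wordAfter a b r

lemma wordAfter_congr {a b a' b' : ℕ → TurnLog} {r : ℕ} (ha : ∀ i < r, a i = a' i)
    (hb : ∀ i < r, b i = b' i) : wordAfter a b r = wordAfter a' b' r := by
  induction r with
  | zero => rfl
  | succ r ih =>
    rw [wordAfter, wordAfter, ih (fun i hi => ha i (by omega)) (fun i hi => hb i (by omega)),
      ha r (by omega), hb r (by omega)]

/-! ### The classical control -/

section Control

variable {F : Type} [Field F] [DecidableEq F]

/-- The action of party `p` in turn `r`, given its own log and the symbols received. -/
def action (G : ℕ → F) (ι : TurnLog → F) (p : Bool) (r : ℕ) (own : ℕ → TurnLog)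
    (rcv : ℕ → Option F) : Pauli × Option Bool :=
  match p with
  | false => if r = 0 ∨ rcv (r - 1) = none then (0, none) else
      bestAction false (wordBefore own (treeDecode G ι r rcv) false r)
  | true => if rcv r = none then (0, none) else
      bestAction true (wordBefore (treeDecode G ι (r + 1) rcv) own true r)

/-- Causality of the control. In turn `r` Alice has received `r` symbols and Bob, who acts after
her, one more; this is the summand `p.toNat`. -/
lemma action_congr (G : ℕ → F) (ι : TurnLog → F) (p : Bool) {r : ℕ} {own own' : ℕ → TurnLog}
    {rcv rcv' : ℕ → Option F} (h : ∀ i < r, own i = own' i)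
    (h' : ∀ i < r + p.toNat, rcv i = rcv' i) :
    action G ι p r own rcv = action G ι p r own' rcv' := by
  cases p with
  | false =>
    simp only [Bool.toNat_false, add_zero] at h'
    simp only [action]
    rw [treeDecode_congr G ι h']
    rcases Nat.eq_zero_or_pos r with hr | hr
    · simp [hr]
    · rw [h' (r - 1) (by omega)]
      simp only [wordBefore, Bool.false_eq_true, if_false]
      rw [wordAfter_congr h fun _ _ => rfl]
  | true =>
    simp only [Bool.toNat_true] at h'
    simp only [action]
    rw [treeDecode_congr G ι h', h' r (by omega)]
    simp only [wordBefore, if_true]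
    rw [wordAfter_congr (fun _ _ => rfl) h]

variable {G : ℕ → F} {ι : TurnLog → F}

/-- Bob's symbol number `r` arrives before Alice's turn `r + 1`, hence the shift of the index. -/
lemma action_false_of_not_misled {a b : ℕ → TurnLog} {v : ℕ → Option F} {r : ℕ}
    (h : v r ≠ none) (h' : ¬ Misled G ι v b r) :
    action G ι false (r + 1) a v = bestAction false (wordBefore a b false (r + 1)) := by
  have : ∀ j < r + 1, treeDecode G ι (r + 1) v j = b j := by
    intro j hj
    by_contra hne
    exact h' ⟨h, j, by omega, hne⟩
  simp only [action, Nat.add_sub_cancel, h, or_false, wordBefore, Bool.false_eq_true, if_false]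
  rw [if_neg (by omega), wordAfter_congr (fun _ _ => rfl) this]

lemma action_true_of_not_misled {a b : ℕ → TurnLog} {u : ℕ → Option F} {r : ℕ}
    (h : u r ≠ none) (h' : ¬ Misled G ι u a r) :
    action G ι true r b u = bestAction true (wordBefore a b true r) := by
  have : ∀ j < r + 1, treeDecode G ι (r + 1) u j = a j := by
    intro j hj
    by_contra hne
    exact h' ⟨h, j, by omega, hne⟩
  simp only [action, h, if_false, wordBefore, if_true]
  rw [this r (by omega), wordAfter_congr (fun i hi => this i (by omega)) fun _ _ => rfl]

open Classical in
/-- The number of elements of `S` with the property `p`. -/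
def count (k : ℕ) (p : ℕ → Prop) : ℕ := ((Finset.range k).filter p).card

open Classical in
lemma count_succ (k : ℕ) (p : ℕ → Prop) : count (k + 1) p = count k p + if p k then 1 else 0 := by
  unfold count
  rw [Finset.range_add_one, Finset.filter_insert]
  split_ifs with h
  · rw [Finset.card_insert_of_notMem (by simp)]
  · rfl

variable {m : ℕ} {a b : ℕ → TurnLog} {u v : ℕ → Option F}

/-- A round is counted as a turn of Bob followed by the next turn of Alice. If both know the word,
one of them can gain at least 1 and the other loses nothing. An erased symbol forfeits that unit,
and a misled turn forfeits it and may lose 3 more. -/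
lemma potential_before_bob_ge (ha : ∀ r < m, (a r).1 = action G ι false r a v)
    (hb : ∀ r < m, (b r).1 = action G ι true r b u) {r : ℕ} (hr : r < m) :
    (r : ℤ) - count r (fun i => u i = none) - count r (fun i => v i = none) -
      4 * (count r (Misled G ι u a) + count r (Misled G ι v b)) ≤
      potential (wordBefore a b true r).1 := by
  induction r with
  | zero =>
    -- Alice's first turn is idle, as she has received nothing yet.
    have h0 := ha 0 hr
    simp only [action, true_or, if_true] at h0
    simp only [wordBefore, if_true]
    rw [step_fst_of_none (by rw [h0])]
    simp [wordAfter, potential, cleanLength, count]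
  | succ r ih =>
    have ih := ih (by omega)
    have hbr := hb r (by omega)
    have har := ha (r + 1) hr
    set w := wordBefore a b true r with hw
    set w' := Word.step true (b r) w with hw'
    have hw1 : wordBefore a b false (r + 1) = w' := by
      simp [wordBefore, wordAfter, hw, hw']
    have hw2 : wordBefore a b true (r + 1) = Word.step false (a (r + 1)) w' := by
      simp [wordBefore, wordAfter, hw, hw']
    rw [hw2]
    simp only [count_succ]
    have hB := potential_step_ge true (b r) w
    have hA := potential_step_ge false (a (r + 1)) w'
    rw [← hw'] at hB
    have hBn : u r = none → w'.1 = w.1 := fun h => by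
      refine step_fst_of_none ?_
      rw [hbr]; simp [action, h]
    have hAn : v r = none → (Word.step false (a (r + 1)) w').1 = w'.1 := fun h => by
      refine step_fst_of_none ?_
      rw [har]; simp [action, h]
    have hBg : u r ≠ none → ¬ Misled G ι u a r → (b r).1 = bestAction true w := fun h h' => by
      rw [hbr, action_true_of_not_misled h h']
    have hAg : v r ≠ none → ¬ Misled G ι v b r → (a (r + 1)).1 = bestAction false w' :=
      fun h h' => by rw [har, action_false_of_not_misled h h', hw1]
    have mu : Misled G ι u a r → u r ≠ none := fun h => h.1
    have mv : Misled G ι v b r → v r ≠ none := fun h => h.1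
    push_cast
    by_cases h1 : u r = none
    · have m1 : ¬ Misled G ι u a r := fun h => mu h h1
      rw [← hBn h1] at ih
      by_cases h2 : v r = none
      · have m2 : ¬ Misled G ι v b r := fun h => mv h h2
        rw [hAn h2]
        simp only [h1, h2, m1, m2, if_true, if_false]
        linarith
      · by_cases m2 : Misled G ι v b r
        · simp only [h1, h2, m1, m2, if_true, if_false]
          linarith
        · have := potential_step_bestAction_ge (hAg h2 m2)
          simp only [h1, h2, m1, m2, if_true, if_false]
          linarith
    · by_cases m1 : Misled G ι u a r
      · by_cases h2 : v r = none
        · have m2 : ¬ Misled G ι v b r := fun h => mv h h2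
          rw [hAn h2]
          simp only [h1, h2, m1, m2, if_true, if_false]
          linarith
        · by_cases m2 : Misled G ι v b r
          · simp only [h1, h2, m1, m2, if_true, if_false]
            linarith
          · have := potential_step_bestAction_ge (hAg h2 m2)
            simp only [h1, h2, m1, m2, if_true, if_false]
            linarith
      · have gB := potential_step_bestAction_ge (hBg h1 m1)
        rw [← hw'] at gB
        by_cases h2 : v r = none
        · have m2 : ¬ Misled G ι v b r := fun h => mv h h2
          rw [hAn h2]
          simp only [h1, h2, m1, m2, if_true, if_false]
          linarith
        · by_cases m2 : Misled G ι v b r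
          · simp only [h1, h2, m1, m2, if_true, if_false]
            linarith
          · have gA := potential_step_bestAction_ge (hAg h2 m2)
            simp only [h1, h2, m1, m2, if_false]
            -- If Bob has no useful move, the letters stay unchanged and the useful move is Alice's.
            by_cases hact : (bestAction true w).2 = none
            · have e1 : w'.1 = w.1 := step_fst_of_none (by rw [hBg h1 m1, hact])
              have e2 : (bestAction false w').2 ≠ none := by
                have := bestAction_ne_none_or true w.1 w.2 w'.2 hact
                rw [← e1] at this
                exact this
              have := potential_step_bestAction (hAg h2 m2) e2
              rw [e1] at this
              linarith
            · have := potential_step_bestAction (hBg h1 m1) hact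
              rw [← hw'] at this
              linarith

/-- The progress of the simulation in terms of the numbers of erased and corrupted symbols. -/
theorem potential_wordAfter_ge {c : ℕ} (hG : IsTreeCode c m G ι) (hm : 1 ≤ m)
    (ha : ∀ r < m, (a r).1 = action G ι false r a v)
    (hb : ∀ r < m, (b r).1 = action G ι true r b u) :
    (c : ℤ) * ((m : ℤ) - 1 - count m (fun i => u i = none) - count m (fun i => v i = none)) -
      8 * (m + c * ((mismatches G ι (Finset.range m) u a).card +
        (mismatches G ι (Finset.range m) v b).card)) ≤
      c * potential (wordAfter a b m).1 := by
  obtain ⟨r, rfl⟩ : ∃ r, m = r + 1 := ⟨m - 1, by omega⟩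
  have h1 := potential_before_bob_ge ha hb (show r < r + 1 by omega)
  have hbr := hb r (by omega)
  -- Bob's last turn is not followed by a turn of Alice within the count. It is only shown to be
  -- harmless, so the total is m - 1 units.
  have h2 : (r : ℤ) - count (r + 1) (fun i => u i = none) - count (r + 1) (fun i => v i = none) -
      4 * (count (r + 1) (Misled G ι u a) + count (r + 1) (Misled G ι v b)) ≤
      potential (wordAfter a b (r + 1)).1 := by
    have hw : wordAfter a b (r + 1) = Word.step true (b r) (wordBefore a b true r) := by
      simp [wordAfter, wordBefore]
    rw [hw]
    have hB := potential_step_ge true (b r) (wordBefore a b true r)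
    simp only [count_succ]
    push_cast
    by_cases h1 : u r = none
    · have : (Word.step true (b r) (wordBefore a b true r)).1 = (wordBefore a b true r).1 := by
        refine step_fst_of_none ?_
        rw [hbr]; simp [action, h1]
      rw [this]
      simp only [h1, if_true]
      split_ifs <;> linarith
    · by_cases m1 : Misled G ι u a r
      · simp only [h1, m1, if_true, if_false]
        split_ifs <;> linarith
      · have := potential_step_bestAction_ge (p := true) (x := b r) (w := wordBefore a b true r)
          (by rw [hbr, action_true_of_not_misled h1 m1])
        simp only [h1, m1, if_false]
        split_ifs <;> linarith
  have hu := card_misled_le hG u a le_rfl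
  have hv := card_misled_le hG v b le_rfl
  -- The penalty 4 per misled turn, multiplied by the constants of `card_misled_le` in both
  -- directions, produces the factor 8.
  have e1 : c * count (r + 1) (Misled G ι u a) ≤
      (r + 1) + 2 * c * (mismatches G ι (Finset.range (r + 1)) u a).card := hu
  have e2 : c * count (r + 1) (Misled G ι v b) ≤
      (r + 1) + 2 * c * (mismatches G ι (Finset.range (r + 1)) v b).card := hv
  zify at e1 e2
  have e3 := mul_le_mul_of_nonneg_left h2 (show (0 : ℤ) ≤ c by positivity)
  push_cast at *
  nlinarith [e1, e2, e3]

end Control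

/-! ### Operators on a part of a register -/

section LiftEquiv

variable {I J R : Type} [DecidableEq R]

/-- The operator `M` on a tensor factor. -/
def liftEquiv (e : I ≃ J × R) (M : Matrix J J ℂ) : Matrix I I ℂ :=
  (M ⊗ₖ (1 : Matrix R R ℂ)).submatrix e e

lemma liftEquiv_apply (e : I ≃ J × R) (M : Matrix J J ℂ) (i i' : I) :
    liftEquiv e M i i' = if (e i).2 = (e i').2 then M (e i).1 (e i').1 else 0 := by
  simp [liftEquiv, Matrix.kroneckerMap_apply, Matrix.one_apply]

lemma liftEquiv_one [DecidableEq I] [DecidableEq J] (e : I ≃ J × R) :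
    liftEquiv e (1 : Matrix J J ℂ) = 1 := by
  simp [liftEquiv]

lemma liftEquiv_conjTranspose (e : I ≃ J × R) (M : Matrix J J ℂ) :
    (liftEquiv e M)ᴴ = liftEquiv e Mᴴ := by
  simp [liftEquiv, Matrix.conjTranspose_submatrix, Matrix.conjTranspose_kronecker]

lemma liftEquiv_zero (e : I ≃ J × R) : liftEquiv e (0 : Matrix J J ℂ) = 0 := by
  ext; simp [liftEquiv_apply]

lemma liftEquiv_sum {α : Type} (s : Finset α) (e : I ≃ J × R) (M : α → Matrix J J ℂ) :
    liftEquiv e (∑ a ∈ s, M a) = ∑ a ∈ s, liftEquiv e (M a) := by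
  ext i i'
  simp only [liftEquiv_apply, Matrix.sum_apply]
  split_ifs <;> simp

variable [Fintype I] [Fintype J] [Fintype R]

lemma liftEquiv_mul (e : I ≃ J × R) (M N : Matrix J J ℂ) :
    liftEquiv e (M * N) = liftEquiv e M * liftEquiv e N := by
  simp only [liftEquiv]
  rw [Matrix.submatrix_mul_equiv, ← Matrix.mul_kronecker_mul, one_mul]

/-- The action of an operator on a tensor factor. -/
lemma liftEquiv_mul_apply {K : Type} (e : I ≃ J × R) (M : Matrix J J ℂ) (V : Matrix I K ℂ) (i : I)
    (k : K) : (liftEquiv e M * V) i k = ∑ j, M (e i).1 j * V (e.symm (j, (e i).2)) k := by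
  rw [Matrix.mul_apply, ← e.symm.sum_comp, Fintype.sum_prod_type]
  refine Finset.sum_congr rfl fun j _ => ?_
  simp only [liftEquiv_apply, Equiv.apply_symm_apply, ite_mul, zero_mul]
  rw [Finset.sum_ite_eq]
  simp

variable [DecidableEq I] [DecidableEq J]

/-- `liftEquiv` as a homomorphism of unitary groups. -/
def liftUnitary (e : I ≃ J × R) : Matrix.unitaryGroup J ℂ →* Matrix.unitaryGroup I ℂ where
  toFun U := ⟨liftEquiv e U.1, by
    rw [Matrix.mem_unitaryGroup_iff, Matrix.star_eq_conjTranspose, liftEquiv_conjTranspose,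
      ← liftEquiv_mul, ← Matrix.star_eq_conjTranspose, Matrix.mem_unitaryGroup_iff.1 U.2,
      liftEquiv_one]⟩
  map_one' := Subtype.ext (liftEquiv_one e)
  map_mul' U V := Subtype.ext (liftEquiv_mul e U.1 V.1)

@[simp] lemma coe_liftUnitary (e : I ≃ J × R) (U : Matrix.unitaryGroup J ℂ) :
    (liftUnitary e U).1 = liftEquiv e U.1 := rfl

end LiftEquiv

/-! ### Pauli operators -/

def pauliMatrix (P : Pauli) : Matrix Qubit Qubit ℂ :=
  Matrix.of fun i j => if i = j + P.1 then (-1) ^ ((P.2 : ℕ) * (j : ℕ)) else 0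

/-- The Pauli operators `X ^ a Z ^ b`. -/
def pauli (P : Pauli) : Matrix.unitaryGroup Qubit ℂ := ⟨pauliMatrix P, by
  rw [Matrix.mem_unitaryGroup_iff]
  ext i j
  obtain ⟨a, b⟩ := P
  fin_cases a <;> fin_cases b <;> fin_cases i <;> fin_cases j <;>
    simp [pauliMatrix, Matrix.mul_apply, Fin.sum_univ_two]⟩

lemma pauli_zero : pauli 0 = 1 := by
  apply Subtype.ext
  ext i j
  fin_cases i <;> fin_cases j <;> simp [pauli, pauliMatrix]

/-- Equality up to sign. -/
def EqUpToSign {G : Type} [Neg G] (x y : G) : Prop := x = y ∨ x = -y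

namespace EqUpToSign

variable {G : Type} [Monoid G] [HasDistribNeg G] {x y z x' y' : G}

lemma refl (x : G) : EqUpToSign x x := Or.inl rfl

lemma mul (h : EqUpToSign x y) (h' : EqUpToSign x' y') : EqUpToSign (x * x') (y * y') := by
  rcases h with rfl | rfl <;> rcases h' with rfl | rfl <;> simp [EqUpToSign]

lemma trans (h : EqUpToSign x y) (h' : EqUpToSign y z) : EqUpToSign x z := by
  rcases h with rfl | rfl <;> rcases h' with rfl | rfl <;> simp [EqUpToSign]

lemma map {G' : Type} [Monoid G'] [HasDistribNeg G'] (f : G → G') (hf : ∀ x, f (-x) = - f x)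
    (h : EqUpToSign x y) : EqUpToSign (f x) (f y) := by
  rcases h with rfl | rfl <;> simp [EqUpToSign, hf]

end EqUpToSign

lemma liftUnitary_neg {I J R : Type} [DecidableEq R] [Fintype I] [Fintype J] [Fintype R]
    [DecidableEq I] [DecidableEq J] (e : I ≃ J × R) (U : Matrix.unitaryGroup J ℂ) :
    liftUnitary e (-U) = - liftUnitary e U := by
  apply Subtype.ext
  ext i j
  simp only [coe_liftUnitary, Unitary.coe_neg, liftEquiv_apply, Matrix.neg_apply]
  split_ifs <;> simp

/-- Moving `Z` past `X` changes the sign. A global sign does not affect the channel, so it is not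
tracked. -/
lemma pauli_mul (P Q : Pauli) : EqUpToSign (pauli P * pauli Q) (pauli (P + Q)) := by
  have key : (pauliMatrix P * pauliMatrix Q = pauliMatrix (P + Q)) ∨
      (pauliMatrix P * pauliMatrix Q = - pauliMatrix (P + Q)) := by
    obtain ⟨a, b⟩ := P
    obtain ⟨c, d⟩ := Q
    have h2 : ∀ s : ℂ, (∀ i j, (pauliMatrix (a, b) * pauliMatrix (c, d)) i j =
        s * pauliMatrix ((a, b) + (c, d)) i j) →
        pauliMatrix (a, b) * pauliMatrix (c, d) = s • pauliMatrix ((a, b) + (c, d)) := by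
      intro s h; ext i j; rw [h]; simp
    by_cases hs : b = 1 ∧ c = 1
    · right
      rw [h2 (-1), neg_one_smul]
      obtain ⟨rfl, rfl⟩ := hs
      intro i j
      fin_cases a <;> fin_cases d <;> fin_cases i <;> fin_cases j <;>
        simp [pauliMatrix, Matrix.mul_apply]
    · left
      rw [h2 1, one_smul]
      intro i j
      fin_cases a <;> fin_cases b <;> fin_cases c <;> fin_cases d <;> simp at hs <;>
        fin_cases i <;> fin_cases j <;> simp [pauliMatrix, Matrix.mul_apply]
  rcases key with h | h
  · exact Or.inl (Subtype.ext h)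
  · exact Or.inr (Subtype.ext h)

/-- The Pauli operators divided by √2 are an orthonormal basis of the operators on a qubit. This
makes the Bell measurement complete. -/
lemma pauliMatrix_completeness (s s' c c' : Qubit) :
    ∑ P : Pauli, star (pauliMatrix P s c) * pauliMatrix P s' c' =
      if s = s' ∧ c = c' then 2 else 0 := by
  rw [Fintype.sum_prod_type]
  simp only [Fin.sum_univ_two, pauliMatrix, Matrix.of_apply]
  fin_cases s <;> fin_cases s' <;> fin_cases c <;> fin_cases c' <;>
    norm_num [show (1 : Fin 2) + 1 = 0 from rfl]

def swapGateMatrix : Matrix (Qubit × Qubit) (Qubit × Qubit) ℂ :=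
  Matrix.of fun p p' => if p.1 = p'.2 ∧ p.2 = p'.1 then 1 else 0

def swapGate : Matrix.unitaryGroup (Qubit × Qubit) ℂ := ⟨swapGateMatrix, by
  rw [Matrix.mem_unitaryGroup_iff]
  ext ⟨i, i'⟩ ⟨j, j'⟩
  rw [Matrix.mul_apply, Fintype.sum_prod_type]
  fin_cases i <;> fin_cases i' <;> fin_cases j <;> fin_cases j' <;>
    simp [swapGateMatrix, Fin.sum_univ_two]⟩

/-! ### The operators applied to the data, the communication qubit and the output qubit -/

section Ops

variable {n : ℕ} {A B : Type} [Fintype A] [DecidableEq A] [Fintype B] [DecidableEq B]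

/-- `A`, `B`, `C` and the output qubit. -/
abbrev Row (A B : Type) : Type := A × B × Qubit × Qubit

def rowEquivAC : Row A B ≃ (A × Qubit) × (B × Qubit) where
  toFun p := ((p.1, p.2.2.1), (p.2.1, p.2.2.2))
  invFun p := (p.1.1, p.2.1, p.1.2, p.2.2)
  left_inv _ := rfl
  right_inv _ := rfl

def rowEquivBC : Row A B ≃ (B × Qubit) × (A × Qubit) where
  toFun p := ((p.2.1, p.2.2.1), (p.1, p.2.2.2))
  invFun p := (p.2.1, p.1.1, p.1.2, p.2.2)
  left_inv _ := rfl
  right_inv _ := rfl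

def rowEquivC : Row A B ≃ Qubit × (A × B × Qubit) where
  toFun p := (p.2.2.1, (p.1, p.2.1, p.2.2.2))
  invFun p := (p.2.1, p.2.2.1, p.1, p.2.2.2)
  left_inv _ := rfl
  right_inv _ := rfl

def rowEquivCC : Row A B ≃ (Qubit × Qubit) × (A × B) where
  toFun p := (p.2.2, (p.1, p.2.1))
  invFun p := (p.2.1, p.2.2, p.1)
  left_inv _ := rfl
  right_inv _ := rfl

def rowEquivABC : Row A B ≃ (A × B × Qubit) × Qubit where
  toFun p := ((p.1, p.2.1, p.2.2.1), p.2.2.2)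
  invFun p := (p.1.1, p.1.2.1, p.1.2.2, p.2)
  left_inv _ := rfl
  right_inv _ := rfl

/-- The `k`-th unitary of party `p` (`true` for Bob): the unitaries of the protocol, then for Alice
the swap of `C` with the output qubit, and the identity for all other `k`. -/
def letterUnitary (P : NoiselessProtocol n A B) : Bool → ℤ → Matrix.unitaryGroup (Row A B) ℂ
  | false, k => if h : 0 ≤ k ∧ k ≤ n then liftUnitary rowEquivAC (P.alice ⟨k.toNat, by omega⟩) else
      if k = n + 1 then liftUnitary rowEquivCC swapGate else 1
  | true, k => if h : 0 ≤ k ∧ k < n then liftUnitary rowEquivBC (P.bob ⟨k.toNat, by omega⟩) else 1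

/-- The operator applied by a party that has advanced to its `k`-th unitary. -/
def moveUnitary (P : NoiselessProtocol n A B) (p : Bool) (k : ℤ) :
    Option Bool → Matrix.unitaryGroup (Row A B) ℂ
  | none => 1
  | some true => letterUnitary P p k
  | some false => (letterUnitary P p (k - 1))⁻¹

def pauliC (A B : Type) [Fintype A] [DecidableEq A] [Fintype B] [DecidableEq B] (Q : Pauli) :
    Matrix.unitaryGroup (Row A B) ℂ := liftUnitary rowEquivC (pauli Q)

lemma pauliC_zero : pauliC A B 0 = 1 := by simp [pauliC, pauli_zero]

lemma pauliC_mul (P Q : Pauli) : EqUpToSign (pauliC A B P * pauliC A B Q) (pauliC A B (P + Q)) := by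
  rw [pauliC, pauliC, pauliC, ← map_mul]
  exact (pauli_mul P Q).map _ (liftUnitary_neg _)

def turnUnitary (P : NoiselessProtocol n A B) (p : Bool) (k : ℤ) (x : TurnLog) :
    Matrix.unitaryGroup (Row A B) ℂ :=
  pauliC A B x.2 * (moveUnitary P p k x.1.2 * pauliC A B x.1.1)

def moveSign : Option Bool → ℤ
  | none => 0
  | some true => 1
  | some false => -1

/-- The net number of unitaries applied by party `p` in a word. -/
def wordCounter (p : Bool) : List Letter → ℤ
  | [] => 0
  | e :: l => wordCounter p l + if e.2.1 = p then moveSign (some e.2.2) else 0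

/-- The net number of unitaries applied by a party, from its log. -/
def logCounter (x : ℕ → TurnLog) (r : ℕ) : ℤ := ∑ i ∈ Finset.range r, moveSign (x i).1.2

lemma logCounter_congr {x x' : ℕ → TurnLog} {r : ℕ} (h : ∀ i < r, x i = x' i) :
    logCounter x r = logCounter x' r :=
  Finset.sum_congr rfl fun i hi => by rw [h i (Finset.mem_range.1 hi)]

/-- The joint operator after `r` turns of either party. -/
def unitaryAfter (P : NoiselessProtocol n A B) (a b : ℕ → TurnLog) :
    ℕ → Matrix.unitaryGroup (Row A B) ℂ
  | 0 => 1
  | r + 1 => turnUnitary P true (logCounter b r) (b r) *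
      (turnUnitary P false (logCounter a r) (a r) * unitaryAfter P a b r)

/-- The joint operator before turn `r` of party `p`. -/
def unitaryBefore (P : NoiselessProtocol n A B) (a b : ℕ → TurnLog) (p : Bool) (r : ℕ) :
    Matrix.unitaryGroup (Row A B) ℂ :=
  if p then turnUnitary P false (logCounter a r) (a r) * unitaryAfter P a b r
  else unitaryAfter P a b r

lemma unitaryAfter_congr (P : NoiselessProtocol n A B) {a b a' b' : ℕ → TurnLog} {r : ℕ}
    (ha : ∀ i < r, a i = a' i) (hb : ∀ i < r, b i = b' i) :
    unitaryAfter P a b r = unitaryAfter P a' b' r := by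
  induction r with
  | zero => rfl
  | succ r ih =>
    rw [unitaryAfter, unitaryAfter, ih (fun i hi => ha i (by omega)) (fun i hi => hb i (by omega)),
      ha r (by omega), hb r (by omega), logCounter_congr fun i hi => ha i (by omega),
      logCounter_congr fun i hi => hb i (by omega)]

/-- The operator that a word denotes. -/
def wordUnitary (P : NoiselessProtocol n A B) : List Letter → Matrix.unitaryGroup (Row A B) ℂ
  | [] => 1
  | e :: l => moveUnitary P e.2.1 (wordCounter e.2.1 l) (some e.2.2) *
      (pauliC A B e.1 * wordUnitary P l)

/-- A cancelled letter has the opposite sign of the move that cancels it, so reducing the word does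
not disturb the net count. -/
lemma wordCounter_step (p : Bool) (x : TurnLog) (w : Word) :
    wordCounter p (w.step p x).1 = wordCounter p w.1 + moveSign x.1.2 := by
  obtain ⟨l, P⟩ := w
  obtain ⟨⟨Q, o⟩, R⟩ := x
  rcases o with _ | d
  · simp [Word.step, Word.applyOp, moveSign]
  · cases l with
    | nil => simp [Word.step, Word.applyOp, wordCounter]
    | cons e l =>
      simp only [Word.step, Word.applyOp]
      split_ifs with h
      · simp only [wordCounter, h.2.1, h.2.2, if_true]
        cases d <;> simp [moveSign]
      · simp [wordCounter]

lemma wordCounter_step_not (p : Bool) (x : TurnLog) (w : Word) :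
    wordCounter (!p) (w.step p x).1 = wordCounter (!p) w.1 := by
  obtain ⟨l, P⟩ := w
  obtain ⟨⟨Q, o⟩, R⟩ := x
  rcases o with _ | d
  · simp [Word.step, Word.applyOp]
  · cases l with
    | nil => simp [Word.step, Word.applyOp, wordCounter]
    | cons e l =>
      simp only [Word.step, Word.applyOp]
      split_ifs with h
      · simp [wordCounter, h.2.1]
      · simp [wordCounter]

/-- Although the word depends on both logs, a party can compute from its own log which unitary comes
next. Queries of the black box are thus always consistent, even for a party that misjudges the word.
-/
lemma wordCounter_wordAfter (a b : ℕ → TurnLog) (r : ℕ) :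
    wordCounter false (wordAfter a b r).1 = logCounter a r ∧
      wordCounter true (wordAfter a b r).1 = logCounter b r := by
  induction r with
  | zero => simp [wordAfter, wordCounter, logCounter]
  | succ r ih =>
    have h1 := wordCounter_step_not true (b r) (Word.step false (a r) (wordAfter a b r))
    have h2 := wordCounter_step_not false (a r) (wordAfter a b r)
    simp only [Bool.not_true, Bool.not_false] at h1 h2
    simp only [wordAfter, logCounter, Finset.sum_range_succ]
    rw [wordCounter_step, h1, wordCounter_step, h2, ih.1, ih.2]
    exact ⟨rfl, rfl⟩

lemma moveUnitary_not_mul (P : NoiselessProtocol n A B) (p d : Bool) (k : ℤ) :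
    moveUnitary P p (k + moveSign (some d)) (some !d) * moveUnitary P p k (some d) = 1 := by
  cases d
  · simp [moveUnitary, moveSign, ← sub_eq_add_neg]
  · simp [moveUnitary, moveSign]

/-- A turn acts on the operator denoted by a word as on the word. -/
lemma turnUnitary_mul_wordUnitary (P : NoiselessProtocol n A B) (p : Bool) (x : TurnLog)
    (w : Word) :
    EqUpToSign (turnUnitary P p (wordCounter p w.1) x * (pauliC A B w.2 * wordUnitary P w.1))
      (pauliC A B (w.step p x).2 * wordUnitary P (w.step p x).1) := by
  obtain ⟨l, S⟩ := w
  obtain ⟨⟨Q, o⟩, R⟩ := x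
  have hQS : EqUpToSign (pauliC A B Q * pauliC A B S) (pauliC A B (S + Q)) := by
    rw [add_comm]; exact pauliC_mul Q S
  -- The correction merges with the pending Pauli operator at the cost of a sign, and so does the
  -- teleportation outcome at the end. What remains is the move alone, where equality is exact.
  suffices h : ∀ w' : Word, w' = Word.applyOp p o (l, S + Q) →
      moveUnitary P p (wordCounter p l) o * (pauliC A B (S + Q) * wordUnitary P l) =
        pauliC A B w'.2 * wordUnitary P w'.1 by
    have h1 := h _ rfl
    have h2 : turnUnitary P p (wordCounter p l) ((Q, o), R) *
        (pauliC A B S * wordUnitary P l) = pauliC A B R * (moveUnitary P p (wordCounter p l) o *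
          ((pauliC A B Q * pauliC A B S) * wordUnitary P l)) := by
      simp only [turnUnitary, mul_assoc]
    simp only [Word.step]
    rw [h2]
    refine ((EqUpToSign.refl (pauliC A B R)).mul
      ((EqUpToSign.refl (moveUnitary P p (wordCounter p l) o)).mul
        (hQS.mul (EqUpToSign.refl (wordUnitary P l))))).trans ?_
    rw [h1, ← mul_assoc]
    refine EqUpToSign.mul ?_ (EqUpToSign.refl _)
    have h3 := pauliC_mul (A := A) (B := B) R (Word.applyOp p o (l, S + Q)).2
    rwa [add_comm R] at h3
  rintro w' rfl
  cases o with
  | none => simp [Word.applyOp, moveUnitary]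
  | some d =>
    cases l with
    | nil => simp [Word.applyOp, wordUnitary, pauliC_zero]
    | cons e l =>
      simp only [Word.applyOp]
      split_ifs with h
      · obtain ⟨h1, h2, h3⟩ := h
        obtain rfl : d = !e.2.2 := by rw [h3, Bool.not_not]
        simp only [h1, pauliC_zero, one_mul, wordUnitary, wordCounter, h2, if_true]
        rw [← mul_assoc, moveUnitary_not_mul, one_mul]
      · simp [wordUnitary, pauliC_zero]

lemma unitaryAfter_eq (P : NoiselessProtocol n A B) (a b : ℕ → TurnLog) (r : ℕ) :
    EqUpToSign (unitaryAfter P a b r)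
      (pauliC A B (wordAfter a b r).2 * wordUnitary P (wordAfter a b r).1) := by
  induction r with
  | zero => simp [unitaryAfter, wordAfter, wordUnitary, pauliC_zero, EqUpToSign]
  | succ r ih =>
    have hc := wordCounter_wordAfter a b r
    simp only [unitaryAfter, wordAfter]
    have h1 := turnUnitary_mul_wordUnitary P false (a r) (wordAfter a b r)
    have h2 := turnUnitary_mul_wordUnitary P true (b r) (Word.step false (a r) (wordAfter a b r))
    have h3 := wordCounter_step_not false (a r) (wordAfter a b r)
    simp only [Bool.not_false] at h3
    rw [hc.1] at h1
    rw [h3, hc.2] at h2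
    exact ((EqUpToSign.refl _).mul (((EqUpToSign.refl _).mul ih).trans h1)).trans h2

/-- The first `k` unitaries of the noiseless protocol, followed by the swap with the output qubit. -/
def cleanUnitary (P : NoiselessProtocol n A B) : ℕ → Matrix.unitaryGroup (Row A B) ℂ
  | 0 => 1
  | k + 1 => letterUnitary P k.bodd (k / 2 : ℕ) * cleanUnitary P k

/-- The parties alternate and Alice begins, so half of the length is rounded up for her and down for
Bob. -/
lemma wordCounter_of_clean {l : List Letter} (h : Clean l) (p : Bool) :
    wordCounter p l = ((l.length + if p then 0 else 1) / 2 : ℕ) := by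
  induction l with
  | nil => cases p <;> simp [wordCounter]
  | cons e l ih =>
    obtain ⟨h1, h2⟩ := h
    rw [wordCounter, ih h2, h1]
    have := Nat.bodd_add_div2 l.length
    rw [Nat.div2_val] at this
    cases p <;> cases hb : l.length.bodd <;> simp [hb, moveSign] at this ⊢ <;> omega

lemma wordUnitary_of_clean (P : NoiselessProtocol n A B) {l : List Letter} (h : Clean l) :
    wordUnitary P l = cleanUnitary P l.length := by
  induction l with
  | nil => rfl
  | cons e l ih =>
    obtain ⟨h1, h2⟩ := h
    rw [List.length_cons, cleanUnitary, wordUnitary, ih h2, h1]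
    simp only [pauliC_zero, one_mul, moveUnitary]
    rw [wordCounter_of_clean h2]
    congr 3
    have := Nat.bodd_add_div2 l.length
    rw [Nat.div2_val] at this
    cases hb : l.length.bodd <;> simp [hb] at this ⊢ <;> omega

lemma letterUnitary_of_lt (P : NoiselessProtocol n A B) (p : Bool) {k : ℤ} (h : (n : ℤ) + 1 < k) :
    letterUnitary P p k = 1 := by
  cases p
  · simp only [letterUnitary]
    rw [dif_neg (by omega), if_neg (by omega)]
  · simp only [letterUnitary]
    rw [dif_neg (by omega)]

/-- After the 2n + 1 unitaries of the protocol come an idle letter of Bob and Alice's swap of `C`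
with the output qubit; all later letters are the identity. -/
lemma cleanUnitary_of_le (P : NoiselessProtocol n A B) {k : ℕ} (h : 2 * n + 3 ≤ k) :
    cleanUnitary P k = cleanUnitary P (2 * n + 3) := by
  induction k, h using Nat.le_induction with
  | base => rfl
  | succ k hk ih =>
    rw [cleanUnitary, ih]
    suffices h : letterUnitary P k.bodd (k / 2 : ℕ) = 1 by rw [h, one_mul]
    -- This letter has number n + 1 but belongs to Bob, so it is not the swap.
    by_cases h3 : k = 2 * n + 3
    · subst h3
      have hb : (2 * n + 3).bodd = true := by simp [Nat.bodd_mul]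
      rw [hb]
      simp only [letterUnitary]
      rw [dif_neg (by omega)]
    · exact letterUnitary_of_lt _ _ (by omega)

/-- Twice the counter is at least the clean length minus 1 on the clean prefix, and each letter
beyond the prefix lowers it by at most 2. -/
lemma wordCounter_ge (p : Bool) (l : List Letter) :
    3 * (cleanLength l : ℤ) - 2 * l.length - 1 ≤ 2 * wordCounter p l := by
  induction l with
  | nil => simp [wordCounter, cleanLength]
  | cons e l ih =>
    by_cases hc : Clean (e :: l)
    · rw [cleanLength_of_clean hc, wordCounter_of_clean hc]
      split_ifs <;> omega
    · rw [cleanLength_of_not_clean hc, wordCounter, List.length_cons]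
      have : -1 ≤ if e.2.1 = p then moveSign (some e.2.2) else 0 := by
        split_ifs
        · cases e.2.2 <;> simp [moveSign]
        · simp
      push_cast
      linarith

/-- If the clean prefix is long enough, the rest of the word acts on `C` only. -/
theorem wordUnitary_of_potential (P : NoiselessProtocol n A B) {l : List Letter}
    (h : 2 * (n : ℤ) + 4 ≤ potential l) : ∃ g : Matrix.unitaryGroup Qubit ℂ,
      wordUnitary P l = liftUnitary rowEquivC g * cleanUnitary P (2 * n + 3) := by
  induction l with
  | nil => simp [potential, cleanLength] at h; omega
  | cons e l ih =>
    by_cases hc : Clean (e :: l)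
    · refine ⟨1, ?_⟩
      rw [map_one, one_mul, wordUnitary_of_clean P hc, cleanUnitary_of_le]
      rw [potential, cleanLength_of_clean hc] at h
      omega
    · have h3 := potential_cons_of_not_clean hc
      obtain ⟨g, hg⟩ := ih (by omega)
      have h4 := wordCounter_ge e.2.1 l
      have h5 := cleanLength_le l
      rw [h3, potential] at h
      refine ⟨pauli e.1 * g, ?_⟩
      -- Here the potential of `l` is at least 2n + 7, so `wordCounter_ge` puts the counter at n + 3
      -- or more. Even the letter undone by an inverse move, one index below, comes after the swap
      -- and is the identity. Only the Pauli operator on `C` survives.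
      have h6 : moveUnitary P e.2.1 (wordCounter e.2.1 l) (some e.2.2) = 1 := by
        cases e.2.2
        · simp only [moveUnitary]
          rw [letterUnitary_of_lt _ _ (by omega), inv_one]
        · simp only [moveUnitary]
          rw [letterUnitary_of_lt _ _ (by omega)]
      rw [wordUnitary, h6, one_mul, hg, map_mul, mul_assoc]
      rfl

end Ops

lemma finFoldl_induction {α : Type} {n : ℕ} (f : α → Fin n → α) (x : α) (Inv : ℕ → α → Prop)
    (h0 : Inv 0 x) (hs : ∀ (r : Fin n) (y : α), Inv r y → Inv (r + 1) (f y r)) :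
    Inv n (Fin.foldl n f x) := by
  induction n with
  | zero => simpa using h0
  | succ n ih =>
    rw [Fin.foldl_succ_last]
    exact hs (Fin.last n) _ (ih _ fun r y hy => hs r.castSucc y hy)

/-! ### The clean word as the unitary of the protocol followed by the swap. -/

section Ops

variable {A B : Type}

def equivAC : A × B × Qubit ≃ (A × Qubit) × B where
  toFun p := ((p.1, p.2.2), p.2.1)
  invFun p := (p.1.1, p.2, p.1.2)
  left_inv _ := rfl
  right_inv _ := rfl

def equivBC : A × B × Qubit ≃ (B × Qubit) × A where
  toFun p := ((p.2.1, p.2.2), p.1)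
  invFun p := (p.2, p.1.1, p.1.2)
  left_inv _ := rfl
  right_inv _ := rfl

lemma onAC_eq_liftEquiv [DecidableEq B] (U : Matrix (A × Qubit) (A × Qubit) ℂ) :
    onAC (B := B) U = liftEquiv equivAC U := by
  ext p p'
  simp [onAC, liftEquiv_apply, equivAC]

lemma onBC_eq_liftEquiv [DecidableEq A] (U : Matrix (B × Qubit) (B × Qubit) ℂ) :
    onBC (A := A) U = liftEquiv equivBC U := by
  ext p p'
  simp [onBC, liftEquiv_apply, equivBC]

lemma liftEquiv_onAC [DecidableEq B] (U : Matrix (A × Qubit) (A × Qubit) ℂ) :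
    liftEquiv rowEquivABC (onAC (B := B) U) = liftEquiv rowEquivAC U := by
  ext p p'
  simp only [onAC, liftEquiv_apply, rowEquivABC, rowEquivAC, Equiv.coe_fn_mk, Matrix.of_apply,
    Prod.mk.injEq]
  split_ifs <;> simp_all

lemma liftEquiv_onBC [DecidableEq A] (U : Matrix (B × Qubit) (B × Qubit) ℂ) :
    liftEquiv rowEquivABC (onBC (A := A) U) = liftEquiv rowEquivBC U := by
  ext p p'
  simp only [onBC, liftEquiv_apply, rowEquivABC, rowEquivBC, Equiv.coe_fn_mk, Matrix.of_apply,
    Prod.mk.injEq]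
  split_ifs <;> simp_all

variable {n : ℕ} [Fintype A] [DecidableEq A] [Fintype B] [DecidableEq B]

lemma NoiselessProtocol.unitary_mem_unitaryGroup (P : NoiselessProtocol n A B) : P.unitary ∈
    Matrix.unitaryGroup (A × B × Qubit) ℂ := by
  have hA : ∀ r, onAC (B := B) (P.alice r).1 ∈ Matrix.unitaryGroup (A × B × Qubit) ℂ := fun r => by
    rw [onAC_eq_liftEquiv]; exact (liftUnitary equivAC (P.alice r)).2
  have hB : ∀ r, onBC (A := A) (P.bob r).1 ∈ Matrix.unitaryGroup (A × B × Qubit) ℂ := fun r => by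
    rw [onBC_eq_liftEquiv]; exact (liftUnitary equivBC (P.bob r)).2
  refine mul_mem (hA _) ?_
  exact finFoldl_induction _ _ (fun _ V => V ∈ Matrix.unitaryGroup (A × B × Qubit) ℂ)
    (one_mem _) fun r V hV => mul_mem (hB _) (mul_mem (hA _) hV)

/-- The fold in `NoiselessProtocol.unitary` consumes two letters per step. Of the last three
letters, one is Alice's final unitary, one is idle and one is the swap. -/
lemma coe_cleanUnitary (P : NoiselessProtocol n A B) :
    (cleanUnitary P (2 * n + 3)).1 =
      liftEquiv rowEquivCC swapGateMatrix * liftEquiv rowEquivABC P.unitary := by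
  have hf := finFoldl_induction (n := n)
    (fun V r => onBC (P.bob r).1 * (onAC (P.alice r.castSucc).1 * V))
    (1 : Matrix (A × B × Qubit) (A × B × Qubit) ℂ)
    (fun r V => (cleanUnitary P (2 * r)).1 = liftEquiv rowEquivABC V)
    (by simp [cleanUnitary, liftEquiv_one]) (by
      intro r V hV
      rw [show 2 * ((r : ℕ) + 1) = 2 * r + 1 + 1 by ring, cleanUnitary, cleanUnitary,
        Matrix.UnitaryGroup.mul_val, Matrix.UnitaryGroup.mul_val, hV, liftEquiv_mul, liftEquiv_mul,
        liftEquiv_onAC, liftEquiv_onBC]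
      have hb1 : (2 * (r : ℕ) + 1).bodd = true := by simp [Nat.bodd_mul]
      have hb2 : (2 * (r : ℕ)).bodd = false := by simp [Nat.bodd_mul]
      have hd1 : (2 * (r : ℕ) + 1) / 2 = r := by omega
      have hd2 : (2 * (r : ℕ)) / 2 = r := by omega
      have hr := r.2
      rw [hb1, hb2, hd1, hd2]
      simp only [letterUnitary]
      rw [dif_pos (by omega), dif_pos (by omega)]
      rfl)
  have hb1 : (2 * n + 2).bodd = false := by simp [Nat.bodd_mul]
  have hb2 : (2 * n + 1).bodd = true := by simp [Nat.bodd_mul]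
  have hb3 : (2 * n).bodd = false := by simp [Nat.bodd_mul]
  have hd1 : (2 * n + 2) / 2 = n + 1 := by omega
  have hd2 : (2 * n + 1) / 2 = n := by omega
  have hd3 : (2 * n) / 2 = n := by omega
  rw [show 2 * n + 3 = 2 * n + 1 + 1 + 1 by ring, cleanUnitary, cleanUnitary, cleanUnitary, hb1, hb2,
    hb3, hd1, hd2, hd3]
  simp only [Matrix.UnitaryGroup.mul_val]
  rw [hf, NoiselessProtocol.unitary, liftEquiv_mul, liftEquiv_onAC]
  simp only [letterUnitary]
  rw [dif_neg (by omega), if_pos (by push_cast; rfl), dif_neg (by omega), dif_pos (by omega)]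
  simp only [Matrix.UnitaryGroup.one_val, one_mul]
  rfl

/-- The isometry that adjoins an output qubit in state `|0⟩`. -/
def adjoinOutput : Matrix (Row A B) (A × B × Qubit) ℂ :=
  Matrix.of fun p i => if (p.1, p.2.1, p.2.2.1) = i ∧ p.2.2.2 = 0 then 1 else 0

lemma adjoinOutput_isometry :
    (adjoinOutput (A := A) (B := B))ᴴ * adjoinOutput (A := A) (B := B) = 1 := by
  ext i j
  rw [Matrix.mul_apply, ← (rowEquivABC (A := A) (B := B)).symm.sum_comp, Fintype.sum_prod_type]
  simp only [Matrix.conjTranspose_apply, adjoinOutput, Matrix.of_apply, rowEquivABC,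
    Equiv.coe_fn_symm_mk, Fin.sum_univ_two, Matrix.one_apply]
  simp only [apply_ite, star_one, star_zero]
  by_cases h : i = j <;> simp [h, eq_comm]

/-- The simulated operator, if the simulation has made enough progress. -/
theorem unitaryAfter_of_potential (P : NoiselessProtocol n A B) {a b : ℕ → TurnLog} {r : ℕ}
    (h : 2 * (n : ℤ) + 4 ≤ potential (wordAfter a b r).1) :
    ∃ v : Qubit → ℂ, ∑ c, v c * star (v c) = 1 ∧ ∀ i₁ i₂ c c' j,
      ((unitaryAfter P a b r).1 * adjoinOutput (A := A) (B := B)) (i₁, i₂, c, c') j = v c * P.unitary (i₁, i₂, c') j := by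
  obtain ⟨g, hg⟩ := wordUnitary_of_potential P h
  have h1 := unitaryAfter_eq P a b r
  rw [hg, ← mul_assoc, pauliC, ← map_mul] at h1
  generalize pauli (wordAfter a b r).2 * g = g' at h1
  obtain ⟨g'', h2⟩ : ∃ g'', unitaryAfter P a b r =
      liftUnitary rowEquivC g'' * cleanUnitary P (2 * n + 3) := by
    rcases h1 with h1 | h1
    · exact ⟨g', h1⟩
    · exact ⟨-g', by rw [h1, liftUnitary_neg, neg_mul]⟩
  -- After the swap, `C` is in the initial state |0⟩ of the output qubit, and the stray operator
  -- turns it into the first column of `g''`, a unit vector in tensor product with the correct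
  -- output.
  refine ⟨fun c => g''.1 c 0, ?_, ?_⟩
  · have := congrFun (congrFun (Matrix.mem_unitaryGroup_iff'.1 g''.2) 0) 0
    rw [Matrix.star_eq_conjTranspose, Matrix.mul_apply] at this
    simp only [Matrix.conjTranspose_apply, Matrix.one_apply_eq] at this
    rw [← this]
    exact Finset.sum_congr rfl fun c _ => mul_comm _ _
  · intro i₁ i₂ c c' j
    rw [h2, Matrix.UnitaryGroup.mul_val, coe_cleanUnitary, coe_liftUnitary,
      Matrix.mul_assoc, Matrix.mul_assoc]
    have h3 : ∀ p : Row A B, (liftEquiv rowEquivABC P.unitary * adjoinOutput (A := A) (B := B)) p j =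
        if p.2.2.2 = 0 then P.unitary (p.1, p.2.1, p.2.2.1) j else 0 := by
      intro p
      rw [liftEquiv_mul_apply]
      simp only [adjoinOutput, rowEquivABC, Equiv.coe_fn_mk, Equiv.coe_fn_symm_mk, Matrix.of_apply]
      split_ifs with h0
      · simp [h0]
      · simp [h0]
    have h4 : ∀ V : Matrix (Row A B) (A × B × Qubit) ℂ,
        (∀ p, V p j = if p.2.2.2 = 0 then P.unitary (p.1, p.2.1, p.2.2.1) j else 0) →
        ∀ p, (liftEquiv (rowEquivCC (A := A) (B := B)) swapGateMatrix * V) p j =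
          if p.2.2.1 = 0 then P.unitary (p.1, p.2.1, p.2.2.2) j else 0 := by
      intro V hV p
      rw [liftEquiv_mul_apply]
      simp only [hV, Fintype.sum_prod_type]
      simp only [swapGateMatrix, rowEquivCC, Equiv.coe_fn_mk, Equiv.coe_fn_symm_mk, Matrix.of_apply,
        ite_mul, one_mul, zero_mul]
      obtain ⟨p1, p2, p3, p4⟩ := p
      fin_cases p3 <;> fin_cases p4 <;> simp [Fin.sum_univ_two]
    have h5 : ∀ V : Matrix (Row A B) (A × B × Qubit) ℂ,
        (∀ p, V p j = if p.2.2.1 = 0 then P.unitary (p.1, p.2.1, p.2.2.2) j else 0) →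
        (liftEquiv (rowEquivC (A := A) (B := B)) g''.1 * V) (i₁, i₂, c, c') j =
          g''.1 c 0 * P.unitary (i₁, i₂, c') j := by
      intro V hV
      rw [liftEquiv_mul_apply]
      simp only [hV]
      simp [rowEquivC]
    exact h5 _ (h4 _ h3)

end Ops

/-! ### Trace norm and diamond norm -/

section Norms

variable {I : Type} [Fintype I] [DecidableEq I]

/-- The eigenvalues of `Oᴴ * O` are the squares of those of `O`, but the two enumerations need not
match. They are compared as multisets of roots of the characteristic polynomial. -/
lemma traceNorm_eq_sum_abs_eigenvalues {O : Matrix I I ℂ} (hO : O.IsHermitian) :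
    traceNorm O = ∑ i, |hO.eigenvalues i| := by
  have hH := Matrix.isHermitian_conjTranspose_mul_self O
  have h1 : Oᴴ * O = (hO.eigenvectorUnitary : Matrix I I ℂ) *
      Matrix.diagonal (fun i => ((hO.eigenvalues i ^ 2 : ℝ) : ℂ)) *
        star (hO.eigenvectorUnitary : Matrix I I ℂ) := by
    have hs := hO.spectral_theorem
    rw [Unitary.conjStarAlgAut_apply] at hs
    rw [hO.eq]
    conv_lhs => rw [hs]
    have hu : star (hO.eigenvectorUnitary : Matrix I I ℂ) * (hO.eigenvectorUnitary : Matrix I I ℂ) = 1 :=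
      Unitary.coe_star_mul_self _
    simp only [mul_assoc]
    rw [← mul_assoc (star (hO.eigenvectorUnitary : Matrix I I ℂ)) _ _, hu, one_mul, ← mul_assoc
      (Matrix.diagonal _) (Matrix.diagonal _), Matrix.diagonal_mul_diagonal]
    congr 3
    ext i; simp [sq]
  have h2 : (Oᴴ * O).charpoly = ∏ i, (Polynomial.X -
      Polynomial.C ((hO.eigenvalues i ^ 2 : ℝ) : ℂ)) := by
    rw [h1]
    have : ((hO.eigenvectorUnitary : Matrix I I ℂ) *
      Matrix.diagonal (fun i => ((hO.eigenvalues i ^ 2 : ℝ) : ℂ)) *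
        star (hO.eigenvectorUnitary : Matrix I I ℂ)).charpoly = (Matrix.diagonal
        (fun i => ((hO.eigenvalues i ^ 2 : ℝ) : ℂ))).charpoly := by
      rw [Matrix.charpoly_mul_comm, ← mul_assoc, Unitary.coe_star_mul_self, one_mul]
    rw [this, Matrix.charpoly_diagonal]
  have h3 := hH.roots_charpoly_eq_eigenvalues
  have hr : (∏ i, (Polynomial.X - Polynomial.C ((hO.eigenvalues i ^ 2 : ℝ) : ℂ))).roots =
      Multiset.map (fun i => ((hO.eigenvalues i ^ 2 : ℝ) : ℂ)) Finset.univ.val := by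
    rw [← Polynomial.roots_multiset_prod_X_sub_C
      (Multiset.map (fun i => ((hO.eigenvalues i ^ 2 : ℝ) : ℂ)) Finset.univ.val), Multiset.map_map]
    rfl
  rw [h2, hr] at h3
  have h4 : Multiset.map (fun i => hO.eigenvalues i ^ 2) Finset.univ.val =
      Multiset.map hH.eigenvalues Finset.univ.val := by
    have := congrArg (Multiset.map Complex.re) h3
    rw [Multiset.map_map, Multiset.map_map] at this
    exact this
  have h5 := congrArg (fun s => (Multiset.map Real.sqrt s).sum) h4
  simp only [Multiset.map_map, Function.comp_def, Real.sqrt_sq_eq_abs] at h5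
  exact h5.symm

/-- In an eigenbasis of the difference, each eigenvalue is a difference of non-negative diagonal
entries of `X` and `Y`. -/
lemma traceNorm_sub_le {X Y : Matrix I I ℂ} (hX : X.PosSemidef) (hY : Y.PosSemidef) :
    traceNorm (X - Y) ≤ X.trace.re + Y.trace.re := by
  have hO : (X - Y).IsHermitian := hX.1.sub hY.1
  rw [traceNorm_eq_sum_abs_eigenvalues hO]
  set U : Matrix I I ℂ := hO.eigenvectorUnitary.1
  have hUU : U * star U = 1 := Unitary.coe_mul_star_self _
  have key : ∀ i, hO.eigenvalues i = ((star U * X * U) i i).re - ((star U * Y * U) i i).re := by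
    intro i
    have hs := hO.spectral_theorem
    rw [Unitary.conjStarAlgAut_apply] at hs
    have h1 : star U * (X - Y) * U = Matrix.diagonal (RCLike.ofReal ∘ hO.eigenvalues) := by
      have hu : star U * U = 1 := Unitary.coe_star_mul_self _
      refine (congrArg (fun Z => star U * Z * U) hs).trans ?_
      change star U * (U * _ * star U) * U = _
      rw [mul_assoc, mul_assoc, mul_assoc, hu, mul_one, ← mul_assoc, hu, one_mul]
    have h2 := congrFun (congrFun h1 i) i
    rw [mul_sub, sub_mul, Matrix.sub_apply, Matrix.diagonal_apply_eq] at h2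
    have h3 := congrArg Complex.re h2
    simpa using h3.symm
  have hpos : ∀ Z : Matrix I I ℂ, Z.PosSemidef → ∀ i, 0 ≤ ((star U * Z * U) i i).re := by
    intro Z hZ i
    have := (hZ.conjTranspose_mul_mul_same U).diag_nonneg (i := i)
    exact (Complex.le_def.1 this).1
  have htr : ∀ Z : Matrix I I ℂ, ∑ i, ((star U * Z * U) i i).re = Z.trace.re := by
    intro Z
    rw [← Complex.re_sum]
    change (Matrix.trace (star U * Z * U)).re = _
    rw [Matrix.trace_mul_comm, ← mul_assoc, hUU, one_mul]
  rw [← htr X, ← htr Y, ← Finset.sum_add_distrib]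
  refine Finset.sum_le_sum fun i _ => ?_
  rw [key i]
  have h1 := hpos X hX i
  have h2 := hpos Y hY i
  rw [abs_le]
  constructor <;> linarith

end Norms

/-! ### Kraus maps and a bound on the diamond norm. -/

section Diamond

variable {I O R : Type} [Fintype I]

/-- The completely positive map with a given multiset of Kraus operators. -/
def krausMap (Ks : Multiset (Matrix O I ℂ)) (ρ : Matrix I I ℂ) : Matrix O O ℂ :=
  (Ks.map fun K => K * ρ * Kᴴ).sum

def partialTrace [Fintype R] (σ : Matrix (I × R) (I × R) ℂ) : Matrix I I ℂ :=
  Matrix.of fun i i' => ∑ r, σ (i, r) (i', r)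

lemma krausMap_apply (Ks : Multiset (Matrix O I ℂ)) (ρ : Matrix I I ℂ) (p p' : O) :
    krausMap Ks ρ p p' = (Ks.map fun K => (K * ρ * Kᴴ) p p').sum := by
  induction Ks using Multiset.induction_on with
  | empty => simp [krausMap]
  | cons K Ks ih =>
    simp only [krausMap, Multiset.map_cons, Multiset.sum_cons, Matrix.add_apply] at ih ⊢
    rw [ih]

variable [Fintype O] [Fintype R]

lemma mul_mul_conjTranspose_apply {I' O' : Type} [Fintype I'] (K : Matrix O' I' ℂ)
    (ρ : Matrix I' I' ℂ) (p p' : O') :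
    (K * ρ * Kᴴ) p p' = ∑ i, ∑ i', K p i * ρ i i' * star (K p' i') := by
  simp only [Matrix.mul_apply, Matrix.conjTranspose_apply, Finset.sum_mul]
  exact Finset.sum_comm

lemma ampliate_krausMap [DecidableEq R] (Ks : Multiset (Matrix O I ℂ))
    (σ : Matrix (I × R) (I × R) ℂ) :
    ampliate (krausMap Ks) σ = krausMap (Ks.map fun K => K ⊗ₖ (1 : Matrix R R ℂ)) σ := by
  ext ⟨p, r⟩ ⟨p', r'⟩
  simp only [ampliate, Matrix.of_apply]
  rw [krausMap_apply, krausMap_apply, Multiset.map_map]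
  congr 1
  refine Multiset.map_congr rfl fun K _ => ?_
  simp only [Function.comp_apply]
  rw [mul_mul_conjTranspose_apply, mul_mul_conjTranspose_apply]
  simp only [Fintype.sum_prod_type, Matrix.of_apply, Matrix.kroneckerMap_apply, Matrix.one_apply,
    RCLike.star_def]
  simp [apply_ite (starRingEnd ℂ)]

lemma posSemidef_krausMap (Ks : Multiset (Matrix O I ℂ)) {ρ : Matrix I I ℂ} (h : ρ.PosSemidef) :
    (krausMap Ks ρ).PosSemidef := by
  induction Ks using Multiset.induction_on with
  | empty => simpa [krausMap] using Matrix.PosSemidef.zero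
  | cons K Ks ih =>
    simp only [krausMap, Multiset.map_cons, Multiset.sum_cons] at ih ⊢
    exact (h.mul_mul_conjTranspose_same K).add ih

lemma trace_krausMap (Ks : Multiset (Matrix O I ℂ)) (ρ : Matrix I I ℂ) :
    (krausMap Ks ρ).trace = (Ks.map fun K => (K * ρ * Kᴴ).trace).sum := by
  induction Ks using Multiset.induction_on with
  | empty => simp [krausMap]
  | cons K Ks ih =>
    simp only [krausMap, Multiset.map_cons, Multiset.sum_cons, Matrix.trace_add] at ih ⊢
    rw [ih]

/-- The trace of an output does not see the reference system. Trace bounds on plain inputs therefore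
suffice for the diamond norm. -/
lemma trace_kronecker_one_mul [DecidableEq R] (K : Matrix O I ℂ) (σ : Matrix (I × R) (I × R) ℂ) :
    ((K ⊗ₖ (1 : Matrix R R ℂ)) * σ * (K ⊗ₖ (1 : Matrix R R ℂ))ᴴ).trace =
      (K * partialTrace σ * Kᴴ).trace := by
  simp only [Matrix.trace, Matrix.diag_apply, Fintype.sum_prod_type]
  refine Finset.sum_congr rfl fun p _ => ?_
  simp only [mul_mul_conjTranspose_apply, Fintype.sum_prod_type, Matrix.kroneckerMap_apply,
    Matrix.one_apply, partialTrace, Matrix.of_apply]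
  simp only [mul_ite, mul_one, mul_zero, ite_mul, zero_mul, apply_ite star, star_zero,
    Finset.sum_ite_eq, Finset.mem_univ, if_true, Finset.mul_sum, Finset.sum_mul]
  rw [Finset.sum_comm]
  refine Finset.sum_congr rfl fun i _ => ?_
  rw [Finset.sum_comm]
  conv_rhs => rw [Finset.sum_comm]
  refine Finset.sum_congr rfl fun r _ => ?_
  rw [Finset.sum_eq_single r (fun b _ hb => by simp [hb]) (by simp)]
  simp

lemma isDensity_partialTrace {σ : Matrix (I × R) (I × R) ℂ} (h : IsDensity σ) :
    IsDensity (partialTrace σ) := by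
  classical
  constructor
  · have : partialTrace σ = ∑ r, σ.submatrix (fun i => (i, r)) (fun i => (i, r)) := by
      ext i i'
      simp [partialTrace, Matrix.sum_apply]
    rw [this]
    refine Matrix.posSemidef_sum _ fun r _ => ?_
    exact h.1.submatrix _
  · rw [← h.2]
    simp [partialTrace, Matrix.trace, Fintype.sum_prod_type]

/-- A difference of completely positive maps of small trace has a small diamond norm. -/
theorem diamondNorm_le [DecidableEq I] [DecidableEq O] {Φ : Matrix I I ℂ → Matrix O O ℂ}
    (Ks Ls : Multiset (Matrix O I ℂ)) {η : ℝ} (hΦ : ∀ ρ, Φ ρ = krausMap Ks ρ - krausMap Ls ρ)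
    (hK : ∀ ρ, IsDensity ρ → (krausMap Ks ρ).trace.re ≤ η / 2)
    (hL : ∀ ρ, IsDensity ρ → (krausMap Ls ρ).trace.re ≤ η / 2) :
    diamondNorm Φ ≤ ENNReal.ofReal η := by
  refine iSup_le fun ⟨σ, hσ⟩ => ENNReal.ofReal_le_ofReal ?_
  have h1 : ampliate Φ σ = ampliate (krausMap Ks) σ - ampliate (krausMap Ls) σ := by
    ext p p'
    simp [ampliate, hΦ]
  have h2 : ∀ Ks : Multiset (Matrix O I ℂ), (krausMap (Ks.map fun K => K ⊗ₖ (1 : Matrix I I ℂ))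
      σ).trace = (krausMap Ks (partialTrace σ)).trace := by
    intro Ks
    rw [trace_krausMap, trace_krausMap, Multiset.map_map]
    simp only [Function.comp_def, trace_kronecker_one_mul]
  rw [h1, ampliate_krausMap, ampliate_krausMap]
  refine (traceNorm_sub_le (posSemidef_krausMap _ hσ.1) (posSemidef_krausMap _ hσ.1)).trans ?_
  rw [h2, h2]
  linarith [hK _ (isDensity_partialTrace hσ), hL _ (isDensity_partialTrace hσ)]

end Diamond

/-! ### Pure branches of classical-quantum states -/

section Branch

variable {X Q In : Type} [DecidableEq X] [Fintype In]

/-- The branch with classical value `x` and quantum state `V ρ V†`. -/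
def branch (x : X) (V : Matrix Q In ℂ) (ρ : Matrix In In ℂ) : X → Matrix Q Q ℂ :=
  fun y => if y = x then V * ρ * Vᴴ else 0

lemma branch_zero (x : X) (ρ : Matrix In In ℂ) : branch x (0 : Matrix Q In ℂ) ρ = 0 := by
  funext y; simp [branch]

variable [Fintype X] [Fintype Q]

def KrausFamily.applyHom (F : KrausFamily X Q) : (X → Matrix Q Q ℂ) →+ (X → Matrix Q Q ℂ) where
  toFun := F.apply
  map_zero' := by funext x; simp [KrausFamily.apply]
  map_add' σ τ := by
    funext x
    simp [KrausFamily.apply, mul_add, add_mul, Finset.sum_add_distrib]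

/-- Each Kraus operator maps a pure branch to a pure branch, so the whole execution can be followed
as a sum of operators applied to the input. -/
lemma KrausFamily.apply_branch (F : KrausFamily X Q) (x : X) (V : Matrix Q In ℂ)
    (ρ : Matrix In In ℂ) :
    F.apply (branch x V ρ) = ∑ x', ∑ j, branch x' (F.K x x' j * V) ρ := by
  funext y
  simp only [KrausFamily.apply, branch, Finset.sum_apply]
  rw [Finset.sum_eq_single x (fun b _ hb => by simp [hb]) (by simp),
    Finset.sum_eq_single y (fun b _ hb => by simp [Ne.symm hb]) (by simp)]
  simp only [if_true]
  refine Finset.sum_congr rfl fun j _ => ?_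
  rw [Matrix.conjTranspose_mul]
  simp only [Matrix.mul_assoc]

lemma KrausFamily.apply_branch_of_eq (F : KrausFamily X Q) (x : X) (V : Matrix Q In ℂ)
    (ρ : Matrix In In ℂ) (u : Fin F.k → X) (K : Fin F.k → Matrix Q Q ℂ)
    (h : ∀ x' j, F.K x x' j = if x' = u j then K j else 0) :
    F.apply (branch x V ρ) = ∑ j, branch (u j) (K j * V) ρ := by
  rw [F.apply_branch, Finset.sum_comm]
  refine Finset.sum_congr rfl fun j _ => ?_
  rw [Finset.sum_eq_single (u j)]
  · rw [h, if_pos rfl]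
  · intro x' _ hx'
    rw [h, if_neg hx', Matrix.zero_mul, branch_zero]
  · simp

/-- A measurement with outcomes in `Λ`, controlled by and recorded in the classical register. -/
def controlledMeasurement {Λ : Type} [Fintype Λ] [DecidableEq Q] (R : X → Λ → Matrix Q Q ℂ)
    (u : X → Λ → X) (h : ∀ x, ∑ l, (R x l)ᴴ * R x l = 1) : Instrument X Q where
  k := Fintype.card Λ
  K x x' j := if x' = u x ((Fintype.equivFin Λ).symm j) then R x ((Fintype.equivFin Λ).symm j) else 0
  trace_preserving x := by
    rw [Finset.sum_comm, ← h x, ← (Fintype.equivFin Λ).symm.sum_comp]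
    refine Finset.sum_congr rfl fun j _ => ?_
    rw [Finset.sum_eq_single (u x ((Fintype.equivFin Λ).symm j)) (fun b _ hb => by simp [hb])
      (by simp)]
    simp

lemma sum_liftEquiv_mul {I J R : Type} [DecidableEq R] [Fintype I] [Fintype J] [Fintype R]
    (e : I ≃ J × R) (M : Matrix J J ℂ) (i : I) (g : I → ℂ) :
    ∑ i', liftEquiv e M i i' * g i' = ∑ j, M (e i).1 j * g (e.symm (j, (e i).2)) := by
  have := liftEquiv_mul_apply e M (Matrix.of fun i (_ : Unit) => g i) i ()
  simpa [Matrix.mul_apply] using this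

end Branch

/-! ### The operations of Alice, Bob and the adversary on a branch. -/

section Global

variable {n m q : ℕ} {A B E In : Type} [Fintype A] [DecidableEq A] [Fintype B]
  [DecidableEq B] [Fintype E] [DecidableEq E] [Fintype In]
variable (S : Simulator n m q) (𝒜 : Adversary m q E)

abbrev Simulator.WA : Type := Qubit × S.SA × S.TA

abbrev Simulator.WB : Type := S.SB × S.TB

/-- Alice's local registers, and everything else. -/
def aliceLocalEquiv (A B : Type) : QAll S 𝒜 A B ≃
    (Qubit × S.WA) × ((A × A) × S.QB B × (E × 𝒜.F)) where
  toFun p := (p.1.2.2, (p.1.1, p.1.2.1), p.2)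
  invFun p := ((p.2.1.1, p.2.1.2, p.1), p.2.2)
  left_inv _ := rfl
  right_inv _ := rfl

def bobLocalEquiv (A B : Type) : QAll S 𝒜 A B ≃
    (Qubit × S.WB) × ((B × B) × S.QA A × (E × 𝒜.F)) where
  toFun p := (p.2.1.2.2, (p.2.1.1, p.2.1.2.1), p.1, p.2.2)
  invFun p := (p.2.2.1, (p.2.1.1, p.2.1.2, p.1), p.2.2.2)
  left_inv _ := rfl
  right_inv _ := rfl

/-- Alice's registers on which the black box acts, and everything else. -/
def aliceCallEquiv (A B : Type) : QAll S 𝒜 A B ≃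
    (A × Qubit) × ((A × S.WA) × S.QB B × (E × 𝒜.F)) where
  toFun p := ((p.1.1, p.1.2.2.1), (p.1.2.1, p.1.2.2.2), p.2)
  invFun p := ((p.1.1, p.2.1.1, p.1.2, p.2.1.2), p.2.2)
  left_inv _ := rfl
  right_inv _ := rfl

def bobCallEquiv (A B : Type) : QAll S 𝒜 A B ≃
    (B × Qubit) × ((B × S.WB) × S.QA A × (E × 𝒜.F)) where
  toFun p := ((p.2.1.1, p.2.1.2.2.1), (p.2.1.2.1, p.2.1.2.2.2), p.1, p.2.2)
  invFun p := (p.2.2.1, (p.1.1, p.2.1.1, p.1.2, p.2.1.2), p.2.2.2)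
  left_inv _ := rfl
  right_inv _ := rfl

def eveEquiv (A B : Type) : QAll S 𝒜 A B ≃ (E × 𝒜.F) × (S.QA A × S.QB B) where
  toFun p := (p.2.2, p.1, p.2.1)
  invFun p := (p.2.1, p.2.2, p.1)
  left_inv _ := rfl
  right_inv _ := rfl

lemma aliceLift_local (M : Matrix (Qubit × S.WA) (Qubit × S.WA) ℂ) :
    ((1 : Matrix A A ℂ) ⊗ₖ ((1 : Matrix A A ℂ) ⊗ₖ M)) ⊗ₖ
      ((1 : Matrix (S.QB B) (S.QB B) ℂ) ⊗ₖ (1 : Matrix (E × 𝒜.F) (E × 𝒜.F) ℂ)) =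
      liftEquiv (aliceLocalEquiv S 𝒜 A B) M := by
  ext p p'
  rw [liftEquiv_apply]
  simp only [Matrix.one_kronecker_one, Matrix.kroneckerMap_apply, aliceLocalEquiv,
    Equiv.coe_fn_mk, Prod.mk.injEq, Matrix.one_apply]
  split_ifs <;> simp_all

lemma bobLift_local (M : Matrix (Qubit × S.WB) (Qubit × S.WB) ℂ) :
    (1 : Matrix (S.QA A) (S.QA A) ℂ) ⊗ₖ (((1 : Matrix B B ℂ) ⊗ₖ ((1 : Matrix B B ℂ) ⊗ₖ M)) ⊗ₖ
      (1 : Matrix (E × 𝒜.F) (E × 𝒜.F) ℂ)) = liftEquiv (bobLocalEquiv S 𝒜 A B) M := by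
  ext p p'
  rw [liftEquiv_apply]
  simp only [Matrix.kroneckerMap_apply, bobLocalEquiv,
    Equiv.coe_fn_mk, Prod.mk.injEq, Matrix.one_apply]
  split_ifs <;> simp_all

lemma aliceLift_call (U : Matrix (A × Qubit) (A × Qubit) ℂ) :
    (onData U : Matrix (S.QA A) (S.QA A) ℂ) ⊗ₖ
      ((1 : Matrix (S.QB B) (S.QB B) ℂ) ⊗ₖ (1 : Matrix (E × 𝒜.F) (E × 𝒜.F) ℂ)) =
      liftEquiv (aliceCallEquiv S 𝒜 A B) U := by
  ext p p'
  rw [liftEquiv_apply]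
  simp only [Matrix.one_kronecker_one, Matrix.kroneckerMap_apply, aliceCallEquiv, onData,
    Equiv.coe_fn_mk, Prod.mk.injEq, Matrix.one_apply, Matrix.of_apply]
  split_ifs <;> simp_all

lemma bobLift_call (U : Matrix (B × Qubit) (B × Qubit) ℂ) :
    (1 : Matrix (S.QA A) (S.QA A) ℂ) ⊗ₖ ((onData U : Matrix (S.QB B) (S.QB B) ℂ) ⊗ₖ
      (1 : Matrix (E × 𝒜.F) (E × 𝒜.F) ℂ)) = liftEquiv (bobCallEquiv S 𝒜 A B) U := by
  ext p p'
  rw [liftEquiv_apply]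
  simp only [Matrix.kroneckerMap_apply, bobCallEquiv, onData,
    Equiv.coe_fn_mk, Prod.mk.injEq, Matrix.one_apply, Matrix.of_apply]
  split_ifs <;> simp_all

lemma eveLift (M : Matrix (E × 𝒜.F) (E × 𝒜.F) ℂ) :
    (1 : Matrix (S.QA A) (S.QA A) ℂ) ⊗ₖ ((1 : Matrix (S.QB B) (S.QB B) ℂ) ⊗ₖ M) =
      liftEquiv (eveEquiv S 𝒜 A B) M := by
  ext p p'
  rw [liftEquiv_apply]
  simp only [Matrix.kroneckerMap_apply, eveEquiv,
    Equiv.coe_fn_mk, Prod.mk.injEq, Matrix.one_apply]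
  split_ifs <;> simp_all

variable {S 𝒜}
variable (V : Matrix (QAll S 𝒜 A B) In ℂ) (ρ : Matrix In In ℂ)

lemma liftAlice_loc_branch {J Λ : Type} [Fintype Λ] (U : J → Matrix (A × Qubit) (A × Qubit) ℂ)
    (R : S.X × Fin q → Λ → Matrix (Qubit × S.WA) (Qubit × S.WA) ℂ)
    (u : S.X × Fin q → Λ → S.X × Fin q) (h : ∀ x, ∑ l, (R x l)ᴴ * R x l = 1) (x : S.X) (y : S.Y)
    (z : 𝒜.Z) (c : Fin q) :
    (liftAlice S 𝒜 (Instruction.kraus U (.loc (controlledMeasurement R u h)))).apply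
      (branch (x, y, z, c) V ρ) =
      ∑ l, branch ((u (x, c) l).1, y, z, (u (x, c) l).2)
        (liftEquiv (aliceLocalEquiv S 𝒜 A B) (R (x, c) l) * V) ρ := by
  rw [KrausFamily.apply_branch_of_eq _ _ _ _
    (fun j => ((u (x, c) ((Fintype.equivFin Λ).symm j)).1, y, z,
      (u (x, c) ((Fintype.equivFin Λ).symm j)).2))
    (fun j => liftEquiv (aliceLocalEquiv S 𝒜 A B) (R (x, c) ((Fintype.equivFin Λ).symm j)))]
  · exact (Fintype.equivFin Λ).symm.sum_comp fun l => branch ((u (x, c) l).1, y, z, (u (x, c) l).2)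
        (liftEquiv (aliceLocalEquiv S 𝒜 A B) (R (x, c) l) * V) ρ
  · rintro ⟨x', y', z', c'⟩ j
    simp only [liftAlice, Instruction.kraus, controlledMeasurement]
    rw [aliceLift_local]
    simp only [apply_ite (liftEquiv (aliceLocalEquiv S 𝒜 A B)), liftEquiv_zero, Prod.ext_iff]
    split_ifs <;> simp_all

lemma liftBob_loc_branch {J Λ : Type} [Fintype Λ] (U : J → Matrix (B × Qubit) (B × Qubit) ℂ)
    (R : S.Y × Fin q → Λ → Matrix (Qubit × S.WB) (Qubit × S.WB) ℂ)
    (u : S.Y × Fin q → Λ → S.Y × Fin q) (h : ∀ x, ∑ l, (R x l)ᴴ * R x l = 1) (x : S.X) (y : S.Y)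
    (z : 𝒜.Z) (c : Fin q) :
    (liftBob S 𝒜 (Instruction.kraus U (.loc (controlledMeasurement R u h)))).apply
      (branch (x, y, z, c) V ρ) =
      ∑ l, branch (x, (u (y, c) l).1, z, (u (y, c) l).2)
        (liftEquiv (bobLocalEquiv S 𝒜 A B) (R (y, c) l) * V) ρ := by
  rw [KrausFamily.apply_branch_of_eq _ _ _ _
    (fun j => (x, (u (y, c) ((Fintype.equivFin Λ).symm j)).1, z,
      (u (y, c) ((Fintype.equivFin Λ).symm j)).2))
    (fun j => liftEquiv (bobLocalEquiv S 𝒜 A B) (R (y, c) ((Fintype.equivFin Λ).symm j)))]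
  · exact (Fintype.equivFin Λ).symm.sum_comp fun l => branch (x, (u (y, c) l).1, z, (u (y, c) l).2)
        (liftEquiv (bobLocalEquiv S 𝒜 A B) (R (y, c) l) * V) ρ
  · rintro ⟨x', y', z', c'⟩ j
    simp only [liftBob, Instruction.kraus, controlledMeasurement]
    rw [bobLift_local]
    simp only [apply_ite (liftEquiv (bobLocalEquiv S 𝒜 A B)), liftEquiv_zero, Prod.ext_iff]
    split_ifs <;> simp_all

/-- The operator applied by a query of the black box. -/
def callMatrix {I D J R : Type} [DecidableEq I] [DecidableEq R] (e : I ≃ (D × Qubit) × R)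
    (U : J → Matrix (D × Qubit) (D × Qubit) ℂ) : Option (J × Bool) → Matrix I I ℂ
  | none => 1
  | some (j, false) => liftEquiv e (U j)
  | some (j, true) => liftEquiv e (U j)ᴴ

lemma liftAlice_call_branch {J : Type} (U : J → Matrix (A × Qubit) (A × Qubit) ℂ)
    (f : S.X × Fin q → Option (J × Bool)) (x : S.X) (y : S.Y) (z : 𝒜.Z) (c : Fin q) :
    (liftAlice S 𝒜 (Instruction.kraus U (.call f))).apply (branch (x, y, z, c) V ρ) =
      branch (x, y, z, c) (callMatrix (aliceCallEquiv S 𝒜 A B) U (f (x, c)) * V) ρ := by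
  rw [KrausFamily.apply_branch_of_eq _ _ _ _ (fun _ => (x, y, z, c))
    (fun _ => callMatrix (aliceCallEquiv S 𝒜 A B) U (f (x, c)))]
  · exact Fin.sum_univ_one _
  · rintro ⟨x', y', z', c'⟩ j
    simp only [liftAlice, Instruction.kraus]
    by_cases h : x = x' ∧ y = y' ∧ z = z' ∧ c = c'
    · obtain ⟨rfl, rfl, rfl, rfl⟩ := h
      simp only [if_true, and_self]
      rcases f (x, c) with _ | ⟨j, _ | _⟩
      · simp [callMatrix]
      · exact aliceLift_call S 𝒜 _
      · exact aliceLift_call S 𝒜 _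
    · rw [if_neg (show ¬ (x', y', z', c') = (x, y, z, c) by
        simp only [Prod.mk.injEq]; tauto)]
      split_ifs with h1 h2
      · simp only [Prod.mk.injEq] at h2; tauto
      · simp
      · rfl

lemma liftBob_call_branch {J : Type} (U : J → Matrix (B × Qubit) (B × Qubit) ℂ)
    (f : S.Y × Fin q → Option (J × Bool)) (x : S.X) (y : S.Y) (z : 𝒜.Z) (c : Fin q) :
    (liftBob S 𝒜 (Instruction.kraus U (.call f))).apply (branch (x, y, z, c) V ρ) =
      branch (x, y, z, c) (callMatrix (bobCallEquiv S 𝒜 A B) U (f (y, c)) * V) ρ := by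
  rw [KrausFamily.apply_branch_of_eq _ _ _ _ (fun _ => (x, y, z, c))
    (fun _ => callMatrix (bobCallEquiv S 𝒜 A B) U (f (y, c)))]
  · exact Fin.sum_univ_one _
  · rintro ⟨x', y', z', c'⟩ j
    simp only [liftBob, Instruction.kraus]
    by_cases h : x = x' ∧ y = y' ∧ z = z' ∧ c = c'
    · obtain ⟨rfl, rfl, rfl, rfl⟩ := h
      simp only [if_true, and_self]
      rcases f (y, c) with _ | ⟨j, _ | _⟩
      · simp [callMatrix]
      · exact bobLift_call S 𝒜 _
      · exact bobLift_call S 𝒜 _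
    · rw [if_neg (show ¬ (x', y', z', c') = (x, y, z, c) by
        simp only [Prod.mk.injEq]; tauto)]
      split_ifs with h1 h2
      · simp only [Prod.mk.injEq] at h2; tauto
      · simp
      · rfl

lemma liftAlice_swap_branch {J : Type} (U : J → Matrix (A × Qubit) (A × Qubit) ℂ)
    (f : S.X × Fin q → Bool) (x : S.X) (y : S.Y) (z : 𝒜.Z) (c : Fin q) :
    (liftAlice S 𝒜 (Instruction.kraus U (.swap f))).apply (branch (x, y, z, c) V ρ) =
      branch (x, y, z, c) (Matrix.of fun p i => if f (x, c) then
        V ((p.1.2.1, p.1.1, p.1.2.2), p.2) i else V p i) ρ := by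
  rw [KrausFamily.apply_branch_of_eq _ _ _ _ (fun _ => (x, y, z, c))
    (fun _ => (if f (x, c) then swapData else 1 : Matrix (S.QA A) (S.QA A) ℂ) ⊗ₖ
      ((1 : Matrix (S.QB B) (S.QB B) ℂ) ⊗ₖ (1 : Matrix (E × 𝒜.F) (E × 𝒜.F) ℂ)))]
  · refine (Fin.sum_univ_one _).trans ?_
    congr 1
    cases f (x, c)
    · simp; rfl
    · ext p i
      rw [Matrix.one_kronecker_one]
      simp only [if_true, Matrix.mul_apply, Matrix.kroneckerMap_apply, Matrix.of_apply]
      rw [Finset.sum_eq_single ((p.1.2.1, p.1.1, p.1.2.2), p.2)]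
      · simp [swapData]
      · rintro ⟨⟨d, s, w⟩, r⟩ _ hne
        by_cases hr : p.2 = r
        · have : (swapData : Matrix (S.QA A) (S.QA A) ℂ) p.1 (d, s, w) = 0 := by
            simp only [swapData, Matrix.of_apply]
            rw [if_neg]
            rintro ⟨h1, h2, h3⟩
            exact hne (by rw [h1, h2, h3, hr])
          simp [this]
        · simp [hr]
      · simp
  · rintro ⟨x', y', z', c'⟩ j
    simp only [liftAlice, Instruction.kraus]
    by_cases h : x = x' ∧ y = y' ∧ z = z' ∧ c = c'
    · obtain ⟨rfl, rfl, rfl, rfl⟩ := h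
      simp
    · rw [if_neg (show ¬ (x', y', z', c') = (x, y, z, c) by
        simp only [Prod.mk.injEq]; tauto)]
      split_ifs with h1 h2
      · simp only [Prod.mk.injEq] at h2; tauto
      · simp only [Prod.mk.injEq] at h2; tauto
      · simp
      · rfl

lemma liftBob_swap_branch {J : Type} (U : J → Matrix (B × Qubit) (B × Qubit) ℂ)
    (f : S.Y × Fin q → Bool) (x : S.X) (y : S.Y) (z : 𝒜.Z) (c : Fin q) :
    (liftBob S 𝒜 (Instruction.kraus U (.swap f))).apply (branch (x, y, z, c) V ρ) =
      branch (x, y, z, c) (Matrix.of fun p i => if f (y, c) then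
        V (p.1, (p.2.1.2.1, p.2.1.1, p.2.1.2.2), p.2.2) i else V p i) ρ := by
  rw [KrausFamily.apply_branch_of_eq _ _ _ _ (fun _ => (x, y, z, c))
    (fun _ => (1 : Matrix (S.QA A) (S.QA A) ℂ) ⊗ₖ
      ((if f (y, c) then swapData else 1 : Matrix (S.QB B) (S.QB B) ℂ) ⊗ₖ
        (1 : Matrix (E × 𝒜.F) (E × 𝒜.F) ℂ)))]
  · refine (Fin.sum_univ_one _).trans ?_
    congr 1
    cases f (y, c)
    · simp; rfl
    · ext p i
      simp only [if_true, Matrix.mul_apply, Matrix.kroneckerMap_apply, Matrix.of_apply]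
      rw [Finset.sum_eq_single (p.1, (p.2.1.2.1, p.2.1.1, p.2.1.2.2), p.2.2)]
      · simp [swapData]
      · rintro ⟨r, ⟨d, s, w⟩, r'⟩ _ hne
        by_cases hr : p.1 = r
        · by_cases hr' : p.2.2 = r'
          · have : (swapData : Matrix (S.QB B) (S.QB B) ℂ) p.2.1 (d, s, w) = 0 := by
              simp only [swapData, Matrix.of_apply]
              rw [if_neg]
              rintro ⟨h1, h2, h3⟩
              exact hne (by rw [h1, h2, h3, hr, hr'])
            simp [this]
          · simp [Matrix.one_apply, hr']
        · simp [Matrix.one_apply, hr]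
      · simp
  · rintro ⟨x', y', z', c'⟩ j
    simp only [liftBob, Instruction.kraus]
    by_cases h : x = x' ∧ y = y' ∧ z = z' ∧ c = c'
    · obtain ⟨rfl, rfl, rfl, rfl⟩ := h
      simp
    · rw [if_neg (show ¬ (x', y', z', c') = (x, y, z, c) by
        simp only [Prod.mk.injEq]; tauto)]
      split_ifs with h1 h2
      · simp only [Prod.mk.injEq] at h2; tauto
      · simp only [Prod.mk.injEq] at h2; tauto
      · simp
      · rfl

lemma eveTurn_branch (i : Fin (2 * m)) (x : S.X) (y : S.Y) (z : 𝒜.Z) (c : Fin q) :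
    eveTurn S 𝒜 i (branch (x, y, z, c) V ρ) =
      ∑ zc : 𝒜.Z × Fin q, ∑ j, branch (x, y, zc.1, zc.2)
        (liftEquiv (eveEquiv S 𝒜 A B) ((𝒜.act i).K (z, c) zc j) * V) ρ := by
  rw [eveTurn, KrausFamily.apply_branch, Fintype.sum_prod_type,
    Finset.sum_eq_single x (fun x' _ hx' => ?_) (by simp), Fintype.sum_prod_type,
    Finset.sum_eq_single y (fun y' _ hy' => ?_) (by simp)]
  · refine Finset.sum_congr rfl fun zc _ => Finset.sum_congr rfl fun j _ => ?_
    simp only [liftEve, and_self, if_true]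
    rw [eveLift]
  · refine Finset.sum_eq_zero fun zc _ => Finset.sum_eq_zero fun j _ => ?_
    simp only [liftEve]
    rw [if_neg (fun h => hy' h.2.symm), Matrix.zero_mul, branch_zero]
  · refine Finset.sum_eq_zero fun zc _ => Finset.sum_eq_zero fun j _ => ?_
    simp only [liftEve]
    rw [if_neg (fun h => hx' h.1.symm), Matrix.zero_mul, branch_zero]

end Global

/-! ### Local operations of the simulation -/

section Local

variable {m : ℕ} {F : Type} [Field F] [Fintype F] [DecidableEq F]

/-- The shared secret key for one transmission: the key of the authentication, and a one-time pad. -/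
abbrev Key (F : Type) : Type := F × F × F

/-- One party's share of the entanglement for one transmission. -/
abbrev Share (F : Type) : Type := Qubit × Key F

abbrev Ent (m : ℕ) (F : Type) : Type := Fin (2 * m) → Share F

/-- Bell measurement of a qubit and a share with outcome `Q`, and measurement of the key. -/
def sendMatrix (Q : Pauli) (κ : Key F) : Matrix (Qubit × Share F) (Qubit × Share F) ℂ :=
  Matrix.of fun p p' => if p = 0 ∧ p'.2.2 = κ then ((√2 : ℝ) : ℂ)⁻¹ * pauliMatrix Q p'.2.1 p'.1 else 0

/-- Swap of a qubit and the qubit of a share, and measurement of the key. -/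
def recvMatrix (κ : Key F) : Matrix (Qubit × Share F) (Qubit × Share F) ℂ :=
  Matrix.of fun p p' => if p'.2.2 = κ ∧ p = (p'.2.1, p'.1, 0) then 1 else 0

/-- Completeness of the Pauli basis gives this for the qubits, and the key is measured projectively.
The reset to 0 does not change the norm. -/
lemma sum_sendMatrix : ∑ l : Pauli × Key F, (sendMatrix l.1 l.2)ᴴ * sendMatrix l.1 l.2 = 1 := by
  ext ⟨c, s, k⟩ ⟨c', s', k'⟩
  simp only [Matrix.sum_apply, Matrix.mul_apply, Matrix.conjTranspose_apply, sendMatrix,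
    Matrix.of_apply]
  have h1 : ∀ l : Pauli × Key F, (∑ p : Qubit × Share F,
      star (if p = 0 ∧ k = l.2 then ((√2 : ℝ) : ℂ)⁻¹ * pauliMatrix l.1 s c else 0) *
        (if p = 0 ∧ k' = l.2 then ((√2 : ℝ) : ℂ)⁻¹ * pauliMatrix l.1 s' c' else 0)) =
      if k = l.2 then (if k' = l.2 then
        (1 / 2) * (star (pauliMatrix l.1 s c) * pauliMatrix l.1 s' c') else 0) else 0 := by
    intro l
    rw [Finset.sum_eq_single 0 (fun p _ hp => by simp [hp]) (by simp)]
    have h2 : ((√2 : ℝ) : ℂ)⁻¹ * ((√2 : ℝ) : ℂ)⁻¹ = 1 / 2 := by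
      rw [← mul_inv, ← Complex.ofReal_mul, Real.mul_self_sqrt (by norm_num)]
      norm_num
    split_ifs with h3 h4 h5 h6 h7
    · rw [star_mul', ← h2]
      simp only [RCLike.star_def, map_inv₀, Complex.conj_ofReal]
      ring
    all_goals simp_all
  simp only [h1, Fintype.sum_prod_type (α₁ := Pauli), Finset.sum_ite_eq, Finset.mem_univ, if_true]
  by_cases hk : k' = k
  · subst hk
    simp only [if_true]
    rw [← Finset.mul_sum, pauliMatrix_completeness, Matrix.one_apply]
    by_cases h : s = s' ∧ c = c'
    · simp [h]
    · rw [if_neg h, if_neg (fun h' => h (by simp at h'; tauto))]; simp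
  · simp only [hk, if_false, Finset.sum_const_zero]
    rw [Matrix.one_apply, if_neg (fun h' => hk (by simp at h'; tauto))]

lemma sum_recvMatrix : ∑ κ : Key F, (recvMatrix κ)ᴴ * recvMatrix κ = 1 := by
  ext ⟨c, s, k⟩ ⟨c', s', k'⟩
  simp only [Matrix.sum_apply, Matrix.mul_apply, Matrix.conjTranspose_apply, recvMatrix,
    Matrix.of_apply]
  have h1 : ∀ κ : Key F, (∑ p : Qubit × Share F,
      star (if k = κ ∧ p = (s, c, 0) then (1 : ℂ) else 0) *
        (if k' = κ ∧ p = (s', c', 0) then (1 : ℂ) else 0)) =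
      if k = κ then (if k' = κ ∧ (s, c, (0 : Key F)) = (s', c', 0) then 1 else 0) else 0 := by
    intro κ
    rw [Finset.sum_eq_single (s, c, 0) (fun p _ hp => by simp [hp]) (by simp)]
    split_ifs <;> simp_all
  simp only [h1, Finset.sum_ite_eq, Finset.mem_univ, if_true, Matrix.one_apply]
  refine if_congr ?_ rfl rfl
  simp only [Prod.mk.injEq]
  constructor
  · rintro ⟨rfl, rfl, rfl, _⟩; simp
  · rintro ⟨rfl, rfl, rfl⟩; simp

/-- Both parties' shares are unused from number `t` on, and reset before. -/
def Fresh (t : ℕ) (tX tY : Ent m F) : Prop :=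
  ∀ j, if j.1 < t then tX j = 0 ∧ tY j = 0 else tX j = tY j

lemma Fresh.symm {t : ℕ} {tX tY : Ent m F} (h : Fresh t tX tY) : Fresh t tY tX := by
  intro j
  have := h j
  split_ifs at this ⊢
  · exact this.symm
  · exact this.symm

lemma fresh_comm {t : ℕ} {tX tY : Ent m F} : Fresh t tX tY ↔ Fresh t tY tX := ⟨.symm, .symm⟩

/-- Before share `t` is used its two halves carry equal basis labels, so a sum over one half
collapses to the value of the other. -/
lemma fresh_update_iff {t : Fin (2 * m)} {tX tY : Ent m F} {b : Share F} (h0 : tX t = 0) :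
    Fresh t (Function.update tX t b) tY ↔ b = tY t ∧ Fresh (t + 1) tX (Function.update tY t 0) := by
  constructor
  · intro h
    refine ⟨by simpa using h t, fun j => ?_⟩
    by_cases hj : j = t
    · subst hj; simp [h0]
    · have := h j
      have hne : j.1 ≠ t.1 := fun h => hj (Fin.ext h)
      rw [Function.update_of_ne hj] at this ⊢
      by_cases h1 : j.1 < t
      · rw [if_pos h1] at this; rw [if_pos (by omega)]; exact this
      · rw [if_neg h1] at this; rw [if_neg (by omega)]; exact this
  · rintro ⟨rfl, h⟩ j
    by_cases hj : j = t
    · subst hj; simp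
    · have := h j
      have hne : j.1 ≠ t.1 := fun h => hj (Fin.ext h)
      rw [Function.update_of_ne hj] at this ⊢
      by_cases h1 : j.1 < t
      · rw [if_pos (by omega)] at this; rw [if_pos h1]; exact this
      · rw [if_neg (by omega)] at this; rw [if_neg h1]; exact this

lemma Fresh.left_eq_zero {t : Fin (2 * m)} {tX tY : Ent m F} (h : Fresh (t + 1) tX tY) :
    tX t = 0 := by
  have := h t
  rw [if_pos (by omega)] at this
  exact this.1

open Classical in
-- Teleportation in coordinates: the correlation of the shares moves the state `h` into the
-- partner's half, with the Pauli operator `Q` applied to it, amplitude 1/√2 and the partner's key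
-- fixed to `κ`. It is stated for a sender X and a receiver Y to serve both directions.
lemma sum_sendMatrix_mul (t : Fin (2 * m)) (Q : Pauli) (κ : Key F) (c : Qubit) (tX tY : Ent m F)
    (C : Prop) (h : Qubit → ℂ) :
    ∑ p : Qubit × Share F, sendMatrix Q κ (c, tX t) p *
      (if C ∧ Fresh t (Function.update tX t p.2) tY then h p.1 else 0) =
    if C ∧ c = 0 ∧ (tY t).2 = κ ∧ Fresh (t + 1) tX (Function.update tY t 0) then
      ((√2 : ℝ) : ℂ)⁻¹ * ∑ c', pauliMatrix Q (tY t).1 c' * h c' else 0 := by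
  simp only [sendMatrix, Matrix.of_apply]
  by_cases h0 : (c, tX t) = (0 : Qubit × Share F)
  · have hc : c = 0 := congrArg Prod.fst h0
    have hX : tX t = 0 := congrArg Prod.snd h0
    simp only [eq_true h0, true_and, fresh_update_iff hX, eq_true hc]
    rw [Fintype.sum_prod_type]
    split_ifs with h1
    · obtain ⟨h1, h2, h3⟩ := h1
      rw [Finset.mul_sum]
      refine Finset.sum_congr rfl fun c' _ => ?_
      rw [Finset.sum_eq_single (tY t) (fun b _ hb => by simp [hb]) (by simp)]
      simp only [h1, h2, h3, and_self, if_true]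
      ring
    · refine Finset.sum_eq_zero fun c' _ => Finset.sum_eq_zero fun b _ => ?_
      by_cases h2 : b.2 = κ
      · rw [if_neg (show ¬ (C ∧ b = tY t ∧ Fresh (t + 1) tX (Function.update tY t 0)) by
          rintro ⟨h3, rfl, h4⟩; exact h1 ⟨h3, h2, h4⟩), mul_zero]
      · simp [h2]
  · rw [if_neg]
    · refine Finset.sum_eq_zero fun p _ => ?_
      simp [h0]
    · rintro ⟨_, rfl, _, h2⟩
      exact h0 (by rw [h2.left_eq_zero]; rfl)

open Classical in
-- The receiver's key has already been fixed by the sender's measurement, so a single outcome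
-- survives and the parties hold the same key.
lemma sum_recvMatrix_mul (t : Fin (2 * m)) (κ κ' : Key F) (c : Qubit) (tX tY : Ent m F)
    (C : Prop) (h : Qubit → ℂ) :
    ∑ p : Qubit × Share F, recvMatrix κ' (c, tX t) p *
      (if C ∧ p.1 = 0 ∧ p.2.2 = κ ∧ Fresh (t + 1) tY (Function.update tX t 0) then h p.2.1 else 0) =
    if κ' = κ then (if C ∧ Fresh (t + 1) tY tX then h c else 0) else 0 := by
  simp only [recvMatrix, Matrix.of_apply]
  by_cases h0 : tX t = 0
  · have hX : Function.update tX t 0 = tX := by rw [← h0, Function.update_eq_self]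
    rw [Finset.sum_eq_single (0, c, κ')]
    · simp only [h0, hX, true_and]
      rw [if_pos (show (c, (0 : Share F)) = (c, 0, 0) from rfl), one_mul]
      split_ifs <;> simp_all
    · rintro ⟨c', s', k'⟩ _ hne
      simp only [h0]
      rw [if_neg, zero_mul]
      rintro ⟨rfl, h2⟩
      apply hne
      have e1 : c = s' := congrArg Prod.fst h2
      have e2 : 0 = c' := congrArg (fun x => x.2.1) h2
      rw [e1, ← e2]
    · simp
  · rw [Finset.sum_eq_zero]
    · split_ifs with h1 h2
      · exact absurd h2.2.symm.left_eq_zero h0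
      · rfl
      · rfl
    · rintro ⟨c', s', k'⟩ _
      split_ifs with h1 h2
      · obtain ⟨_, rfl, _⟩ := h2
        exact absurd (congrArg Prod.snd h1.2) h0
      all_goals simp

variable {W R : Type}

/-- One party's communication qubit and share number `i`, and the rest of its work registers. -/
def shareEquiv (i : Fin (2 * m)) (e : W ≃ R × Ent m F) :
    Qubit × W ≃ (Qubit × Share F) × (R × ({j // j ≠ i} → Share F)) where
  toFun p := ((p.1, (e p.2).2 i), ((e p.2).1, fun j => (e p.2).2 j))
  invFun p := (p.1.1, e.symm (p.2.1, (Equiv.funSplitAt i (Share F)).symm (p.1.2, p.2.2)))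
  left_inv p := by
    have : (Equiv.funSplitAt i (Share F)).symm ((e p.2).2 i, fun j => (e p.2).2 j) = (e p.2).2 :=
      (Equiv.funSplitAt i (Share F)).symm_apply_apply _
    simp only [this]
    simp
  right_inv p := by
    obtain ⟨⟨c, b⟩, r, g⟩ := p
    have h := (Equiv.funSplitAt i (Share F)).apply_symm_apply (b, g)
    have h1 := congrArg Prod.fst h
    have h2 := congrArg Prod.snd h
    simp only [Equiv.funSplitAt_apply] at h1 h2
    simp only [Equiv.apply_symm_apply, h1, h2]

lemma shareEquiv_symm_apply (i : Fin (2 * m)) (e : W ≃ R × Ent m F) (p : Qubit × W)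
    (b : Qubit × Share F) : (shareEquiv i e).symm (b, (shareEquiv i e p).2) =
      (b.1, e.symm ((e p.2).1, Function.update (e p.2).2 i b.2)) := by
  have : (Equiv.funSplitAt i (Share F)).symm (b.2, fun j => (e p.2).2 j) =
      Function.update (e p.2).2 i b.2 := by
    rw [Equiv.symm_apply_eq]
    refine Prod.ext ?_ (funext fun j => ?_)
    · simp
    · simp [Function.update_of_ne j.2]
  exact congrArg (fun x => (b.1, e.symm ((e p.2).1, x))) this

end Local

/-! ### The simulation protocol -/

/-- The alphabet, the generator of the tree code and the labels of the log entries. -/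
structure Scheme (q : ℕ) (F : Type) where
  sym : F × F ≃ Fin q
  gen : ℕ → F
  label : TurnLog → F

/-- A party's memory: its log and the symbols received. -/
abbrev Mem (m : ℕ) (F : Type) : Type := (Fin m → TurnLog) × (Fin m → Option F)

section Simulation

variable {n m q : ℕ} {F : Type}

def Mem.log (M : Mem m F) : ℕ → TurnLog := extend ((0, none), 0) M.1

def Mem.received (M : Mem m F) : ℕ → Option F := extend none M.2

variable [Field F] [DecidableEq F]

def Scheme.action (C : Scheme q F) (p : Bool) (r : ℕ) (M : Mem m F) : Pauli × Option Bool :=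
  NoisyQC.action C.gen C.label p r M.log M.received

/-- The codeword symbol of turn `r`. -/
def Scheme.codeword (C : Scheme q F) (r : ℕ) (M : Mem m F) : F :=
  treeEncode C.gen C.label M.log r

/-- Authentication and encryption. -/
def Scheme.encrypt (C : Scheme q F) (κ : Key F) (y : F) : Fin q :=
  C.sym (y + κ.2.1, κ.1 * y + κ.2.2)

/-- A failed test of the tag is treated as an erasure. -/
def Scheme.decrypt (C : Scheme q F) (κ : Key F) (c : Fin q) : Option F :=
  if κ.1 * ((C.sym.symm c).1 - κ.2.1) = (C.sym.symm c).2 - κ.2.2 then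
    some ((C.sym.symm c).1 - κ.2.1) else none

def Scheme.recvMem (C : Scheme q F) (r : Fin m) (κ : Key F) (c : Fin q) (M : Mem m F) : Mem m F :=
  (M.1, Function.update M.2 r (C.decrypt κ c))

def Scheme.sendMem (C : Scheme q F) (p : Bool) (r : Fin m) (Q : Pauli) (M : Mem m F) : Mem m F :=
  (Function.update M.1 r (C.action p r M, Q), M.2)

/-- The index of the unitary that a party with counter `k` applies or undoes. -/
def moveIndex (k : ℤ) (o : Option Bool) : ℤ := if o = some false then k - 1 else k

/-- The corresponding query of a black box of `N` unitaries. -/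
def query (N : ℕ) (k : ℤ) (o : Option Bool) : Option (Fin N × Bool) :=
  if h : 0 ≤ moveIndex k o ∧ moveIndex k o < N then
    o.map fun d => (⟨(moveIndex k o).toNat, by omega⟩, !d)
  else none

def Scheme.aliceQuery (C : Scheme q F) (n r : ℕ) (M : Mem m F) : Option (Fin (n + 1) × Bool) :=
  query (n + 1) (logCounter M.log r) (C.action false r M).2

def Scheme.bobQuery (C : Scheme q F) (n r : ℕ) (M : Mem m F) : Option (Fin n × Bool) :=
  query n (logCounter M.log r) (C.action true r M).2

/-- Alice's letter number n + 1 is not in the black box; she performs or undoes it locally. The swap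
is its own inverse, so the direction is irrelevant. -/
def Scheme.swapsOutput (C : Scheme q F) (n r : ℕ) (M : Mem m F) : Prop :=
  (C.action false r M).2 ≠ none ∧
    moveIndex (logCounter M.log r) (C.action false r M).2 = n + 1

variable {W R : Type} [Fintype W] [DecidableEq W] [Fintype R] [DecidableEq R]

lemma sum_liftEquiv_conjTranspose_mul {I J R Λ : Type} [Fintype I] [Fintype J] [Fintype R]
    [DecidableEq I] [DecidableEq J] [DecidableEq R] [Fintype Λ] (e : I ≃ J × R)
    (K : Λ → Matrix J J ℂ) (h : ∑ l, (K l)ᴴ * K l = 1) :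
    ∑ l, (liftEquiv e (K l))ᴴ * liftEquiv e (K l) = 1 := by
  simp only [liftEquiv_conjTranspose, ← liftEquiv_mul]
  rw [← liftEquiv_sum, h, liftEquiv_one]

variable [Fintype F]

def Scheme.recv (C : Scheme q F) (e : W ≃ R × Ent m F) (i : Fin (2 * m)) (r : Fin m) :
    Instrument (Mem m F × Fin q) (Qubit × W) :=
  controlledMeasurement (Λ := Key F) (fun _ κ => liftEquiv (shareEquiv i e) (recvMatrix κ))
    (fun x κ => (C.recvMem r κ x.2 x.1, x.2))
    (fun _ => sum_liftEquiv_conjTranspose_mul _ _ sum_recvMatrix)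

def Scheme.send (C : Scheme q F) (e : W ≃ R × Ent m F) (p : Bool) (i : Fin (2 * m)) (r : Fin m) :
    Instrument (Mem m F × Fin q) (Qubit × W) :=
  controlledMeasurement (Λ := Pauli × Key F)
    (fun _ l => liftEquiv (shareEquiv i e) (sendMatrix l.1 l.2))
    (fun x l => (C.sendMem p r l.1 x.1, C.encrypt l.2 (C.codeword r (C.sendMem p r l.1 x.1))))
    (fun _ => sum_liftEquiv_conjTranspose_mul _ _ sum_sendMatrix)

lemma conjTranspose_mul_self_of_mem {I : Type} [Fintype I] [DecidableEq I] {U : Matrix I I ℂ}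
    (h : U ∈ Matrix.unitaryGroup I ℂ) : ∑ _ : Unit, Uᴴ * U = 1 := by
  rw [Finset.univ_unique, Finset.sum_singleton]
  exact Matrix.mem_unitaryGroup_iff'.1 h

def Scheme.correct (C : Scheme q F) (W : Type) [Fintype W] [DecidableEq W] (p : Bool) (r : Fin m) :
    Instrument (Mem m F × Fin q) (Qubit × W) :=
  controlledMeasurement (Λ := Unit)
    (fun x _ => liftEquiv (Equiv.refl (Qubit × W)) (pauliMatrix (C.action p r x.1).1))
    (fun x _ => x)
    (fun x => conjTranspose_mul_self_of_mem
      (liftUnitary (Equiv.refl (Qubit × W)) (pauli (C.action p r x.1).1)).2)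

/-- Alice's communication and output qubits, and the rest of her work registers. -/
def outputEquiv (T : Type) : Qubit × (Qubit × Unit × T) ≃ (Qubit × Qubit) × (Unit × T) where
  toFun p := ((p.1, p.2.1), p.2.2)
  invFun p := (p.1.1, p.1.2, p.2)
  left_inv _ := rfl
  right_inv _ := rfl

open Classical in
def Scheme.swapOutput (C : Scheme q F) (n : ℕ) (r : Fin m) :
    Instrument (Mem m F × Fin q) (Qubit × (Qubit × Unit × Ent m F)) :=
  controlledMeasurement (Λ := Unit)
    (fun x _ => if C.swapsOutput n r x.1 then
      liftEquiv (outputEquiv (Ent m F)) swapGateMatrix else 1)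
    (fun x _ => x)
    (fun x => conjTranspose_mul_self_of_mem (by
      split_ifs
      · exact (liftUnitary (outputEquiv (Ent m F)) swapGate).2
      · exact one_mem _))

def aliceShares (m : ℕ) (F : Type) : Qubit × Unit × Ent m F ≃ (Qubit × Unit) × Ent m F :=
  (Equiv.prodAssoc _ _ _).symm

def bobShares (m : ℕ) (F : Type) : Unit × Ent m F ≃ Unit × Ent m F := Equiv.refl _

/-- Alice's instructions in turn `r`. -/
def Scheme.aliceTurn (C : Scheme q F) (n : ℕ) (r : Fin (m + 1)) :
    List (Instruction (Fin (n + 1)) (Mem m F × Fin q) (Qubit × Unit × Ent m F)) :=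
  if h : r.1 < m then
    -- Before her first turn nothing has been teleported: `C` starts in Alice's qubit.
    (if r.1 = 0 then [] else
      [.loc (C.recv (aliceShares m F) ⟨2 * r.1 - 1, by omega⟩ ⟨r.1 - 1, by omega⟩)]) ++
    [.loc (C.correct _ false ⟨r, h⟩), .call fun x => C.aliceQuery n r x.1,
      .loc (C.swapOutput n ⟨r, h⟩),
      .loc (C.send (aliceShares m F) false ⟨2 * r.1, by omega⟩ ⟨r, h⟩)]
  -- In her last turn Alice only moves her data to safety. Bob's last message and teleported qubit
  -- are ignored.
  else [.swap fun _ => true]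

/-- Bob's instructions in turn `r`. -/
def Scheme.bobTurn (C : Scheme q F) (n : ℕ) (r : Fin m) :
    List (Instruction (Fin n) (Mem m F × Fin q) (Unit × Ent m F)) :=
  [.loc (C.recv (bobShares m F) ⟨2 * r.1, by omega⟩ r), .loc (C.correct _ true r),
    .call fun x => C.bobQuery n r x.1, .loc (C.send (bobShares m F) true ⟨2 * r.1 + 1, by omega⟩ r),
    -- Bob saves his data in his own last turn, before the last transmission.
    .swap fun _ => decide (r.1 + 1 = m)]

abbrev Scheme.simulator (C : Scheme q F) (n m : ℕ) : Simulator n m q where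
  X := Mem m F
  Y := Mem m F
  SA := Unit
  SB := Unit
  TA := Ent m F
  TB := Ent m F
  x0 := (fun _ => ((0, none), 0), fun _ => none)
  y0 := (fun _ => ((0, none), 0), fun _ => none)
  sA0 := ()
  sB0 := ()
  msg0 := C.sym 0
  -- One maximally entangled state provides all pairs for teleportation and all keys.
  phi s t := if s = t then ((√(Fintype.card (Ent m F)) : ℝ) : ℂ)⁻¹ else 0
  phi_unit := by
    have h : ∀ a : Ent m F, ∑ b : Ent m F,
        ‖(if a = b then ((√(Fintype.card (Ent m F)) : ℝ) : ℂ)⁻¹ else 0)‖ ^ 2 =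
          (Fintype.card (Ent m F) : ℝ)⁻¹ := by
      intro a
      rw [Finset.sum_eq_single a (fun b _ hb => by simp [Ne.symm hb]) (by simp)]
      rw [if_pos rfl, norm_inv, Complex.norm_real, Real.norm_eq_abs, inv_pow, sq_abs,
        Real.sq_sqrt (by positivity)]
    simp only [h, Finset.sum_const, Finset.card_univ, nsmul_eq_mul]
    exact mul_inv_cancel₀ (by exact_mod_cast Fintype.card_ne_zero)
  alice := C.aliceTurn n
  bob := C.bobTurn n

end Simulation

/-! ### The explicit form of the branches -/

section Form

/-- A product state of the data, `C` and the output qubit, located by `row`, and Eve's registers. -/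
def form {n m q : ℕ} {S : Simulator n m q} {A B E : Type} [Fintype E] [DecidableEq E]
    {𝒜 : Adversary m q E} (c : S.QA A → S.QB B → Prop) (row : S.QA A → S.QB B → Row A B) (w : ℂ)
    (W : Matrix (Row A B) (A × B × Qubit) ℂ) (N : Matrix (E × 𝒜.F) E ℂ) :
    Matrix (QAll S 𝒜 A B) ((A × B × Qubit) × E) ℂ :=
  open Classical in
  Matrix.of fun p i => if c p.1 p.2.1 then w * W (row p.1 p.2.1) i.1 * N p.2.2 i.2 else 0

lemma eve_mul_form {n m q : ℕ} {S : Simulator n m q} {A B E : Type} [Fintype A] [DecidableEq A]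
    [Fintype B] [DecidableEq B] [Fintype E] [DecidableEq E]
    {𝒜 : Adversary m q E} (c : S.QA A → S.QB B → Prop) (row : S.QA A → S.QB B → Row A B) (w : ℂ)
    (W : Matrix (Row A B) (A × B × Qubit) ℂ) (N : Matrix (E × 𝒜.F) E ℂ)
    (K : Matrix (E × 𝒜.F) (E × 𝒜.F) ℂ) :
    liftEquiv (eveEquiv S 𝒜 A B) K * form c row w W N = form c row w W (K * N) := by
  ext p i
  rw [liftEquiv_mul_apply]
  simp only [form, Matrix.of_apply, eveEquiv, Equiv.coe_fn_mk, Equiv.coe_fn_symm_mk]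
  split_ifs
  · rw [Matrix.mul_apply, Finset.mul_sum]
    refine Finset.sum_congr rfl fun j _ => ?_
    ring
  · simp

variable {n m q : ℕ} {F : Type} [Field F] [DecidableEq F] [Fintype F] (C : Scheme q F)
  {A B E : Type} [Fintype A] [DecidableEq A] [Inhabited A] [Fintype B] [DecidableEq B]
  [Inhabited B] [Fintype E] [DecidableEq E]

abbrev AliceReg (m : ℕ) (F A : Type) : Type := A × A × Qubit × (Qubit × Unit × Ent m F)

abbrev BobReg (m : ℕ) (F B : Type) : Type := B × B × Qubit × (Unit × Ent m F)

def SafeUnused (a : AliceReg m F A) (b : BobReg m F B) : Prop := a.2.1 = default ∧ b.2.1 = default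

/-- `C` is in Alice's qubit, and the shares are unused from number `t` on. -/
def AtAlice (t : ℕ) (a : AliceReg m F A) (b : BobReg m F B) : Prop :=
  (SafeUnused a b ∧ b.2.2.1 = 0) ∧ Fresh t a.2.2.2.2.2 b.2.2.2.2

def rowAtAlice (a : AliceReg m F A) (b : BobReg m F B) : Row A B := (a.1, b.1, a.2.2.1, a.2.2.2.1)

def AtBob (t : ℕ) (a : AliceReg m F A) (b : BobReg m F B) : Prop :=
  (SafeUnused a b ∧ a.2.2.1 = 0) ∧ Fresh t a.2.2.2.2.2 b.2.2.2.2

def rowAtBob (a : AliceReg m F A) (b : BobReg m F B) : Row A B := (a.1, b.1, b.2.2.1, a.2.2.2.1)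

/-- `C` has been teleported to Bob's share number `t`, which holds the key `κ`. -/
def ToBob (t : Fin (2 * m)) (κ : Key F) (a : AliceReg m F A) (b : BobReg m F B) : Prop :=
  (SafeUnused a b ∧ a.2.2.1 = 0) ∧ b.2.2.1 = 0 ∧ (b.2.2.2.2 t).2 = κ ∧
    Fresh (t + 1) a.2.2.2.2.2 (Function.update b.2.2.2.2 t 0)

def rowToBob (t : Fin (2 * m)) (a : AliceReg m F A) (b : BobReg m F B) : Row A B :=
  (a.1, b.1, (b.2.2.2.2 t).1, a.2.2.2.1)

def ToAlice (t : Fin (2 * m)) (κ : Key F) (a : AliceReg m F A) (b : BobReg m F B) : Prop :=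
  (SafeUnused a b ∧ b.2.2.1 = 0) ∧ a.2.2.1 = 0 ∧ (a.2.2.2.2.2 t).2 = κ ∧
    Fresh (t + 1) b.2.2.2.2 (Function.update a.2.2.2.2.2 t 0)

def rowToAlice (t : Fin (2 * m)) (a : AliceReg m F A) (b : BobReg m F B) : Row A B :=
  (a.1, b.1, (a.2.2.2.2.2 t).1, a.2.2.2.1)

variable {𝒜 : Adversary m q E} (w : ℂ)
    (W : Matrix (Row A B) (A × B × Qubit) ℂ) (N : Matrix (E × 𝒜.F) E ℂ)

lemma ite_eq_ite_of_iff {α : Type} {p p' : Prop} {i : Decidable p} {i' : Decidable p'} {x y z : α}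
    (h : p ↔ p') (hxy : x = y) : (if p then x else z) = if p' then y else z := by
  subst hxy
  exact if_congr h rfl rfl

/-- The measurement affects the amplitude by 1/√2 and the row operator by `Q` alone, independently
of the outcome of the key. This is why all branches have equal amplitudes. -/
lemma alice_send_form (t : Fin (2 * m)) (Q : Pauli) (κ : Key F) :
    liftEquiv (aliceLocalEquiv (C.simulator n m) 𝒜 A B)
      (liftEquiv (shareEquiv t (aliceShares m F)) (sendMatrix Q κ)) *
        form (S := C.simulator n m) (AtAlice t) rowAtAlice w W N =
      form (S := C.simulator n m) (ToBob t κ) (rowToBob t) (w * ((√2 : ℝ) : ℂ)⁻¹)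
        (liftEquiv (rowEquivC (A := A) (B := B)) (pauliMatrix Q) * W) N := by
  classical
  ext ⟨⟨a, sa, c, co, u, tA⟩, ⟨b, sb, cB, u', tB⟩, ef⟩ i
  rw [liftEquiv_mul_apply, sum_liftEquiv_mul]
  simp only [shareEquiv_symm_apply]
  refine Eq.trans ?_ ((sum_sendMatrix_mul t Q κ c tA tB (C := (sa = default ∧ sb = default) ∧ cB = 0)
    (fun c' => w * W (a, b, c', co) i.1 * N ef i.2)).trans ?_)
  · refine Finset.sum_congr rfl fun p _ => congrArg₂ _ rfl (ite_eq_ite_of_iff ?_ rfl)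
    exact Iff.rfl
  · refine ite_eq_ite_of_iff ?_ ?_
    · change _ ↔ ((sa = default ∧ sb = default) ∧ c = 0) ∧ cB = 0 ∧ _
      tauto
    · refine Eq.trans ?_ (congrArg (fun z => w * ((√2 : ℝ) : ℂ)⁻¹ * z * N ef i.2)
        (liftEquiv_mul_apply (rowEquivC (A := A) (B := B)) (pauliMatrix Q) W
          (a, b, ((tB : Ent m F) t).1, co) i.1).symm)
      simp only [Finset.mul_sum, Finset.sum_mul]
      refine Finset.sum_congr rfl fun j _ => ?_
      simp only [rowEquivC, Equiv.coe_fn_mk, Equiv.coe_fn_symm_mk]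
      ring

lemma bob_send_form (t : Fin (2 * m)) (Q : Pauli) (κ : Key F) :
    liftEquiv (bobLocalEquiv (C.simulator n m) 𝒜 A B)
      (liftEquiv (shareEquiv t (bobShares m F)) (sendMatrix Q κ)) *
        form (S := C.simulator n m) (AtBob t) rowAtBob w W N =
      form (S := C.simulator n m) (ToAlice t κ) (rowToAlice t) (w * ((√2 : ℝ) : ℂ)⁻¹)
        (liftEquiv (rowEquivC (A := A) (B := B)) (pauliMatrix Q) * W) N := by
  classical
  ext ⟨⟨a, sa, c, co, u, tA⟩, ⟨b, sb, cB, u', tB⟩, ef⟩ i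
  rw [liftEquiv_mul_apply, sum_liftEquiv_mul]
  simp only [shareEquiv_symm_apply]
  refine Eq.trans ?_ ((sum_sendMatrix_mul t Q κ cB tB tA (C := (sa = default ∧ sb = default) ∧ c = 0)
    (fun c' => w * W (a, b, c', co) i.1 * N ef i.2)).trans ?_)
  · refine Finset.sum_congr rfl fun p _ => congrArg₂ _ rfl (ite_eq_ite_of_iff ?_ rfl)
    exact and_congr Iff.rfl fresh_comm
  · refine ite_eq_ite_of_iff ?_ ?_
    · change _ ↔ ((sa = default ∧ sb = default) ∧ cB = 0) ∧ c = 0 ∧ _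
      tauto
    · refine Eq.trans ?_ (congrArg (fun z => w * ((√2 : ℝ) : ℂ)⁻¹ * z * N ef i.2)
        (liftEquiv_mul_apply (rowEquivC (A := A) (B := B)) (pauliMatrix Q) W
          (a, b, ((tA : Ent m F) t).1, co) i.1).symm)
      simp only [Finset.mul_sum, Finset.sum_mul]
      refine Finset.sum_congr rfl fun j _ => ?_
      simp only [rowEquivC, Equiv.coe_fn_mk, Equiv.coe_fn_symm_mk]
      ring

lemma bob_recv_form (t : Fin (2 * m)) (κ κ' : Key F) :
    liftEquiv (bobLocalEquiv (C.simulator n m) 𝒜 A B)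
      (liftEquiv (shareEquiv t (bobShares m F)) (recvMatrix κ')) *
        form (S := C.simulator n m) (ToBob t κ) (rowToBob t) w W N =
      if κ' = κ then form (S := C.simulator n m) (AtBob (t + 1)) rowAtBob w W N else 0 := by
  classical
  ext ⟨⟨a, sa, c, co, u, tA⟩, ⟨b, sb, cB, u', tB⟩, ef⟩ i
  rw [liftEquiv_mul_apply, sum_liftEquiv_mul]
  simp only [shareEquiv_symm_apply]
  refine Eq.trans ?_ ((sum_recvMatrix_mul t κ κ' cB tB tA
    (C := (sa = default ∧ sb = default) ∧ c = 0)
    (fun c' => w * W (a, b, c', co) i.1 * N ef i.2)).trans ?_)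
  · refine Finset.sum_congr rfl fun p _ => congrArg₂ _ rfl (ite_eq_ite_of_iff ?_ ?_)
    · refine and_congr Iff.rfl (and_congr Iff.rfl ?_)
      change (Function.update tB t p.2 t).2 = κ ∧
        Fresh (t + 1) tA (Function.update (Function.update tB t p.2) t 0) ↔ _
      rw [Function.update_self, Function.update_idem]
    · change w * W (a, b, (Function.update tB t p.2 t).1, co) i.1 * N ef i.2 = _
      rw [Function.update_self]
  · split_ifs with h1 h2
    · exact (if_pos h2).symm
    · exact (if_neg h2).symm
    · rfl

lemma alice_recv_form (t : Fin (2 * m)) (κ κ' : Key F) :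
    liftEquiv (aliceLocalEquiv (C.simulator n m) 𝒜 A B)
      (liftEquiv (shareEquiv t (aliceShares m F)) (recvMatrix κ')) *
        form (S := C.simulator n m) (ToAlice t κ) (rowToAlice t) w W N =
      if κ' = κ then form (S := C.simulator n m) (AtAlice (t + 1)) rowAtAlice w W N else 0 := by
  classical
  ext ⟨⟨a, sa, c, co, u, tA⟩, ⟨b, sb, cB, u', tB⟩, ef⟩ i
  rw [liftEquiv_mul_apply, sum_liftEquiv_mul]
  simp only [shareEquiv_symm_apply]
  refine Eq.trans ?_ ((sum_recvMatrix_mul t κ κ' c tA tB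
    (C := (sa = default ∧ sb = default) ∧ cB = 0)
    (fun c' => w * W (a, b, c', co) i.1 * N ef i.2)).trans ?_)
  · refine Finset.sum_congr rfl fun p _ => congrArg₂ _ rfl (ite_eq_ite_of_iff ?_ ?_)
    · refine and_congr Iff.rfl (and_congr Iff.rfl ?_)
      change (Function.update tA t p.2 t).2 = κ ∧
        Fresh (t + 1) tB (Function.update (Function.update tA t p.2) t 0) ↔ _
      rw [Function.update_self, Function.update_idem]
    · change w * W (a, b, (Function.update tA t p.2 t).1, co) i.1 * N ef i.2 = _
      rw [Function.update_self]
  · split_ifs with h1 h2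
    · exact (if_pos ⟨h2.1, h2.2.symm⟩).symm
    · exact (if_neg fun h => h2 ⟨h.1, h.2.symm⟩).symm
    · rfl

/-- A local operator on registers that only determine the row. -/
lemma liftEquiv_mul_form {S : Simulator n m q} {I R R' : Type} [Fintype I] [Fintype R]
    [DecidableEq R] [Fintype R'] [DecidableEq R'] (e : QAll S 𝒜 A B ≃ I × R)
    (e' : Row A B ≃ I × R') (M : Matrix I I ℂ) {c : S.QA A → S.QB B → Prop}
    {row : S.QA A → S.QB B → Row A B} (he : ∀ p i, c p.1 p.2.1 →
      c (e.symm (i, (e p).2)).1 (e.symm (i, (e p).2)).2.1 ∧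
      row (e.symm (i, (e p).2)).1 (e.symm (i, (e p).2)).2.1 = e'.symm (i, (e' (row p.1 p.2.1)).2) ∧
      (e.symm (i, (e p).2)).2.2 = p.2.2)
    (he1 : ∀ p, c p.1 p.2.1 → (e p).1 = (e' (row p.1 p.2.1)).1) :
    liftEquiv e M * form c row w W N = form c row w (liftEquiv e' M * W) N := by
  classical
  ext p i
  rw [liftEquiv_mul_apply]
  by_cases hc : c p.1 p.2.1
  · simp only [form, Matrix.of_apply]
    rw [if_pos hc, liftEquiv_mul_apply, Finset.mul_sum, Finset.sum_mul]
    refine Finset.sum_congr rfl fun j _ => ?_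
    obtain ⟨h1, h2, h3⟩ := he p j hc
    rw [if_pos h1, h2, h3, he1 p hc]
    ring
  · simp only [form, Matrix.of_apply]
    rw [if_neg hc]
    refine Finset.sum_eq_zero fun j _ => ?_
    rw [if_neg, mul_zero]
    intro h
    have := (he _ (e p).1 h).1
    simp only [Equiv.apply_symm_apply, Prod.mk.eta, Equiv.symm_apply_apply] at this
    exact hc this

end Form

/-! ### A turn of either party on a branch in explicit form. -/

section Turn

variable {n m q : ℕ} {F : Type} [Field F] [DecidableEq F] [Fintype F] (C : Scheme q F)
  {A B E : Type} [Fintype A] [DecidableEq A] [Inhabited A] [Fintype B] [DecidableEq B]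
  [Inhabited B] [Fintype E] [DecidableEq E] {𝒜 : Adversary m q E} (w : ℂ)
  (W : Matrix (Row A B) (A × B × Qubit) ℂ) (N : Matrix (E × 𝒜.F) E ℂ)

lemma liftEquiv_liftEquiv {I J K R R' : Type} [DecidableEq R] [DecidableEq R'] (e : I ≃ J × R)
    (e' : J ≃ K × R') (M : Matrix K K ℂ) : liftEquiv e (liftEquiv e' M) =
      liftEquiv ((e.trans (e'.prodCongr (Equiv.refl R))).trans (Equiv.prodAssoc K R' R)) M := by
  ext i i'
  simp only [liftEquiv_apply, Equiv.trans_apply, Equiv.prodCongr_apply, Prod.map,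
    Equiv.prodAssoc_apply, Equiv.refl_apply, Prod.mk.injEq]
  split_ifs <;> simp_all

lemma alice_correct_form (t : ℕ) (Q : Pauli) :
    liftEquiv (aliceLocalEquiv (C.simulator n m) 𝒜 A B)
      (liftEquiv (Equiv.refl (Qubit × (C.simulator n m).WA)) (pauliMatrix Q)) *
        form (S := C.simulator n m) (AtAlice t) rowAtAlice w W N =
      form (S := C.simulator n m) (AtAlice t) rowAtAlice w ((pauliC A B Q).1 * W) N := by
  rw [liftEquiv_liftEquiv]
  exact liftEquiv_mul_form w W N _ rowEquivC _ (fun _ _ h => ⟨h, rfl, rfl⟩) fun _ _ => rfl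

lemma bob_correct_form (t : ℕ) (Q : Pauli) :
    liftEquiv (bobLocalEquiv (C.simulator n m) 𝒜 A B)
      (liftEquiv (Equiv.refl (Qubit × (C.simulator n m).WB)) (pauliMatrix Q)) *
        form (S := C.simulator n m) (AtBob t) rowAtBob w W N =
      form (S := C.simulator n m) (AtBob t) rowAtBob w ((pauliC A B Q).1 * W) N := by
  rw [liftEquiv_liftEquiv]
  exact liftEquiv_mul_form w W N _ rowEquivC _ (fun _ _ h => ⟨h, rfl, rfl⟩) fun _ _ => rfl

lemma alice_swapGate_form (t : ℕ) :
    liftEquiv (aliceLocalEquiv (C.simulator n m) 𝒜 A B)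
      (liftEquiv (outputEquiv (Ent m F)) swapGateMatrix) *
        form (S := C.simulator n m) (AtAlice t) rowAtAlice w W N =
      form (S := C.simulator n m) (AtAlice t) rowAtAlice w
        (liftEquiv (rowEquivCC (A := A) (B := B)) swapGateMatrix * W) N := by
  rw [liftEquiv_liftEquiv]
  exact liftEquiv_mul_form w W N _ rowEquivCC _ (fun _ _ h => ⟨h, rfl, rfl⟩) fun _ _ => rfl

lemma alice_call_form {J : Type} (t : ℕ) (U : J → Matrix (A × Qubit) (A × Qubit) ℂ)
    (o : Option (J × Bool)) :
    callMatrix (aliceCallEquiv (C.simulator n m) 𝒜 A B) U o *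
        form (S := C.simulator n m) (AtAlice t) rowAtAlice w W N =
      form (S := C.simulator n m) (AtAlice t) rowAtAlice w (callMatrix (rowEquivAC (A := A) (B := B)) U o * W) N := by
  rcases o with _ | ⟨j, _ | _⟩
  · rw [callMatrix, callMatrix, Matrix.one_mul]
    exact congrArg (fun X => form _ _ w X N) (Matrix.one_mul W).symm
  all_goals
    exact liftEquiv_mul_form w W N _ rowEquivAC _ (fun _ _ h => ⟨h, rfl, rfl⟩) fun _ _ => rfl

lemma bob_call_form {J : Type} (t : ℕ) (U : J → Matrix (B × Qubit) (B × Qubit) ℂ)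
    (o : Option (J × Bool)) :
    callMatrix (bobCallEquiv (C.simulator n m) 𝒜 A B) U o *
        form (S := C.simulator n m) (AtBob t) rowAtBob w W N =
      form (S := C.simulator n m) (AtBob t) rowAtBob w (callMatrix (rowEquivBC (A := A) (B := B)) U o * W) N := by
  rcases o with _ | ⟨j, _ | _⟩
  · rw [callMatrix, callMatrix, Matrix.one_mul]
    exact congrArg (fun X => form _ _ w X N) (Matrix.one_mul W).symm
  all_goals
    exact liftEquiv_mul_form w W N _ rowEquivBC _ (fun _ _ h => ⟨h, rfl, rfl⟩) fun _ _ => rfl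

lemma coe_inv_unitaryGroup {I : Type} [Fintype I] [DecidableEq I] (U : Matrix.unitaryGroup I ℂ) :
    (U⁻¹).1 = U.1ᴴ := rfl

lemma query_false (N : ℕ) (k : ℤ) : query N k (some false) =
    if h : 0 ≤ k - 1 ∧ k - 1 < N then some (⟨(k - 1).toNat, by omega⟩, true) else none := rfl

lemma query_true (N : ℕ) (k : ℤ) : query N k (some true) =
    if h : 0 ≤ k ∧ k < N then some (⟨k.toNat, by omega⟩, false) else none := rfl

lemma query_none (N : ℕ) (k : ℤ) : query N k none = none := by simp [query]

/-- A move outside the range of the black box is skipped, in agreement with the convention that such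
letters are the identity. -/
lemma callMatrix_bobQuery (P : NoiselessProtocol n A B) (r : ℕ) (M : Mem m F) :
    callMatrix (rowEquivBC (A := A) (B := B)) (fun j => (P.bob j).1) (C.bobQuery n r M) =
      (moveUnitary P true (logCounter M.log r) (C.action true r M).2).1 := by
  unfold Scheme.bobQuery
  generalize (C.action true r M).2 = o
  generalize logCounter M.log r = k
  rcases o with _ | _ | _
  · rw [query_none]
    rfl
  · simp only [moveUnitary, letterUnitary]
    by_cases h : 0 ≤ k - 1 ∧ k - 1 < n
    · rw [dif_pos h, query_false, dif_pos h, callMatrix, coe_inv_unitaryGroup, coe_liftUnitary,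
        liftEquiv_conjTranspose]
    · rw [dif_neg h, query_false, dif_neg h, inv_one]
      rfl
  · simp only [moveUnitary, letterUnitary]
    by_cases h : 0 ≤ k ∧ k < n
    · rw [dif_pos h, query_true, dif_pos h, callMatrix, coe_liftUnitary]
    · rw [dif_neg h, query_true, dif_neg h]
      rfl

lemma swapGateMatrix_conjTranspose : swapGateMatrixᴴ = swapGateMatrix := by
  ext p p'
  simp only [Matrix.conjTranspose_apply, swapGateMatrix, Matrix.of_apply, apply_ite star, star_one,
    star_zero]
  refine ite_eq_ite_of_iff ?_ rfl
  constructor <;> rintro ⟨h1, h2⟩ <;> exact ⟨h2.symm, h1.symm⟩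

open Classical in
-- At most one of the two factors is non-trivial, since a query needs an index of at most `n` and
-- the swap needs the index n + 1.
lemma swapGate_mul_callMatrix_aliceQuery (P : NoiselessProtocol n A B) (r : ℕ) (M : Mem m F) :
    (if C.swapsOutput n r M then liftEquiv (rowEquivCC (A := A) (B := B)) swapGateMatrix else 1) *
      callMatrix (rowEquivAC (A := A) (B := B)) (fun j => (P.alice j).1) (C.aliceQuery n r M) =
      (moveUnitary P false (logCounter M.log r) (C.action false r M).2).1 := by
  unfold Scheme.aliceQuery Scheme.swapsOutput
  generalize (C.action false r M).2 = o
  generalize logCounter M.log r = k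
  rcases o with _ | _ | _
  · rw [query_none, if_neg (fun h => h.1 rfl), Matrix.one_mul]
    rfl
  · simp only [moveUnitary, letterUnitary]
    have hs : (some false ≠ none ∧ moveIndex k (some false) = n + 1) ↔ k - 1 = n + 1 :=
      and_iff_right (by simp)
    by_cases h : 0 ≤ k - 1 ∧ k - 1 ≤ n
    · rw [dif_pos h, query_false, dif_pos ⟨h.1, by push_cast; omega⟩,
        if_neg (fun h' => by have := hs.1 h'; omega), Matrix.one_mul, callMatrix,
        coe_inv_unitaryGroup, coe_liftUnitary, liftEquiv_conjTranspose]
    · rw [dif_neg h, query_false, dif_neg (fun h' => h ⟨h'.1, by push_cast at h'; omega⟩),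
        callMatrix, Matrix.mul_one]
      by_cases h' : k - 1 = n + 1
      · rw [if_pos h', if_pos (hs.2 h'), coe_inv_unitaryGroup, coe_liftUnitary, swapGate,
          liftEquiv_conjTranspose, swapGateMatrix_conjTranspose]
      · rw [if_neg h', if_neg (fun h1 => h' (hs.1 h1)), inv_one]
        rfl
  · simp only [moveUnitary, letterUnitary]
    have hs : (some true ≠ none ∧ moveIndex k (some true) = n + 1) ↔ k = n + 1 :=
      and_iff_right (by simp)
    by_cases h : 0 ≤ k ∧ k ≤ n
    · rw [dif_pos h, query_true, dif_pos ⟨h.1, by push_cast; omega⟩,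
        if_neg (fun h' => by have := hs.1 h'; omega), Matrix.one_mul, callMatrix,
        coe_liftUnitary]
    · rw [dif_neg h, query_true, dif_neg (fun h' => h ⟨h'.1, by push_cast at h'; omega⟩),
        callMatrix, Matrix.mul_one]
      by_cases h' : k = n + 1
      · rw [if_pos h', if_pos (hs.2 h'), coe_liftUnitary, swapGate]
      · rw [if_neg h', if_neg (fun h1 => h' (hs.1 h1))]
        rfl

open Classical in
lemma alice_swapOutput_form (t : ℕ) (p : Prop) :
    liftEquiv (aliceLocalEquiv (C.simulator n m) 𝒜 A B)
      (if p then liftEquiv (outputEquiv (Ent m F)) swapGateMatrix else 1) *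
        form (S := C.simulator n m) (AtAlice t) rowAtAlice w W N =
      form (S := C.simulator n m) (AtAlice t) rowAtAlice w
        ((if p then liftEquiv (rowEquivCC (A := A) (B := B)) swapGateMatrix else 1 :
          Matrix (Row A B) (Row A B) ℂ) * W) N := by
  by_cases h : p
  · rw [if_pos h, if_pos h]
    exact alice_swapGate_form C w W N t
  · rw [if_neg h, if_neg h, liftEquiv_one,
      Matrix.one_mul W]
    exact Matrix.one_mul (m := QAll (C.simulator n m) 𝒜 A B) _

variable (P : NoiselessProtocol n A B) (ρ : Matrix ((A × B × Qubit) × E) ((A × B × Qubit) × E) ℂ)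

lemma alice_correct_branch (t : ℕ) (r : Fin m) (M y : Mem m F) (z : 𝒜.Z) (c : Fin q) :
    (liftAlice (C.simulator n m) 𝒜
        (Instruction.kraus (fun j => (P.alice j).1) (.loc (C.correct _ false r)))).apply
      (branch (M, y, z, c) (form (S := C.simulator n m) (AtAlice t) rowAtAlice w W N) ρ) =
    branch (M, y, z, c) (form (S := C.simulator n m) (AtAlice t) rowAtAlice w
      ((pauliC A B (C.action false r M).1).1 * W) N) ρ := by
  refine (liftAlice_loc_branch _ _ _ _ _ _ _ _ _ _).trans (Fintype.sum_unique _ |>.trans ?_)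
  exact congrArg (fun V => branch _ V ρ) (alice_correct_form C w W N t _)

lemma bob_correct_branch (t : ℕ) (r : Fin m) (x M : Mem m F) (z : 𝒜.Z) (c : Fin q) :
    (liftBob (C.simulator n m) 𝒜
        (Instruction.kraus (fun j => (P.bob j).1) (.loc (C.correct _ true r)))).apply
      (branch (x, M, z, c) (form (S := C.simulator n m) (AtBob t) rowAtBob w W N) ρ) =
    branch (x, M, z, c) (form (S := C.simulator n m) (AtBob t) rowAtBob w
      ((pauliC A B (C.action true r M).1).1 * W) N) ρ := by
  refine (liftBob_loc_branch _ _ _ _ _ _ _ _ _ _).trans (Fintype.sum_unique _ |>.trans ?_)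
  exact congrArg (fun V => branch _ V ρ) (bob_correct_form C w W N t _)

lemma alice_call_branch (t : ℕ) (r : ℕ) (M y : Mem m F) (z : 𝒜.Z) (c : Fin q) :
    (liftAlice (C.simulator n m) 𝒜 (Instruction.kraus (fun j => (P.alice j).1)
        (.call fun x => C.aliceQuery n r x.1))).apply
      (branch (M, y, z, c) (form (S := C.simulator n m) (AtAlice t) rowAtAlice w W N) ρ) =
    branch (M, y, z, c) (form (S := C.simulator n m) (AtAlice t) rowAtAlice w
      (callMatrix (rowEquivAC (A := A) (B := B)) (fun j => (P.alice j).1) (C.aliceQuery n r M) * W) N) ρ :=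
  (liftAlice_call_branch _ _ _ _ _ _ _ _).trans
    (congrArg (fun V => branch _ V ρ) (alice_call_form C w W N t _ _))

lemma bob_call_branch (t : ℕ) (r : ℕ) (x M : Mem m F) (z : 𝒜.Z) (c : Fin q) :
    (liftBob (C.simulator n m) 𝒜 (Instruction.kraus (fun j => (P.bob j).1)
        (.call fun x => C.bobQuery n r x.1))).apply
      (branch (x, M, z, c) (form (S := C.simulator n m) (AtBob t) rowAtBob w W N) ρ) =
    branch (x, M, z, c) (form (S := C.simulator n m) (AtBob t) rowAtBob w
      (callMatrix (rowEquivBC (A := A) (B := B)) (fun j => (P.bob j).1) (C.bobQuery n r M) * W) N) ρ :=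
  (liftBob_call_branch _ _ _ _ _ _ _ _).trans
    (congrArg (fun V => branch _ V ρ) (bob_call_form C w W N t _ _))

open Classical in
lemma alice_swapOutput_branch (t : ℕ) (r : Fin m) (M y : Mem m F) (z : 𝒜.Z) (c : Fin q) :
    (liftAlice (C.simulator n m) 𝒜
        (Instruction.kraus (fun j => (P.alice j).1) (.loc (C.swapOutput n r)))).apply
      (branch (M, y, z, c) (form (S := C.simulator n m) (AtAlice t) rowAtAlice w W N) ρ) =
    branch (M, y, z, c) (form (S := C.simulator n m) (AtAlice t) rowAtAlice w
      ((if C.swapsOutput n r M then liftEquiv (rowEquivCC (A := A) (B := B)) swapGateMatrix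
        else 1) * W) N) ρ := by
  refine (liftAlice_loc_branch _ _ _ _ _ _ _ _ _ _).trans (Fintype.sum_unique _ |>.trans ?_)
  exact congrArg (fun V => branch _ V ρ) (alice_swapOutput_form C w W N t _)

lemma alice_send_branch (i : Fin (2 * m)) (r : Fin m) (M y : Mem m F) (z : 𝒜.Z) (c : Fin q) :
    (liftAlice (C.simulator n m) 𝒜 (Instruction.kraus (fun j => (P.alice j).1)
        (.loc (C.send (aliceShares m F) false i r)))).apply
      (branch (M, y, z, c) (form (S := C.simulator n m) (AtAlice i) rowAtAlice w W N) ρ) =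
    ∑ l : Pauli × Key F, branch (C.sendMem false r l.1 M, y, z,
        C.encrypt l.2 (C.codeword r (C.sendMem false r l.1 M)))
      (form (S := C.simulator n m) (ToBob i l.2) (rowToBob i) (w * ((√2 : ℝ) : ℂ)⁻¹)
        ((pauliC A B l.1).1 * W) N) ρ :=
  (liftAlice_loc_branch _ _ _ _ _ _ _ _ _ _).trans
    (Finset.sum_congr rfl fun _ _ => congrArg (fun V => branch _ V ρ) (alice_send_form C w W N i _ _))

lemma bob_send_branch (i : Fin (2 * m)) (r : Fin m) (x M : Mem m F) (z : 𝒜.Z) (c : Fin q) :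
    (liftBob (C.simulator n m) 𝒜 (Instruction.kraus (fun j => (P.bob j).1)
        (.loc (C.send (bobShares m F) true i r)))).apply
      (branch (x, M, z, c) (form (S := C.simulator n m) (AtBob i) rowAtBob w W N) ρ) =
    ∑ l : Pauli × Key F, branch (x, C.sendMem true r l.1 M, z,
        C.encrypt l.2 (C.codeword r (C.sendMem true r l.1 M)))
      (form (S := C.simulator n m) (ToAlice i l.2) (rowToAlice i) (w * ((√2 : ℝ) : ℂ)⁻¹)
        ((pauliC A B l.1).1 * W) N) ρ :=
  (liftBob_loc_branch _ _ _ _ _ _ _ _ _ _).trans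
    (Finset.sum_congr rfl fun _ _ => congrArg (fun V => branch _ V ρ) (bob_send_form C w W N i _ _))

lemma alice_recv_branch (r : Fin m) (i : Fin (2 * m)) (κ : Key F) (M y : Mem m F) (z : 𝒜.Z)
    (c : Fin q) : (liftAlice (C.simulator n m) 𝒜
        (Instruction.kraus (fun j => (P.alice j).1) (.loc (C.recv (aliceShares m F) i r)))).apply
      (branch (M, y, z, c) (form (S := C.simulator n m) (ToAlice i κ) (rowToAlice i) w W N) ρ) =
    branch (C.recvMem r κ c M, y, z, c)
      (form (S := C.simulator n m) (AtAlice (i + 1)) rowAtAlice w W N) ρ := by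
  refine (liftAlice_loc_branch _ _ _ _ _ _ _ _ _ _).trans
    ((Finset.sum_eq_single κ (fun κ' _ h => ?_) (by simp)).trans ?_)
  · exact (congrArg (fun V => branch _ V ρ)
      ((alice_recv_form C w W N i κ κ').trans (if_neg h))).trans (branch_zero _ _)
  · exact congrArg (fun V => branch _ V ρ) ((alice_recv_form C w W N i κ κ).trans (if_pos rfl))

lemma bob_recv_branch (r : Fin m) (i : Fin (2 * m)) (κ : Key F) (x M : Mem m F) (z : 𝒜.Z)
    (c : Fin q) : (liftBob (C.simulator n m) 𝒜
        (Instruction.kraus (fun j => (P.bob j).1) (.loc (C.recv (bobShares m F) i r)))).apply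
      (branch (x, M, z, c) (form (S := C.simulator n m) (ToBob i κ) (rowToBob i) w W N) ρ) =
    branch (x, C.recvMem r κ c M, z, c)
      (form (S := C.simulator n m) (AtBob (i + 1)) rowAtBob w W N) ρ := by
  refine (liftBob_loc_branch _ _ _ _ _ _ _ _ _ _).trans
    ((Finset.sum_eq_single κ (fun κ' _ h => ?_) (by simp)).trans ?_)
  · exact (congrArg (fun V => branch _ V ρ)
      ((bob_recv_form C w W N i κ κ').trans (if_neg h))).trans (branch_zero _ _)
  · exact congrArg (fun V => branch _ V ρ) ((bob_recv_form C w W N i κ κ).trans (if_pos rfl))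

/-- The instructions after the reception compose to `turnUnitary`, which links the physical
simulation to the calculus of words. -/
lemma alice_act_branch (i : Fin (2 * m)) (r : Fin m) (M y : Mem m F) (z : 𝒜.Z) (c : Fin q)
    (X : Matrix.unitaryGroup (Row A B) ℂ) (V₀ : Matrix (Row A B) (A × B × Qubit) ℂ) :
    ([.loc (C.correct _ false r), .call fun x => C.aliceQuery n r x.1, .loc (C.swapOutput n r),
      .loc (C.send (aliceShares m F) false i r)] :
        List (Instruction (Fin (n + 1)) (Mem m F × Fin q) (Qubit × Unit × Ent m F))).foldl
      (fun τ I => (liftAlice (C.simulator n m) 𝒜 (I.kraus fun j => (P.alice j).1)).apply τ)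
      (branch (M, y, z, c)
        (form (S := C.simulator n m) (AtAlice i) rowAtAlice w (X.1 * V₀) N) ρ) =
    ∑ l : Pauli × Key F, branch (C.sendMem false r l.1 M, y, z,
        C.encrypt l.2 (C.codeword r (C.sendMem false r l.1 M)))
      (form (S := C.simulator n m) (ToBob i l.2) (rowToBob i) (w * ((√2 : ℝ) : ℂ)⁻¹)
        ((turnUnitary P false (logCounter M.log r) (C.action false r M, l.1) * X).1 * V₀) N) ρ := by
  simp only [List.foldl_cons, List.foldl_nil]
  rw [alice_correct_branch, alice_call_branch, alice_swapOutput_branch, alice_send_branch]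
  refine Finset.sum_congr rfl fun l _ => congrArg (fun W => branch _ (form _ _ _ W N) ρ) ?_
  simp only [turnUnitary, Submonoid.coe_mul, ← swapGate_mul_callMatrix_aliceQuery,
    Matrix.mul_assoc]

lemma bob_act_branch (i : Fin (2 * m)) (r : Fin m) (x M : Mem m F) (z : 𝒜.Z) (c : Fin q)
    (X : Matrix.unitaryGroup (Row A B) ℂ) (V₀ : Matrix (Row A B) (A × B × Qubit) ℂ) :
    ([.loc (C.correct _ true r), .call fun x => C.bobQuery n r x.1,
      .loc (C.send (bobShares m F) true i r)] :
        List (Instruction (Fin n) (Mem m F × Fin q) (Unit × Ent m F))).foldl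
      (fun τ I => (liftBob (C.simulator n m) 𝒜 (I.kraus fun j => (P.bob j).1)).apply τ)
      (branch (x, M, z, c)
        (form (S := C.simulator n m) (AtBob i) rowAtBob w (X.1 * V₀) N) ρ) =
    ∑ l : Pauli × Key F, branch (x, C.sendMem true r l.1 M, z,
        C.encrypt l.2 (C.codeword r (C.sendMem true r l.1 M)))
      (form (S := C.simulator n m) (ToAlice i l.2) (rowToAlice i) (w * ((√2 : ℝ) : ℂ)⁻¹)
        ((turnUnitary P true (logCounter M.log r) (C.action true r M, l.1) * X).1 * V₀) N) ρ := by
  simp only [List.foldl_cons, List.foldl_nil]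
  rw [bob_correct_branch, bob_call_branch, callMatrix_bobQuery, bob_send_branch]
  refine Finset.sum_congr rfl fun l _ => congrArg (fun W => branch _ (form _ _ _ W N) ρ) ?_
  simp only [turnUnitary, Submonoid.coe_mul, Matrix.mul_assoc]

end Turn

/-! ### Runs of the simulation -/

/-- The classical record and the operators of one branch of an execution of the simulation. The
data of transmission number `t` is stored at `t + 1`; `cor` counts the undetected corruptions. -/
structure Run (m : ℕ) {q : ℕ} (F A B : Type) [Fintype A] [DecidableEq A] [Fintype B]
    [DecidableEq B] {E : Type} [Fintype E] [DecidableEq E] (𝒜 : Adversary m q E) where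
  mem : Bool → Mem m F
  z : ℕ → 𝒜.Z
  key : ℕ → Key F
  sent : ℕ → Fin q
  rcv : ℕ → Fin q
  op : ℕ → Matrix (E × 𝒜.F) (E × 𝒜.F) ℂ
  cor : ℕ
  X : Matrix.unitaryGroup (Row A B) ℂ
  N : Matrix (E × 𝒜.F) E ℂ

section Runs

variable {n m q : ℕ} {F : Type} [Field F] [DecidableEq F] [Fintype F] (C : Scheme q F)
  {A B E : Type} [Fintype A] [DecidableEq A] [Fintype B] [DecidableEq B]
  [Fintype E] [DecidableEq E] {𝒜 : Adversary m q E}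
  (P : NoiselessProtocol n A B)

variable (A B 𝒜) in
def Run.start : Run m F A B 𝒜 where
  mem _ := (fun _ => ((0, none), 0), fun _ => none)
  z _ := 𝒜.z0
  key _ := 0
  sent _ := C.sym 0
  rcv _ := C.sym 0
  op _ := 1
  cor := 0
  X := 1
  N := Matrix.of fun ef e => if ef.1 = e ∧ ef.2 = 𝒜.f0 then 1 else 0

variable (F 𝒜) in
/-- The outcomes of the sender's measurement and of the adversary's instrument. -/
abbrev Outcome (t : Fin (2 * m)) : Type :=
  (Pauli × Key F) × (𝒜.Z × Fin q) × Fin (𝒜.act t).k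

def halfIndex (t : Fin (2 * m)) : Fin m := ⟨t / 2, by omega⟩

/-- The memory of the party that acts before transmission `t`, after its reception. -/
def Run.recvMem (s : Run m F A B 𝒜) (t : Fin (2 * m)) : Mem m F :=
  if t.1 = 0 then s.mem false
  else C.recvMem ⟨(t.1 - 1) / 2, by omega⟩ (s.key t) (s.rcv t) (s.mem t.1.bodd)

def Run.sendMem (s : Run m F A B 𝒜) (t : Fin (2 * m)) (Q : Pauli) : Mem m F :=
  C.sendMem t.1.bodd (halfIndex t) Q (s.recvMem C t)

def Run.symbol (s : Run m F A B 𝒜) (t : Fin (2 * m)) (l : Pauli × Key F) : Fin q :=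
  C.encrypt l.2 (C.codeword (halfIndex t) (s.sendMem C t l.1))

/-- An undetected corruption. -/
def Scheme.Undetected (κ : Key F) (c c' : Fin q) : Prop := c ≠ c' ∧ C.decrypt κ c' ≠ none

open Classical in
def Run.next (t : Fin (2 * m)) (s : Run m F A B 𝒜) (l : Outcome F 𝒜 t) : Run m F A B 𝒜 where
  mem := Function.update s.mem t.1.bodd (s.sendMem C t l.1.1)
  z := Function.update s.z (t + 1) l.2.1.1
  key := Function.update s.key (t + 1) l.1.2
  sent := Function.update s.sent (t + 1) (s.symbol C t l.1)
  rcv := Function.update s.rcv (t + 1) l.2.1.2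
  op := Function.update s.op (t + 1) ((𝒜.act t).K (s.z t, s.symbol C t l.1) l.2.1 l.2.2)
  cor := s.cor + if C.Undetected l.1.2 (s.symbol C t l.1) l.2.1.2 then 1 else 0
  X := turnUnitary P t.1.bodd (logCounter (s.recvMem C t).log (halfIndex t))
    (C.action t.1.bodd (halfIndex t) (s.recvMem C t), l.1.1) * s.X
  N := (𝒜.act t).K (s.z t, s.symbol C t l.1) l.2.1 l.2.2 * s.N

variable (𝒜) in
/-- The runs of length `t`. -/
def runs : ℕ → Multiset (Run m F A B 𝒜)
  | 0 => {Run.start C A B 𝒜}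
  | t + 1 => if h : t < 2 * m then
      (runs t).bind fun s => (Finset.univ : Finset (Outcome F 𝒜 ⟨t, h⟩)).val.map (s.next C P ⟨t, h⟩)
    else runs t

lemma sum_runs_succ {G : Type} [AddCommMonoid G] {t : ℕ} (h : t < 2 * m)
    (f : Run m F A B 𝒜 → G) : ((runs C 𝒜 P (t + 1)).map f).sum =
      ((runs C 𝒜 P t).map fun s => ∑ l, f (s.next C P ⟨t, h⟩ l)).sum := by
  rw [runs, dif_pos h, Multiset.map_bind, Multiset.sum_bind]
  simp only [Multiset.map_map]
  rfl

def Run.config (s : Run m F A B 𝒜) (t : ℕ) : Config (C.simulator n m) 𝒜 :=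
  (s.mem false, s.mem true, s.z t, s.rcv t)

/-- The amplitude of each branch after `t` transmissions. -/
def amplitude (m : ℕ) (F : Type) [Fintype F] (t : ℕ) : ℂ :=
  ((√(Fintype.card (Ent m F)) : ℝ) : ℂ)⁻¹ * (((√2 : ℝ) : ℂ)⁻¹) ^ t

variable [Inhabited A] [Inhabited B]

def swapBob (b : BobReg m F B) : BobReg m F B := (b.2.1, b.1, b.2.2)

def swapAlice (a : AliceReg m F A) : AliceReg m F A := (a.2.1, a.1, a.2.2)

variable (n 𝒜) in
/-- The form after a transmission of Bob, who swaps his registers in his last turn. -/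
def formToAlice (t : Fin (2 * m)) (κ : Key F) (w : ℂ) (W : Matrix (Row A B) (A × B × Qubit) ℂ)
    (N : Matrix (E × 𝒜.F) E ℂ) :
    Matrix (QAll (C.simulator n m) 𝒜 A B) ((A × B × Qubit) × E) ℂ :=
  if t + 1 = 2 * m then
    form (S := C.simulator n m) (fun a b => ToAlice t κ a (swapBob b))
      (fun a b => rowToAlice t a (swapBob b)) w W N
  else form (S := C.simulator n m) (ToAlice t κ) (rowToAlice t) w W N

/-- The operator of a run after `t` transmissions. -/
def Run.operator (s : Run m F A B 𝒜) :
    ℕ → Matrix (QAll (C.simulator n m) 𝒜 A B) ((A × B × Qubit) × E) ℂ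
  | 0 => form (S := C.simulator n m) (AtAlice 0) rowAtAlice (amplitude m F 0)
      (s.X.1 * adjoinOutput (A := A) (B := B)) s.N
  | t + 1 => if h : t < 2 * m then
      if t.bodd then
        formToAlice n C 𝒜 ⟨t, h⟩ (s.key (t + 1)) (amplitude m F (t + 1))
          (s.X.1 * adjoinOutput (A := A) (B := B)) s.N
      else
        form (S := C.simulator n m) (ToBob ⟨t, h⟩ (s.key (t + 1))) (rowToBob ⟨t, h⟩)
          (amplitude m F (t + 1)) (s.X.1 * adjoinOutput (A := A) (B := B)) s.N
    else 0

variable (ρ : Matrix ((A × B × Qubit) × E) ((A × B × Qubit) × E) ℂ)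

def Run.state (s : Run m F A B 𝒜) (t : ℕ) : GState (C.simulator n m) 𝒜 A B :=
  branch (s.config C (n := n) t) (s.operator C (n := n) t) ρ

lemma foldl_apply_multiset_sum {ι κ : Type} {X Q : Type} [Fintype X] [Fintype Q]
    (K : ι → KrausFamily X Q) (l : List ι) (s : Multiset κ) (f : κ → X → Matrix Q Q ℂ) :
    l.foldl (fun τ I => (K I).apply τ) (s.map f).sum =
      (s.map fun i => l.foldl (fun τ I => (K I).apply τ) (f i)).sum := by
  induction l generalizing f with
  | nil => rfl
  | cons I l ih =>
    simp only [List.foldl_cons]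
    rw [← ih]
    congr 1
    refine (map_multiset_sum (K I).applyHom _).trans ?_
    rw [Multiset.map_map]
    rfl

lemma foldl_apply_sum {ι κ : Type} {X Q : Type} [Fintype X] [Fintype Q] (K : ι → KrausFamily X Q)
    (l : List ι) (s : Finset κ) (f : κ → X → Matrix Q Q ℂ) :
    l.foldl (fun τ I => (K I).apply τ) (∑ i ∈ s, f i) =
      ∑ i ∈ s, l.foldl (fun τ I => (K I).apply τ) (f i) := foldl_apply_multiset_sum K l s.1 f

lemma amplitude_succ (t : ℕ) : amplitude m F (t + 1) = amplitude m F t * ((√2 : ℝ) : ℂ)⁻¹ := by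
  rw [amplitude, amplitude, pow_succ, mul_assoc]

lemma alice_recv_state (s : Run m F A B 𝒜) (r : Fin m) :
    (if r.1 = 0 then [] else
      [.loc (C.recv (aliceShares m F) ⟨2 * r.1 - 1, by omega⟩ ⟨r.1 - 1, by omega⟩)] :
        List (Instruction (Fin (n + 1)) (Mem m F × Fin q) (Qubit × Unit × Ent m F))).foldl
      (fun τ I => (liftAlice (C.simulator n m) 𝒜 (I.kraus fun j => (P.alice j).1)).apply τ)
      (s.state C ρ (2 * r)) =
    branch (s.recvMem C ⟨2 * r, by omega⟩, s.mem true, s.z (2 * r), s.rcv (2 * r))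
      (form (S := C.simulator n m) (AtAlice (2 * r)) rowAtAlice (amplitude m F (2 * r))
        (s.X.1 * adjoinOutput (A := A) (B := B)) s.N) ρ := by
  obtain ⟨_ | r, hr⟩ := r
  · rfl
  · have h1 : 2 * r + 1 < 2 * m := by omega
    have h2 : (2 * r + 1).bodd = true := by simp
    have e : 2 * (r + 1) = 2 * r + 1 + 1 := by ring
    have h3 : s.operator C (n := n) (2 * (r + 1)) =
        form (S := C.simulator n m) (ToAlice ⟨2 * r + 1, h1⟩ (s.key (2 * r + 1 + 1)))
          (rowToAlice ⟨2 * r + 1, h1⟩) (amplitude m F (2 * r + 1 + 1)) (s.X.1 * adjoinOutput (A := A) (B := B))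
          s.N := by
      rw [e, Run.operator, dif_pos h1, if_pos h2, formToAlice, if_neg (by simp only; omega)]
    have h4 : s.recvMem C ⟨2 * (r + 1), by omega⟩ =
        C.recvMem ⟨r, by omega⟩ (s.key (2 * (r + 1))) (s.rcv (2 * (r + 1))) (s.mem false) := by
      rw [Run.recvMem, if_neg (by simp)]
      congr 2
      · simp only; omega
      · simp
    simp only [if_neg (show ¬ r + 1 = 0 by omega), List.foldl_cons, List.foldl_nil]
    rw [Run.state, h3, h4]
    exact alice_recv_branch C _ _ _ P ρ ⟨r, by omega⟩ ⟨2 * r + 1, h1⟩ _ _ _ _ _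

lemma eveTurn_multiset_sum {κ : Type} (S : Simulator n m q) (i : Fin (2 * m)) (s : Multiset κ)
    (f : κ → GState S 𝒜 A B) :
    eveTurn S 𝒜 i (s.map f).sum = (s.map fun x => eveTurn S 𝒜 i (f x)).sum :=
  (map_multiset_sum (liftEve S 𝒜 (𝒜.act i).toKrausFamily).applyHom _).trans
    (by rw [Multiset.map_map]; rfl)

lemma eveTurn_sum {κ : Type} (S : Simulator n m q) (i : Fin (2 * m)) (s : Finset κ)
    (f : κ → GState S 𝒜 A B) : eveTurn S 𝒜 i (∑ x ∈ s, f x) = ∑ x ∈ s, eveTurn S 𝒜 i (f x) :=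
  eveTurn_multiset_sum S i s.1 f

lemma halfIndex_two_mul (r : Fin m) (h : 2 * r.1 < 2 * m) : halfIndex ⟨2 * r.1, h⟩ = r :=
  Fin.ext (Nat.mul_div_cancel_left _ (by norm_num))

lemma aliceTurn_state (s : Run m F A B 𝒜) (r : Fin m) (h : 2 * r.1 < 2 * m) :
    aliceTurn (C.simulator n m) 𝒜 P r.castSucc (s.state C ρ (2 * r)) =
    ∑ l : Pauli × Key F, branch (s.sendMem C ⟨2 * r, h⟩ l.1, s.mem true, s.z (2 * r),
        s.symbol C ⟨2 * r, h⟩ l)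
      (form (S := C.simulator n m) (ToBob ⟨2 * r, h⟩ l.2) (rowToBob ⟨2 * r, h⟩)
        (amplitude m F (2 * r + 1))
        ((turnUnitary P (2 * r.1).bodd
          (logCounter (s.recvMem C ⟨2 * r, h⟩).log (halfIndex ⟨2 * r.1, h⟩))
          (C.action (2 * r.1).bodd (halfIndex ⟨2 * r.1, h⟩) (s.recvMem C ⟨2 * r, h⟩), l.1) *
            s.X).1 * adjoinOutput (A := A) (B := B)) s.N) ρ := by
  have hb : (2 * r.1).bodd = false := by simp
  rw [aliceTurn, show (C.simulator n m).alice r.castSucc = C.aliceTurn n r.castSucc from rfl,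
    Scheme.aliceTurn, dif_pos (show r.castSucc.1 < m from r.2), List.foldl_append]
  refine (congrArg (List.foldl _ · _) (alice_recv_state C P ρ s r)).trans
    ((alice_act_branch C _ _ P ρ ⟨2 * r.1, h⟩ r _ _ _ _ _ _).trans ?_)
  simp only [Run.symbol, Run.sendMem, halfIndex_two_mul, hb, amplitude_succ]

/-- The turn of Alice before transmission number `2 r`, and the transmission. -/
lemma eveTurn_aliceTurn_state (s : Run m F A B 𝒜) (r : Fin m) (h : 2 * r.1 < 2 * m) :
    eveTurn (C.simulator n m) 𝒜 ⟨2 * r, h⟩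
      (aliceTurn (C.simulator n m) 𝒜 P r.castSucc (s.state C ρ (2 * r))) =
    ∑ l : Outcome F 𝒜 ⟨2 * r, h⟩, (s.next C P _ l).state C ρ (2 * r + 1) := by
  have hb : (2 * r.1).bodd = false := by simp
  rw [aliceTurn_state C P ρ s r h, eveTurn_sum]
  refine Eq.trans ?_ (Fintype.sum_prod_type _).symm
  refine Finset.sum_congr rfl fun l _ => ?_
  rw [eveTurn_branch]
  refine Eq.trans ?_ (Fintype.sum_prod_type _).symm
  refine Finset.sum_congr rfl fun zc _ => Finset.sum_congr rfl fun j _ => ?_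
  rw [eve_mul_form, Run.state, Run.operator, dif_pos h, if_neg (by simp [hb]), Run.config]
  simp only [Run.next, Function.update_self, hb]
  rfl

lemma bob_swap_branch (r : Fin m) (h : 2 * r.1 + 1 < 2 * m) (κ : Key F) (w : ℂ)
    (W : Matrix (Row A B) (A × B × Qubit) ℂ) (N : Matrix (E × 𝒜.F) E ℂ) (x y : Mem m F) (z : 𝒜.Z)
    (c : Fin q) :
    (liftBob (C.simulator n m) 𝒜 (Instruction.kraus (fun j => (P.bob j).1)
        (.swap fun _ => decide (r.1 + 1 = m)))).apply
      (branch (x, y, z, c) (form (S := C.simulator n m) (ToAlice ⟨2 * r + 1, h⟩ κ)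
        (rowToAlice ⟨2 * r + 1, h⟩) w W N) ρ) =
    branch (x, y, z, c) (formToAlice n C 𝒜 ⟨2 * r + 1, h⟩ κ w W N) ρ := by
  refine (liftBob_swap_branch _ _ _ _ _ _ _ _).trans (congrArg (fun V => branch _ V ρ) ?_)
  rw [formToAlice]
  by_cases hr : r.1 + 1 = m
  · rw [if_pos (by simp only; omega)]
    simp only [hr, decide_true, if_true]
    rfl
  · rw [if_neg (by simp only; omega)]
    simp only [hr, decide_false]
    rfl

lemma halfIndex_two_mul_add_one (r : Fin m) (h : 2 * r.1 + 1 < 2 * m) :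
    halfIndex ⟨2 * r.1 + 1, h⟩ = r := Fin.ext (by simp only [halfIndex]; omega)

lemma bob_recv_state (s : Run m F A B 𝒜) (r : Fin m) (h : 2 * r.1 + 1 < 2 * m) :
    (liftBob (C.simulator n m) 𝒜 (Instruction.kraus (fun j => (P.bob j).1)
        (.loc (C.recv (bobShares m F) ⟨2 * r.1, by omega⟩ r)))).apply
      (s.state C ρ (2 * r + 1)) =
    branch (s.mem false, s.recvMem C ⟨2 * r + 1, h⟩, s.z (2 * r + 1), s.rcv (2 * r + 1))
      (form (S := C.simulator n m) (AtBob (2 * r + 1)) rowAtBob (amplitude m F (2 * r + 1))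
        (s.X.1 * adjoinOutput (A := A) (B := B)) s.N) ρ := by
  have h1 : 2 * r.1 < 2 * m := by omega
  have h4 : s.recvMem C ⟨2 * r + 1, h⟩ =
      C.recvMem r (s.key (2 * r + 1)) (s.rcv (2 * r + 1)) (s.mem true) := by
    rw [Run.recvMem, if_neg (by simp)]
    congr 2
    · simp
    · simp
  rw [Run.state, Run.operator, dif_pos h1, if_neg (by simp), h4]
  exact bob_recv_branch C _ _ _ P ρ r ⟨2 * r, h1⟩ _ _ _ _ _

lemma bobTurn_state (s : Run m F A B 𝒜) (r : Fin m) (h : 2 * r.1 + 1 < 2 * m) :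
    bobTurn (C.simulator n m) 𝒜 P r (s.state C ρ (2 * r + 1)) =
    ∑ l : Pauli × Key F, branch (s.mem false, s.sendMem C ⟨2 * r + 1, h⟩ l.1, s.z (2 * r + 1),
        s.symbol C ⟨2 * r + 1, h⟩ l)
      (formToAlice n C 𝒜 ⟨2 * r + 1, h⟩ l.2 (amplitude m F (2 * r + 1 + 1))
        ((turnUnitary P (2 * r.1 + 1).bodd
          (logCounter (s.recvMem C ⟨2 * r + 1, h⟩).log (halfIndex ⟨2 * r.1 + 1, h⟩))
          (C.action (2 * r.1 + 1).bodd (halfIndex ⟨2 * r.1 + 1, h⟩)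
            (s.recvMem C ⟨2 * r + 1, h⟩), l.1) *
            s.X).1 * adjoinOutput (A := A) (B := B)) s.N) ρ := by
  have hb : (2 * r.1 + 1).bodd = true := by simp
  rw [bobTurn, show (C.simulator n m).bob r = [.loc (C.recv (bobShares m F) ⟨2 * r.1, by omega⟩ r)]
    ++ ([.loc (C.correct _ true r), .call fun x => C.bobQuery n r x.1,
      .loc (C.send (bobShares m F) true ⟨2 * r.1 + 1, by omega⟩ r)] ++
      [.swap fun _ => decide (r.1 + 1 = m)]) from rfl, List.foldl_append, List.foldl_append]
  refine (congrArg (fun σ => List.foldl _ (List.foldl _ σ _) _)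
    (bob_recv_state C P ρ s r h)).trans ((congrArg (List.foldl _ · _)
    (bob_act_branch C _ _ P ρ ⟨2 * r.1 + 1, h⟩ r _ _ _ _ _ _)).trans ?_)
  rw [foldl_apply_sum]
  refine Finset.sum_congr rfl fun l _ => ?_
  rw [List.foldl_cons, List.foldl_nil, bob_swap_branch C P ρ r h]
  simp only [Run.symbol, Run.sendMem, halfIndex_two_mul_add_one, hb, amplitude_succ]

lemma eve_mul_formToAlice (t : Fin (2 * m)) (κ : Key F) (w : ℂ)
    (W : Matrix (Row A B) (A × B × Qubit) ℂ) (N : Matrix (E × 𝒜.F) E ℂ)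
    (K : Matrix (E × 𝒜.F) (E × 𝒜.F) ℂ) :
    liftEquiv (eveEquiv (C.simulator n m) 𝒜 A B) K * formToAlice n C 𝒜 t κ w W N =
      formToAlice n C 𝒜 t κ w W (K * N) := by
  unfold formToAlice
  split_ifs <;> exact eve_mul_form _ _ _ _ _ _

/-- The turn of Bob before transmission number `2 r + 1`, and the transmission. -/
lemma eveTurn_bobTurn_state (s : Run m F A B 𝒜) (r : Fin m) (h : 2 * r.1 + 1 < 2 * m) :
    eveTurn (C.simulator n m) 𝒜 ⟨2 * r + 1, h⟩
      (bobTurn (C.simulator n m) 𝒜 P r (s.state C ρ (2 * r + 1))) =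
    ∑ l : Outcome F 𝒜 ⟨2 * r + 1, h⟩, (s.next C P _ l).state C ρ (2 * r + 1 + 1) := by
  have hb : (2 * r.1 + 1).bodd = true := by simp
  rw [bobTurn_state C P ρ s r h, eveTurn_sum]
  refine Eq.trans ?_ (Fintype.sum_prod_type _).symm
  refine Finset.sum_congr rfl fun l _ => ?_
  rw [eveTurn_branch]
  refine Eq.trans ?_ (Fintype.sum_prod_type _).symm
  refine Finset.sum_congr rfl fun zc _ => Finset.sum_congr rfl fun j _ => ?_
  rw [eve_mul_formToAlice, Run.state, Run.operator, dif_pos h, if_pos hb, Run.config]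
  simp only [Run.next, Function.update_self, hb]
  rfl

end Runs

/-! ### The channel of the simulation as a sum over runs. -/

section Channel

variable {n m q : ℕ} {F : Type} [Field F] [DecidableEq F] [Fintype F] (C : Scheme q F)
  {A B E : Type} [Fintype A] [DecidableEq A] [Inhabited A] [Fintype B] [DecidableEq B]
  [Inhabited B] [Fintype E] [DecidableEq E] {𝒜 : Adversary m q E}
  (P : NoiselessProtocol n A B) (ρ : Matrix ((A × B × Qubit) × E) ((A × B × Qubit) × E) ℂ)

/-- Freshness at time 0 says that the labels of the two parties' shares are equal, which is the
support of the maximally entangled state. -/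
lemma initState_eq : initState (C.simulator n m) 𝒜 ρ = (Run.start C A B 𝒜).state C ρ 0 := by
  have h : initIsometry (C.simulator n m) 𝒜 = (Run.start C A B 𝒜).operator C (n := n) 0 := by
    ext ⟨⟨a, sa, c, co, u, tA⟩, ⟨b, sb, cB, u', tB⟩, ⟨e, f⟩⟩ ⟨⟨a₁, b₁, c₁⟩, e₁⟩
    have hF : Fresh 0 tA tB ↔ tA = tB := ⟨fun h => funext fun j => by simpa using h j,
      fun h j => by simp [h]⟩
    simp only [initIsometry, Run.operator, form, Run.start, AtAlice, SafeUnused, rowAtAlice,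
      Matrix.of_apply, amplitude, pow_zero, mul_one, hF, adjoinOutput]
    split_ifs <;> simp_all
  funext x
  rw [Run.state, ← h]
  rfl

lemma state_after_rounds :
    Fin.foldl m (fun σ r => eveTurn (C.simulator n m) 𝒜 ⟨2 * r.1 + 1, by omega⟩
      (bobTurn (C.simulator n m) 𝒜 P r (eveTurn (C.simulator n m) 𝒜 ⟨2 * r.1, by omega⟩
        (aliceTurn (C.simulator n m) 𝒜 P r.castSucc σ)))) (initState (C.simulator n m) 𝒜 ρ) =
    ((runs C 𝒜 P (2 * m)).map fun s => s.state C ρ (2 * m)).sum := by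
  refine finFoldl_induction _ _
    (fun r σ => σ = ((runs C 𝒜 P (2 * r)).map fun s => s.state C ρ (2 * r)).sum) ?_ ?_
  · rw [initState_eq]
    simp [runs]
  · rintro r σ rfl
    have h0 : 2 * r.1 < 2 * m := by omega
    have h1 : 2 * r.1 + 1 < 2 * m := by omega
    rw [show 2 * (r.1 + 1) = 2 * r.1 + 1 + 1 by ring, sum_runs_succ C P h1]
    simp only [← eveTurn_bobTurn_state C P ρ _ r h1]
    rw [← eveTurn_multiset_sum]
    congr 1
    refine Eq.trans ?_ (foldl_apply_multiset_sum _ _ _ _)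
    refine congrArg (List.foldl _ · _) ?_
    rw [sum_runs_succ C P h0]
    simp only [← eveTurn_aliceTurn_state C P ρ _ r h0]
    rw [← eveTurn_multiset_sum]
    congr 1
    exact foldl_apply_multiset_sum _ _ _ _

/-- The Kraus operators of the simulation in a final form, for each basis state of the registers
that are traced out. -/
def outputKraus (w : ℂ) (W : Matrix (Row A B) (A × B × Qubit) ℂ) (N : Matrix (E × 𝒜.F) E ℂ)
    (g : Qubit × (E × 𝒜.F)) : Matrix (A × B × Qubit) ((A × B × Qubit) × E) ℂ :=
  Matrix.of fun p i => w * W (p.1, p.2.1, g.1, p.2.2) i.1 * N g.2 i.2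

/-- The registers that are traced out at the end. -/
abbrev Traced (S : Simulator n m q) (𝒜 : Adversary m q E) (A B : Type) : Type :=
  A × Qubit × (S.SA × S.TA) × B × Qubit × (S.SB × S.TB) × (E × 𝒜.F)

def attach {S : Simulator n m q} (τ : Traced S 𝒜 A B) (p : A × B × Qubit) : QAll S 𝒜 A B :=
  ((τ.1, p.1, τ.2.1, p.2.2, τ.2.2.1), (τ.2.2.2.1, p.2.1, τ.2.2.2.2.1, τ.2.2.2.2.2.1),
    τ.2.2.2.2.2.2)

lemma outputState_branch (S : Simulator n m q) (x : Config S 𝒜)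
    (V : Matrix (QAll S 𝒜 A B) ((A × B × Qubit) × E) ℂ) (p p' : A × B × Qubit) :
    outputState S 𝒜 (branch x V ρ) p p' =
      ∑ τ : Traced S 𝒜 A B, (V * ρ * Vᴴ) (attach τ p) (attach τ p') := by
  obtain ⟨a, b, c⟩ := p
  obtain ⟨a', b', c'⟩ := p'
  simp only [outputState, Matrix.of_apply]
  rw [Finset.sum_eq_single x (fun y _ hy => by simp [branch, hy]) (by simp)]
  simp only [branch, if_true, attach, Fintype.sum_prod_type (α₁ := A),
    Fintype.sum_prod_type (α₁ := Qubit), Fintype.sum_prod_type (α₁ := S.SA × S.TA),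
    Fintype.sum_prod_type (α₁ := B), Fintype.sum_prod_type (α₁ := S.SB × S.TB)]

variable (n 𝒜) in
/-- The form at the end of the simulation. -/
def finalForm (t : Fin (2 * m)) (κ : Key F) (w : ℂ) (W : Matrix (Row A B) (A × B × Qubit) ℂ)
    (N : Matrix (E × 𝒜.F) E ℂ) :
    Matrix (QAll (C.simulator n m) 𝒜 A B) ((A × B × Qubit) × E) ℂ :=
  form (S := C.simulator n m) (fun a b => ToAlice t κ (swapAlice a) (swapBob b))
    (fun a b => rowToAlice t (swapAlice a) (swapBob b)) w W N

/-- The values of the traced registers in a final form. -/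
def finalTraced (t : Fin (2 * m)) (κ : Key F) (g : Qubit × (E × 𝒜.F)) :
    Traced (C.simulator n m) 𝒜 A B :=
  (default, 0, ((), Function.update (0 : Ent m F) t (g.1, κ)), default, 0, ((), (0 : Ent m F)), g.2)

lemma finalForm_attach (t : Fin (2 * m)) (ht : t.1 + 1 = 2 * m) (κ : Key F) (w : ℂ)
    (W : Matrix (Row A B) (A × B × Qubit) ℂ) (N : Matrix (E × 𝒜.F) E ℂ)
    (g : Qubit × (E × 𝒜.F)) (p : A × B × Qubit) (i : (A × B × Qubit) × E) :
    finalForm n C 𝒜 t κ w W N (attach (finalTraced C t κ g) p) i = outputKraus w W N g p i := by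
  classical
  refine (if_pos ⟨⟨⟨rfl, rfl⟩, rfl⟩, rfl, ?_, fun j => ?_⟩).trans ?_
  · change w * W (p.1, p.2.1, (Function.update (0 : Ent m F) t (g.1, κ) t).1, p.2.2) i.1 * N g.2 i.2
      = _
    rw [Function.update_self]
    rfl
  · change (Function.update (0 : Ent m F) t (g.1, κ) t).2 = κ
    rw [Function.update_self]
  · rw [if_pos (by omega)]
    refine ⟨rfl, ?_⟩
    change Function.update (Function.update (0 : Ent m F) t (g.1, κ)) t 0 j = 0
    rw [Function.update_idem]
    simp

lemma finalForm_attach_of_ne (t : Fin (2 * m)) (ht : t.1 + 1 = 2 * m) (κ : Key F) (w : ℂ)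
    (W : Matrix (Row A B) (A × B × Qubit) ℂ) (N : Matrix (E × 𝒜.F) E ℂ)
    (τ : Traced (C.simulator n m) 𝒜 A B) (hτ : τ ∉ Set.range (finalTraced C t κ))
    (p : A × B × Qubit) (i : (A × B × Qubit) × E) :
    finalForm n C 𝒜 t κ w W N (attach τ p) i = 0 := by
  classical
  obtain ⟨dA, cA, ⟨uA, tA⟩, dB, cB, ⟨uB, tB⟩, ef⟩ := τ
  refine if_neg fun h => hτ ⟨((((tA : Ent m F) t).1), ef), ?_⟩
  obtain ⟨⟨⟨h1, h2⟩, h3⟩, h4, h5, h6⟩ := h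
  have h7 : (tB : Ent m F) = 0 := funext fun j => by
    have := h6 j
    rw [if_pos (by omega)] at this
    exact this.1
  have h8 : Function.update (0 : Ent m F) t (((tA : Ent m F) t).1, κ) = tA := by
    funext j
    by_cases hj : j = t
    · subst hj
      rw [Function.update_self]
      exact Prod.ext rfl h5.symm
    · have := h6 j
      rw [if_pos (by omega)] at this
      rw [Function.update_of_ne hj]
      have h9 := this.2
      change Function.update (tA : Ent m F) t 0 j = 0 at h9
      rw [Function.update_of_ne hj] at h9
      exact h9.symm
  change dA = default at h1
  change dB = default at h2
  change cB = 0 at h3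
  change cA = 0 at h4
  simp only [finalTraced, h8, h1, h2, h3, h4, h7]

/-- The form vanishes unless every traced register has its reset value. The exceptions are the last
teleported qubit, left in Alice's share with the key `κ`, and the adversary's registers, so the
trace runs over these only. -/
lemma outputState_finalForm (t : Fin (2 * m)) (ht : t.1 + 1 = 2 * m) (κ : Key F) (w : ℂ)
    (W : Matrix (Row A B) (A × B × Qubit) ℂ) (N : Matrix (E × 𝒜.F) E ℂ)
    (x : Config (C.simulator n m) 𝒜) :
    outputState (C.simulator n m) 𝒜 (branch x (finalForm n C 𝒜 t κ w W N) ρ) =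
      krausMap ((Finset.univ : Finset (Qubit × (E × 𝒜.F))).val.map (outputKraus w W N)) ρ := by
  ext p p'
  rw [outputState_branch, krausMap_apply, Multiset.map_map]
  refine (Fintype.sum_of_injective (finalTraced C t κ) ?_ _ _ ?_ ?_).symm
  · rintro ⟨γ, ef⟩ ⟨γ', ef'⟩ h
    have h1 : ef = ef' := congrArg (fun τ => τ.2.2.2.2.2.2) h
    have h2 : Function.update (0 : Ent m F) t (γ, κ) = Function.update (0 : Ent m F) t (γ', κ) :=
      congrArg (fun τ => τ.2.2.1.2) h
    have h3 := congrFun h2 t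
    rw [Function.update_self, Function.update_self] at h3
    rw [h1, show γ = γ' from congrArg Prod.fst h3]
  · intro τ hτ
    rw [mul_mul_conjTranspose_apply]
    refine Finset.sum_eq_zero fun i _ => Finset.sum_eq_zero fun i' _ => ?_
    rw [finalForm_attach_of_ne C t ht κ w W N τ hτ, zero_mul, zero_mul]
  · intro g
    simp only [Function.comp_apply, mul_mul_conjTranspose_apply]
    refine Finset.sum_congr rfl fun i _ => Finset.sum_congr rfl fun i' _ => ?_
    rw [finalForm_attach C t ht, finalForm_attach C t ht]

/-- The Kraus operators contributed by a run of full length. -/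
def Run.kraus (s : Run m F A B 𝒜) : Multiset (Matrix (A × B × Qubit) ((A × B × Qubit) × E) ℂ) :=
  (Finset.univ : Finset (Qubit × (E × 𝒜.F))).val.map
    (outputKraus (amplitude m F (2 * m)) (s.X.1 * adjoinOutput (A := A) (B := B)) s.N)

lemma outputState_aliceTurn_state (hm : 1 ≤ m) (s : Run m F A B 𝒜) :
    outputState (C.simulator n m) 𝒜
      (aliceTurn (C.simulator n m) 𝒜 P (Fin.last m) (s.state C ρ (2 * m))) =
      krausMap s.kraus ρ := by
  have ht : 2 * m - 1 < 2 * m := by omega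
  have hb : (2 * m - 1).bodd = true := by
    obtain ⟨k, rfl⟩ : ∃ k, m = k + 1 := ⟨m - 1, by omega⟩
    rw [show 2 * (k + 1) - 1 = 2 * k + 1 by omega]
    simp
  have e : 2 * m = 2 * m - 1 + 1 := by omega
  have h1 : s.operator C (n := n) (2 * m) =
      form (S := C.simulator n m)
        (fun a b => ToAlice ⟨2 * m - 1, ht⟩ (s.key (2 * m - 1 + 1)) a (swapBob b))
        (fun a b => rowToAlice ⟨2 * m - 1, ht⟩ a (swapBob b)) (amplitude m F (2 * m))
          (s.X.1 * adjoinOutput (A := A) (B := B)) s.N := by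
    have h2 : ∀ k, k = 2 * m - 1 + 1 → s.operator C (n := n) k = form (S := C.simulator n m)
        (fun a b => ToAlice ⟨2 * m - 1, ht⟩ (s.key (2 * m - 1 + 1)) a (swapBob b))
        (fun a b => rowToAlice ⟨2 * m - 1, ht⟩ a (swapBob b)) (amplitude m F k)
          (s.X.1 * adjoinOutput (A := A) (B := B)) s.N := by
      rintro k rfl
      rw [Run.operator, dif_pos ht, if_pos hb, formToAlice, if_pos e.symm]
    exact h2 _ e
  have h3 : aliceTurn (C.simulator n m) 𝒜 P (Fin.last m) (s.state C ρ (2 * m)) =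
      branch (s.config C (n := n) (2 * m)) (finalForm n C 𝒜 ⟨2 * m - 1, ht⟩ (s.key (2 * m - 1 + 1))
        (amplitude m F (2 * m)) (s.X.1 * adjoinOutput (A := A) (B := B)) s.N) ρ := by
    rw [aliceTurn, show (C.simulator n m).alice (Fin.last m) = C.aliceTurn n (Fin.last m) from rfl,
      Scheme.aliceTurn, dif_neg (show ¬ (Fin.last m).1 < m from lt_irrefl m), List.foldl_cons,
      List.foldl_nil, Run.state, h1]
    exact (liftAlice_swap_branch _ _ _ _ _ _ _ _).trans (congrArg (fun V => branch _ V ρ) rfl)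
  rw [h3]
  exact outputState_finalForm C ρ _ e.symm _ _ _ _ _

lemma outputState_multiset_sum {κ : Type} (S : Simulator n m q) (s : Multiset κ)
    (f : κ → GState S 𝒜 A B) :
    outputState S 𝒜 (s.map f).sum = (s.map fun x => outputState S 𝒜 (f x)).sum := by
  have h0 : outputState S 𝒜 (0 : GState S 𝒜 A B) = 0 := by
    ext p p'
    exact Finset.sum_eq_zero fun x _ => by simp only [Pi.zero_apply, Matrix.zero_apply,
      Finset.sum_const_zero]
  have hadd : ∀ σ τ : GState S 𝒜 A B,
      outputState S 𝒜 (σ + τ) = outputState S 𝒜 σ + outputState S 𝒜 τ := by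
    intro σ τ
    ext p p'
    simp only [outputState, Matrix.of_apply, Matrix.add_apply, Pi.add_apply,
      Finset.sum_add_distrib]
  refine (map_multiset_sum (⟨⟨outputState S 𝒜, h0⟩, hadd⟩ :
    GState S 𝒜 A B →+ Matrix (A × B × Qubit) (A × B × Qubit) ℂ) _).trans ?_
  rw [Multiset.map_map]
  rfl

lemma krausMap_bind {ι I O : Type} [Fintype I] (s : Multiset ι)
    (f : ι → Multiset (Matrix O I ℂ)) (ρ : Matrix I I ℂ) :
    krausMap (s.bind f) ρ = (s.map fun x => krausMap (f x) ρ).sum := by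
  simp only [krausMap, Multiset.map_bind, Multiset.sum_bind]

/-- The channel induced by the simulation, as a sum over its runs. -/
theorem simChannel_eq (hm : 1 ≤ m) : simChannel (C.simulator n m) 𝒜 P ρ =
    krausMap ((runs C 𝒜 P (2 * m)).bind Run.kraus) ρ := by
  rw [simChannel, state_after_rounds, krausMap_bind]
  simp only [← outputState_aliceTurn_state C P ρ hm]
  rw [← outputState_multiset_sum]
  congr 1
  exact foldl_apply_multiset_sum _ _ _ _

end Channel

lemma extend_update {α : Type} {M : ℕ} (d : α) (g : Fin M → α) (i : Fin M) (x : α) :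
    extend d (Function.update g i x) = Function.update (extend d g) i x := by
  funext j
  by_cases hj : j = i
  · subst hj
    rw [Function.update_self, extend_val, Function.update_self]
  · rw [Function.update_of_ne hj]
    unfold extend
    split_ifs with h
    · rw [Function.update_of_ne fun h' => hj (by rw [← h'])]
    · rfl

/-! ### Consistency of the record of a run. -/

section Invariants

variable {n m q : ℕ} {F : Type} [Field F] [DecidableEq F] [Fintype F] (C : Scheme q F)
  {A B E : Type} [Fintype A] [DecidableEq A] [Fintype B] [DecidableEq B]
  [Fintype E] [DecidableEq E] {𝒜 : Adversary m q E}
  (P : NoiselessProtocol n A B)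

open Classical in
/-- The record of a run of length `t` is consistent. -/
structure Run.Valid (s : Run m F A B 𝒜) (t : ℕ) : Prop where
  log_eq : ∀ p r, 2 * r + p.toNat < t → ((s.mem p).log r).1 = C.action p r (s.mem p)
  sent_eq : ∀ p r, 2 * r + p.toNat < t → s.sent (2 * r + p.toNat + 1) =
    C.encrypt (s.key (2 * r + p.toNat + 1)) (C.codeword r (s.mem p))
  received_eq : ∀ p r, 2 * r + (!p).toNat + 1 < t → (s.mem p).received r =
    C.decrypt (s.key (2 * r + (!p).toNat + 1)) (s.rcv (2 * r + (!p).toNat + 1))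
  received_none : ∀ p r, t ≤ 2 * r + (!p).toNat + 1 → (s.mem p).received r = none
  cor_eq : s.cor = ((Finset.range t).filter fun i =>
    C.Undetected (s.key (i + 1)) (s.sent (i + 1)) (s.rcv (i + 1))).card
  X_eq : s.X = unitaryBefore P (s.mem false).log (s.mem true).log t.bodd (t / 2)
  z_zero : s.z 0 = 𝒜.z0
  op_eq : ∀ i : Fin (2 * m), i.1 < t → ∃ j, s.op (i + 1) =
    (𝒜.act i).K (s.z i, s.sent (i + 1)) (s.z (i + 1), s.rcv (i + 1)) j
  N_eq : s.N = ((List.range t).map fun i => s.op (i + 1)).reverse.prod * (Run.start C A B 𝒜).N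

lemma Run.valid_start : (Run.start C A B 𝒜).Valid C P 0 where
  log_eq p r h := by omega
  sent_eq p r h := by omega
  received_eq p r h := by omega
  received_none p r h := by simp [Run.start, Mem.received, extend]
  cor_eq := by
    rw [Finset.range_zero, Finset.filter_empty]
    rfl
  X_eq := by simp [Run.start, unitaryBefore, unitaryAfter]
  z_zero := rfl
  op_eq i h := by omega
  N_eq := by simp

variable {C P} {s : Run m F A B 𝒜} {t : Fin (2 * m)}

lemma Run.recvMem_log : (s.recvMem C t).log = (s.mem t.1.bodd).log := by
  unfold Run.recvMem
  split_ifs with h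
  · rw [h]; rfl
  · rfl

lemma Run.sendMem_log (Q : Pauli) : (s.sendMem C t Q).log =
    Function.update (s.mem t.1.bodd).log (halfIndex t)
      (C.action t.1.bodd (halfIndex t) (s.recvMem C t), Q) := by
  rw [← Run.recvMem_log (C := C)]
  exact extend_update _ _ _ _

/-- A transmitted symbol enters the receiver's memory only when the receiver acts next, just before
transmission `t`. In `Run.Valid` this is the strict inequality in `received_eq`. -/
lemma Run.sendMem_received (Q : Pauli) (i : ℕ) : (s.sendMem C t Q).received i =
    if 2 * i + (!t.1.bodd).toNat + 1 = t then C.decrypt (s.key t) (s.rcv t)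
    else (s.mem t.1.bodd).received i := by
  have h0 : t.1 = 2 * (t.1 / 2) + t.1.bodd.toNat := by
    have := Nat.bodd_add_div2 t.1
    rw [Nat.div2_val] at this
    omega
  have h1 : t.1.bodd.toNat + (!t.1.bodd).toNat = 1 := by cases t.1.bodd <;> rfl
  change (s.recvMem C t).received i = _
  unfold Run.recvMem
  split_ifs with h2 h3 h3
  · omega
  · rw [h2]; rfl
  · have h4 : i = (⟨(t.1 - 1) / 2, by omega⟩ : Fin m).1 := by simp only; omega
    change extend none (Function.update _ _ _) i = _
    rw [extend_update, h4, Function.update_self]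
  · change extend none (Function.update _ _ _) i = _
    rw [extend_update, Function.update_of_ne]
    · rfl
    · simp only; omega

/-- Only the acting party's memory changes, in its newest entries, and only position t + 1 of the
other sequences is written. By causality of the control and of the code, earlier equations persist.
-/
lemma Run.Valid.next (h : s.Valid C P t) (l : Outcome F 𝒜 t) : (s.next C P t l).Valid C P (t + 1) := by
  classical
  have h0 : t.1 = 2 * (t.1 / 2) + t.1.bodd.toNat := by
    have := Nat.bodd_add_div2 t.1
    rw [Nat.div2_val] at this
    omega
  have h1 : t.1.bodd.toNat + (!t.1.bodd).toNat = 1 := by cases t.1.bodd <;> rfl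
  have hr : (halfIndex t).1 = t.1 / 2 := rfl
  have hp : ∀ p, p = t.1.bodd ∨ p = !t.1.bodd := by
    intro p; cases p <;> cases t.1.bodd <;> simp
  have hm1 : (s.next C P t l).mem t.1.bodd = s.sendMem C t l.1.1 := Function.update_self _ _ _
  have hm2 : (s.next C P t l).mem (!t.1.bodd) = s.mem (!t.1.bodd) :=
    Function.update_of_ne (by cases t.1.bodd <;> simp) _ _
  have hlog : ∀ i < t.1 / 2, (s.sendMem C t l.1.1).log i = (s.mem t.1.bodd).log i := by
    intro i hi
    rw [Run.sendMem_log, Function.update_of_ne (by omega)]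
  have hkey : ∀ i ≤ t.1, (s.next C P t l).key i = s.key i := fun i hi =>
    Function.update_of_ne (by omega) _ _
  have hrcv : ∀ i ≤ t.1, (s.next C P t l).rcv i = s.rcv i := fun i hi =>
    Function.update_of_ne (by omega) _ _
  have hsent : ∀ i ≤ t.1, (s.next C P t l).sent i = s.sent i := fun i hi =>
    Function.update_of_ne (by omega) _ _
  have hz : ∀ i ≤ t.1, (s.next C P t l).z i = s.z i := fun i hi =>
    Function.update_of_ne (by omega) _ _
  have hop : ∀ i ≤ t.1, (s.next C P t l).op i = s.op i := fun i hi =>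
    Function.update_of_ne (by omega) _ _
  refine ⟨fun p r hpr => ?_, fun p r hpr => ?_, fun p r hpr => ?_, fun p r hpr => ?_, ?_, ?_, ?_,
    fun i hi => ?_, ?_⟩
  · rcases hp p with rfl | rfl
    · rw [hm1]
      rcases lt_or_eq_of_le (show r ≤ t.1 / 2 by omega) with hlt | rfl
      · rw [hlog r hlt, h.log_eq _ r (by omega)]
        -- An action of an earlier turn must not see the symbol that has just been received.
        refine action_congr _ _ _ (fun i hi => (hlog i (by omega)).symm) fun i hi => ?_
        rw [Run.sendMem_received, if_neg (by omega)]
      · rw [Run.sendMem_log, hr, Function.update_self]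
        refine action_congr _ _ _ (fun i hi => ?_) fun i hi => rfl
        rw [hlog i hi, Run.recvMem_log]
    · rw [hm2]
      exact h.log_eq _ r (by omega)
  · rcases hp p with rfl | rfl
    · rw [hm1]
      rcases lt_or_eq_of_le (show r ≤ t.1 / 2 by omega) with hlt | rfl
      · rw [hsent _ (by omega), hkey _ (by omega), h.sent_eq _ r (by omega)]
        congr 1
        exact treeEncode_congr _ _ fun i hi => (hlog i (by omega)).symm
      · rw [← h0]
        simp only [Run.next, Function.update_self]
        rfl
    · rw [hm2, hsent _ (by omega), hkey _ (by omega)]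
      exact h.sent_eq _ r (by omega)
  · rcases hp p with rfl | rfl
    · rw [hm1, Run.sendMem_received]
      rw [hkey _ (by omega), hrcv _ (by omega)]
      split_ifs with h2
      · rw [h2]
      · exact h.received_eq _ r (by omega)
    · rw [Bool.not_not] at hpr ⊢
      rw [hm2, hkey _ (by omega), hrcv _ (by omega)]
      have := h.received_eq (!t.1.bodd) r
      rw [Bool.not_not] at this
      exact this (by omega)
  · rcases hp p with rfl | rfl
    · rw [hm1, Run.sendMem_received, if_neg (by omega)]
      exact h.received_none _ r (by omega)
    · rw [hm2]
      exact h.received_none _ r (by omega)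
  · rw [Finset.range_add_one, Finset.filter_insert]
    have h2 : ((Finset.range t.1).filter fun i => C.Undetected ((s.next C P t l).key (i + 1))
        ((s.next C P t l).sent (i + 1)) ((s.next C P t l).rcv (i + 1))) =
        (Finset.range t.1).filter fun i =>
          C.Undetected (s.key (i + 1)) (s.sent (i + 1)) (s.rcv (i + 1)) := by
      refine Finset.filter_congr fun i hi => ?_
      have := Finset.mem_range.1 hi
      rw [hkey _ (by omega), hsent _ (by omega), hrcv _ (by omega)]
    have h3 : (s.next C P t l).cor = s.cor +
        if C.Undetected ((s.next C P t l).key (t + 1)) ((s.next C P t l).sent (t + 1))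
          ((s.next C P t l).rcv (t + 1)) then 1 else 0 := by
      simp only [Run.next, Function.update_self]
    rw [h2, h3, h.cor_eq]
    split_ifs
    · rw [Finset.card_insert_of_notMem (by simp)]
    · rfl
  · have h2 : (s.next C P t l).X = turnUnitary P t.1.bodd (logCounter (s.mem t.1.bodd).log (t.1 / 2))
        ((s.sendMem C t l.1.1).log (t.1 / 2)) * s.X := by
      rw [Run.sendMem_log, hr, Function.update_self, ← Run.recvMem_log (C := C)]
      rfl
    rw [h2, h.X_eq]
    have hlc : logCounter (s.mem t.1.bodd).log (t.1 / 2) =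
        logCounter ((s.next C P t l).mem t.1.bodd).log (t.1 / 2) :=
      logCounter_congr fun i hi => by rw [hm1, hlog i hi]
    rw [hlc, ← hm1]
    cases hb : t.1.bodd
    · rw [hb] at hm1 hm2 hlog h0
      have e1 : (t.1 + 1).bodd = true := by simp [hb]
      have e2 : (t.1 + 1) / 2 = t.1 / 2 := by simp at h0; omega
      simp only [unitaryBefore, e1, e2, if_true, Bool.false_eq_true, if_false]
      rw [unitaryAfter_congr P (fun i hi => ?_) fun i hi => ?_]
      · rw [hm1, hlog i hi]
      · exact congrArg (fun M => Mem.log M i) hm2.symm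
    · rw [hb] at hm1 hm2 hlog h0
      have e1 : (t.1 + 1).bodd = false := by simp [hb]
      have e2 : (t.1 + 1) / 2 = t.1 / 2 + 1 := by simp at h0; omega
      simp only [unitaryBefore, e1, e2, if_true, Bool.false_eq_true, if_false, unitaryAfter]
      have e3 : ((s.next C P t l).mem false) = s.mem false := hm2
      rw [e3, unitaryAfter_congr P (fun i hi => rfl) fun i hi => ?_]
      rw [hm1, hlog i hi]
  · rw [hz 0 (by omega), h.z_zero]
  · rcases lt_or_eq_of_le (show i.1 ≤ t.1 by omega) with hlt | heq
    · obtain ⟨j, hj⟩ := h.op_eq i hlt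
      refine ⟨j, ?_⟩
      rw [hop _ (by omega), hz _ (by omega), hz _ (by omega), hsent _ (by omega), hrcv _ (by omega),
        hj]
    · obtain rfl := Fin.ext heq
      refine ⟨l.2.2, ?_⟩
      rw [hz _ le_rfl]
      simp only [Run.next, Function.update_self]
  · rw [List.range_succ, List.map_append, List.reverse_append, List.prod_append, List.map_singleton,
      List.reverse_singleton, List.prod_singleton, Matrix.mul_assoc]
    have h2 : (List.range t).map (fun i => (s.next C P t l).op (i + 1)) =
        (List.range t).map fun i => s.op (i + 1) := by
      refine List.map_congr_left fun i hi => hop _ ?_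
      have := List.mem_range.1 hi
      omega
    rw [h2, ← h.N_eq]
    simp only [Run.next, Function.update_self]

lemma Run.valid_of_mem_runs {t : ℕ} (ht : t ≤ 2 * m) {s : Run m F A B 𝒜} (hs : s ∈ runs C 𝒜 P t) :
    s.Valid C P t := by
  induction t generalizing s with
  | zero =>
    rw [runs, Multiset.mem_singleton] at hs
    rw [hs]
    exact Run.valid_start C P
  | succ t ih =>
    rw [runs, dif_pos (by omega), Multiset.mem_bind] at hs
    obtain ⟨s', hs', hs⟩ := hs
    obtain ⟨l, _, rfl⟩ := Multiset.mem_map.1 hs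
    exact Run.Valid.next (t := ⟨t, by omega⟩) (ih (by omega) hs') l

end Invariants

/-! ### Errors of a run and the progress that they allow. -/

section Progress

lemma card_add_card_le_of_even_odd {U V D : Finset ℕ} (hU : ∀ r ∈ U, 2 * r ∈ D)
    (hV : ∀ r ∈ V, 2 * r + 1 ∈ D) : U.card + V.card ≤ D.card := by
  have h1 : (U.image fun r => 2 * r).card = U.card :=
    Finset.card_image_of_injective _ fun a b h => by simpa using h
  have h2 : (V.image fun r => 2 * r + 1).card = V.card :=
    Finset.card_image_of_injective _ fun a b h => by simpa using h
  rw [← h1, ← h2, ← Finset.card_union_of_disjoint]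
  · refine Finset.card_le_card (Finset.union_subset ?_ ?_)
    · exact Finset.image_subset_iff.2 hU
    · exact Finset.image_subset_iff.2 hV
  · rw [Finset.disjoint_left]
    intro x hx hx'
    obtain ⟨a, _, rfl⟩ := Finset.mem_image.1 hx
    obtain ⟨b, _, hb⟩ := Finset.mem_image.1 hx'
    omega

variable {n m q : ℕ} {F : Type} [Field F] [DecidableEq F] [Fintype F] {C : Scheme q F}
  {A B E : Type} [Fintype A] [DecidableEq A] [Fintype B] [DecidableEq B]
  [Fintype E] [DecidableEq E] {𝒜 : Adversary m q E}
  {P : NoiselessProtocol n A B} {s : Run m F A B 𝒜}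

lemma Scheme.decrypt_encrypt (C : Scheme q F) (κ : Key F) (y : F) :
    C.decrypt κ (C.encrypt κ y) = some y := by
  simp [Scheme.decrypt, Scheme.encrypt]

lemma Run.Valid.exists_op (h : s.Valid C P (2 * m)) :
    ∃ j : ∀ i, Fin (𝒜.act i).k, ∀ i : Fin (2 * m), s.op (i + 1) =
      (𝒜.act i).K (s.z i, s.sent (i + 1)) (s.z (i + 1), s.rcv (i + 1)) (j i) :=
  ⟨fun i => (h.op_eq i i.2).choose, fun i => (h.op_eq i i.2).choose_spec⟩

lemma Run.Valid.prod_ne_zero (h : s.Valid C P (2 * m)) (hN : s.N ≠ 0) :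
    ((List.range (2 * m)).map fun i => s.op (i + 1)).reverse.prod ≠ 0 := by
  intro h0
  exact hN (by rw [h.N_eq, h0, Matrix.zero_mul])

/-- `N` contains the product of the adversary's Kraus operators. If it does not vanish, neither does
the product, and the classical record of the run is subject to the bound on corruptions. -/
lemma Run.Valid.possible (h : s.Valid C P (2 * m)) (hN : s.N ≠ 0) :
    𝒜.Possible fun i => s.z i := by
  obtain ⟨j, hj⟩ := h.exists_op
  refine ⟨h.z_zero, fun i => s.sent (i + 1), fun i => s.rcv (i + 1), j, ?_⟩
  have := h.prod_ne_zero hN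
  rw [← List.map_coe_finRange_eq_range, List.map_map, ← List.ofFn_eq_map] at this
  convert this using 5 with i
  exact (hj i).symm

lemma Run.Valid.mem_corrupted (h : s.Valid C P (2 * m)) (hN : s.N ≠ 0) (i : Fin (2 * m))
    (hi : s.sent (i + 1) ≠ s.rcv (i + 1)) : i ∈ 𝒜.corrupted fun i => s.z i := by
  obtain ⟨j, hj⟩ := h.exists_op
  refine ⟨_, _, j i, hi, fun h0 => h.prod_ne_zero hN (List.prod_eq_zero ?_)⟩
  rw [List.mem_reverse, List.mem_map]
  exact ⟨i, List.mem_range.2 i.2, (hj i).trans h0⟩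

/-- The transmissions that were changed. -/
def Run.errors (s : Run m F A B 𝒜) : Finset ℕ :=
  (Finset.range (2 * m)).filter fun i => s.sent (i + 1) ≠ s.rcv (i + 1)

lemma Run.Valid.card_errors_le (h : s.Valid C P (2 * m)) (hN : s.N ≠ 0) {δ : ℝ}
    (hδ : 𝒜.InClass δ) : (s.errors.card : ℝ) ≤ δ * ((2 * m : ℕ) : ℝ) := by
  refine le_trans ?_ (hδ _ (h.possible hN))
  have h1 : s.errors = (Finset.univ.filter fun i : Fin (2 * m) =>
      s.sent (i + 1) ≠ s.rcv (i + 1)).map Fin.valEmbedding := by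
    ext i
    simp only [Run.errors, Finset.mem_filter, Finset.mem_range, Finset.mem_map, Finset.mem_univ,
      true_and, Fin.valEmbedding_apply]
    constructor
    · rintro ⟨h1, h2⟩
      exact ⟨⟨i, h1⟩, h2, rfl⟩
    · rintro ⟨i, h1, rfl⟩
      exact ⟨i.2, h1⟩
  rw [h1, Finset.card_map, ← Set.ncard_coe_finset]
  refine Nat.cast_le.2 (Set.ncard_le_ncard (fun i hi => h.mem_corrupted hN i ?_) (Set.toFinite _))
  exact (Finset.mem_filter.1 (Finset.mem_coe.1 hi)).2

/-- An unchanged symbol always passes the test and decrypts correctly. -/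
lemma Run.Valid.sent_ne_rcv (h : s.Valid C P (2 * m)) {p : Bool} {r : ℕ}
    (hr : 2 * r + (!p).toNat + 1 < 2 * m)
    (hne : (s.mem p).received r ≠ some (C.codeword r (s.mem !p))) :
    s.sent (2 * r + (!p).toNat + 1) ≠ s.rcv (2 * r + (!p).toNat + 1) := by
  intro heq
  rw [h.received_eq p r hr, ← heq, h.sent_eq (!p) r (by omega), Scheme.decrypt_encrypt] at hne
  exact hne rfl

open Classical in
lemma Run.Valid.count_none_le (h : s.Valid C P (2 * m)) (hm : 1 ≤ m) :
    count m (fun i => (s.mem true).received i = none) +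
      count m (fun i => (s.mem false).received i = none) ≤ s.errors.card + 1 := by
  have e : ∀ p, count m (fun i => (s.mem p).received i = none) =
      ((Finset.range m).filter fun i => (s.mem p).received i = none).card := by
    intro p
    unfold count
    congr
  -- Alice never reads Bob's last symbol, so entry m - 1 of her memory is empty without any
  -- corruption. It accounts for the summand 1.
  have h1 := Finset.pred_card_le_card_erase
    (s := (Finset.range m).filter fun i => (s.mem false).received i = none) (a := m - 1)
  have h2 := card_add_card_le_of_even_odd (D := s.errors)
    (U := (Finset.range m).filter fun i => (s.mem true).received i = none)
    (V := ((Finset.range m).filter fun i => (s.mem false).received i = none).erase (m - 1))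
    (fun r hr => ?_) (fun r hr => ?_)
  · rw [e, e]
    omega
  · obtain ⟨hr, h3⟩ := Finset.mem_filter.1 hr
    have := Finset.mem_range.1 hr
    refine Finset.mem_filter.2 ⟨Finset.mem_range.2 (by omega), ?_⟩
    exact h.sent_ne_rcv (p := true) (r := r) (by simp; omega) (by rw [h3]; simp)
  · obtain ⟨hne, hr⟩ := Finset.mem_erase.1 hr
    obtain ⟨hr, h3⟩ := Finset.mem_filter.1 hr
    have := Finset.mem_range.1 hr
    refine Finset.mem_filter.2 ⟨Finset.mem_range.2 (by omega), ?_⟩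
    exact h.sent_ne_rcv (p := false) (r := r) (by simp; omega) (by rw [h3]; simp)

/-- A wrong symbol that is not an erasure must have passed the test, so it is one of the undetected
corruptions counted by `cor`. -/
lemma Run.Valid.card_mismatches_le (h : s.Valid C P (2 * m)) :
    (mismatches C.gen C.label (Finset.range m) (s.mem true).received (s.mem false).log).card +
      (mismatches C.gen C.label (Finset.range m) (s.mem false).received (s.mem true).log).card ≤
      s.cor := by
  classical
  rw [h.cor_eq]
  have key : ∀ p r, r < m → (s.mem p).received r ≠ none →
      (s.mem p).received r ≠ some (treeEncode C.gen C.label (s.mem !p).log r) →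
      2 * r + (!p).toNat + 1 < 2 * m ∧ C.Undetected (s.key (2 * r + (!p).toNat + 1))
        (s.sent (2 * r + (!p).toNat + 1)) (s.rcv (2 * r + (!p).toNat + 1)) := by
    intro p r hr h1 h2
    have h3 : 2 * r + (!p).toNat + 1 < 2 * m := by
      by_contra h3
      exact h1 (h.received_none p r (by omega))
    exact ⟨h3, h.sent_ne_rcv h3 h2, by rwa [← h.received_eq p r h3]⟩
  refine card_add_card_le_of_even_odd (fun r hr => ?_) (fun r hr => ?_)
  · obtain ⟨hr, h1, h2⟩ := Finset.mem_filter.1 hr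
    obtain ⟨h3, h4⟩ := key true r (Finset.mem_range.1 hr) h1 h2
    exact Finset.mem_filter.2 ⟨Finset.mem_range.2 (Nat.lt_of_succ_lt h3), h4⟩
  · obtain ⟨hr, h1, h2⟩ := Finset.mem_filter.1 hr
    obtain ⟨h3, h4⟩ := key false r (Finset.mem_range.1 hr) h1 h2
    exact Finset.mem_filter.2 ⟨Finset.mem_range.2 (Nat.lt_of_succ_lt h3), h4⟩

/-- A run with few undetected corruptions makes enough progress. -/
theorem Run.Valid.potential_ge (h : s.Valid C P (2 * m)) (hN : s.N ≠ 0) (hm : 1 ≤ m) {a k : ℕ}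
    {ε : ℝ} (hC : IsTreeCode a m C.gen C.label) (h𝒜 : 𝒜.InClass (1 / 2 - ε)) (ha : 0 < a)
    (hεa : 16 ≤ ε * a) (hεm : 2 * n + 6 ≤ ε * m) (hk : 16 * k ≤ ε * m) (hcor : s.cor ≤ k) :
    2 * (n : ℤ) + 4 ≤ potential (wordAfter (s.mem false).log (s.mem true).log m).1 := by
  have h1 := potential_wordAfter_ge (u := (s.mem true).received) (v := (s.mem false).received) hC hm
    (fun r hr => h.log_eq false r (by simp; omega)) (fun r hr => h.log_eq true r (by simp; omega))
  have h2 := h.card_errors_le hN h𝒜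
  have h3 := h.count_none_le hm
  have h4 := h.card_mismatches_le
  generalize potential (wordAfter (s.mem false).log (s.mem true).log m).1 = π at h1 ⊢
  generalize count m (fun i => (s.mem true).received i = none) = x at h1 h3
  generalize count m (fun i => (s.mem false).received i = none) = y at h1 h3
  generalize (mismatches C.gen C.label (Finset.range m) (s.mem true).received
    (s.mem false).log).card = x' at h1 h4
  generalize (mismatches C.gen C.label (Finset.range m) (s.mem false).received
    (s.mem true).log).card = y' at h1 h4
  have h1' : (a : ℝ) * (m - 1 - x - y) - 8 * (m + a * (x' + y')) ≤ a * π := by exact_mod_cast h1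
  have h3' : (x : ℝ) + y ≤ s.errors.card + 1 := by exact_mod_cast h3
  have h4' : (x' : ℝ) + y' ≤ k := by exact_mod_cast h4.trans hcor
  have ha' : (0 : ℝ) < a := by exact_mod_cast ha
  push_cast at h2
  -- Erasures leave 2εm - 2 units. The tree code and the undetected corruptions take at most εm / 2
  -- each, and εm - 2 is at least 2n + 4.
  have h5 : (a : ℝ) * (2 * n + 4) ≤ a * π := by
    have e1 : (a : ℝ) * (x + y) ≤ a * ((1 / 2 - ε) * (2 * m) + 1) :=
      mul_le_mul_of_nonneg_left (by linarith) ha'.le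
    have e2 : (a : ℝ) * (x' + y') ≤ a * k := mul_le_mul_of_nonneg_left h4' ha'.le
    have e3 : 16 * (a : ℝ) * k ≤ a * (ε * m) := by nlinarith
    have e4 : (16 : ℝ) * m ≤ a * (ε * m) := by
      have : (0 : ℝ) ≤ m := by positivity
      nlinarith
    have e5 : (a : ℝ) * (2 * n + 6) ≤ a * (ε * m) := mul_le_mul_of_nonneg_left hεm ha'.le
    linarith
  have h6 : (2 * n + 4 : ℝ) ≤ π := le_of_mul_le_mul_left h5 ha'
  exact_mod_cast h6

end Progress

/-! ### Unnormalised probabilities of branches. -/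

section Weight

variable {I J K E : Type} [Fintype I] [DecidableEq I] [Fintype J] [Fintype K] [Fintype E]
  [DecidableEq E]

/-- The squared norm of `1 ⊗ N` in a state. -/
def weight (ρ : Matrix (I × E) (I × E) ℂ) (N : Matrix J E ℂ) : ℝ :=
  (((1 : Matrix I I ℂ) ⊗ₖ (Nᴴ * N)) * ρ).trace.re

/-- An isometry on the first factor drops out of the trace. The probability of a run therefore
depends on the adversary's operator only, not on the simulated operations. -/
lemma trace_kronecker_mul_mul_conjTranspose (ρ : Matrix (I × E) (I × E) ℂ) (N : Matrix J E ℂ)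
    {W : Matrix K I ℂ} (hW : Wᴴ * W = 1) (w : ℂ) :
    ((w • (W ⊗ₖ N)) * ρ * (w • (W ⊗ₖ N))ᴴ).trace.re = ‖w‖ ^ 2 * weight ρ N := by
  rw [Matrix.trace_mul_cycle, Matrix.conjTranspose_smul, Matrix.conjTranspose_kronecker,
    Matrix.smul_mul, Matrix.mul_smul, ← Matrix.mul_kronecker_mul, hW, smul_smul, Matrix.smul_mul,
    Matrix.trace_smul, weight, smul_eq_mul, mul_comm (star w), RCLike.star_def, Complex.mul_conj,
    Complex.normSq_eq_norm_sq, Complex.re_ofReal_mul]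

lemma weight_nonneg {ρ : Matrix (I × E) (I × E) ℂ} (hρ : ρ.PosSemidef) (N : Matrix J E ℂ) :
    0 ≤ weight ρ N := by
  have h := trace_kronecker_mul_mul_conjTranspose ρ N (W := (1 : Matrix I I ℂ)) (by simp) 1
  rw [norm_one, one_pow, one_mul] at h
  rw [← h]
  exact (Complex.le_def.1 (hρ.mul_mul_conjTranspose_same _).trace_nonneg).1

lemma weight_zero (ρ : Matrix (I × E) (I × E) ℂ) : weight ρ (0 : Matrix J E ℂ) = 0 := by
  simp [weight]

lemma sum_conjTranspose_mul_mul {Λ : Type} (S : Finset Λ) (M : Λ → Matrix K J ℂ) [DecidableEq J]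
    (h : ∑ l ∈ S, (M l)ᴴ * M l = 1) (N : Matrix J E ℂ) :
    ∑ l ∈ S, (M l * N)ᴴ * (M l * N) = Nᴴ * N := by
  have h1 : ∀ l, (M l * N)ᴴ * (M l * N) = Nᴴ * (((M l)ᴴ * M l) * N) := by
    intro l
    rw [Matrix.conjTranspose_mul]
    simp only [Matrix.mul_assoc]
  simp only [h1]
  rw [← Matrix.mul_sum, ← Matrix.sum_mul, h, Matrix.one_mul]

/-- A complete family of Kraus operators preserves the weight. -/
lemma sum_weight_mul {Λ : Type} (S : Finset Λ) (M : Λ → Matrix K J ℂ) [DecidableEq J]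
    (h : ∑ l ∈ S, (M l)ᴴ * M l = 1) (ρ : Matrix (I × E) (I × E) ℂ) (N : Matrix J E ℂ) :
    ∑ l ∈ S, weight ρ (M l * N) = weight ρ N := by
  have h1 := sum_conjTranspose_mul_mul S M h N
  have h3 : ∀ T : Finset Λ, ∑ l ∈ T, weight ρ (M l * N) =
      (((1 : Matrix I I ℂ) ⊗ₖ (∑ l ∈ T, (M l * N)ᴴ * (M l * N))) * ρ).trace.re := by
    intro T
    classical
    induction T using Finset.induction_on with
    | empty => simp
    | insert l T hl ih =>
      rw [Finset.sum_insert hl, Finset.sum_insert hl, ih, Matrix.kronecker_add, Matrix.add_mul,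
        Matrix.trace_add, Complex.add_re, weight]
  rw [h3, h1, weight]

end Weight

/-! ### The exponential moment of the number of undetected corruptions. -/

section Chernoff

variable {n m q : ℕ} {F : Type} [Field F] [DecidableEq F] [Fintype F] (C : Scheme q F)
  {A B E : Type} [Fintype A] [DecidableEq A] [Fintype B] [DecidableEq B]
  [Fintype E] [DecidableEq E] {𝒜 : Adversary m q E}
  (P : NoiselessProtocol n A B)

/-- The equation between the authentication key and an undetected error. -/
lemma Scheme.undetected_encrypt_iff (T p₁ p₂ y : F) (c' : Fin q) :
    C.Undetected (T, p₁, p₂) (C.encrypt (T, p₁, p₂) y) c' ↔ C.encrypt (T, p₁, p₂) y ≠ c' ∧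
      T * ((C.sym.symm c').1 - (C.sym.symm (C.encrypt (T, p₁, p₂) y)).1) =
        (C.sym.symm c').2 - (C.sym.symm (C.encrypt (T, p₁, p₂) y)).2 := by
  refine and_congr Iff.rfl ?_
  simp only [Scheme.decrypt, Scheme.encrypt, Equiv.symm_apply_apply, ne_eq, ite_eq_right_iff,
    reduceCtorEq, imp_false, not_not]
  constructor
  · intro h
    linear_combination h
  · intro h
    linear_combination h

open Classical in
-- The condition is linear in `T`. If its coefficient vanishes, the right side must vanish too and
-- the two symbols coincide; otherwise the solution is unique.
lemma Scheme.card_undetected_le (c c' : Fin q) : ((Finset.univ : Finset F).filter fun T =>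
    c ≠ c' ∧ T * ((C.sym.symm c').1 - (C.sym.symm c).1) =
      (C.sym.symm c').2 - (C.sym.symm c).2).card ≤ 1 := by
  refine Finset.card_le_one.2 fun T hT T' hT' => ?_
  obtain ⟨_, hne, h⟩ := Finset.mem_filter.1 hT
  obtain ⟨_, _, h'⟩ := Finset.mem_filter.1 hT'
  by_cases h0 : (C.sym.symm c').1 - (C.sym.symm c).1 = 0
  · rw [h0, mul_zero] at h
    exact absurd (C.sym.symm.injective (Prod.ext (sub_eq_zero.1 h0) (sub_eq_zero.1 h.symm))).symm hne
  · exact mul_right_cancel₀ h0 (h.trans h'.symm)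

/-- For fixed `T` and `y` the pads run through every symbol exactly once: the symbol in transit
reveals nothing about `T`. -/
lemma Scheme.sum_encrypt (T y : F) (g : Fin q → ℝ) :
    ∑ p : F × F, g (C.encrypt (T, p) y) = ∑ c, g c := by
  let e : F × F ≃ Fin q :=
    ((Equiv.addLeft y).prodCongr (Equiv.addLeft (T * y))).trans C.sym
  exact e.sum_comp g

/-- Averaged over the key, an adversary rarely changes a symbol without being detected. -/
lemma Scheme.sum_key_le (y : F) (g : Fin q → Fin q → ℝ) (hg : ∀ c c', 0 ≤ g c c')
    (h : Key F → Fin q → ℝ) (hh : ∀ κ c', h κ c' ≤ Fintype.card F)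
    (hh' : ∀ κ c', ¬ C.Undetected κ (C.encrypt κ y) c' → h κ c' = 1) {γ : ℝ}
    (hγ : ∀ c, ∑ c', g c c' = γ) :
    ∑ κ : Key F, ∑ c', g (C.encrypt κ y) c' * h κ c' ≤ 2 * (Fintype.card F : ℝ) ^ 3 * γ := by
  classical
  have hL : (1 : ℝ) ≤ Fintype.card F := by exact_mod_cast Fintype.card_pos
  let U : F → Fin q → Fin q → Prop := fun T c c' => c ≠ c' ∧
    T * ((C.sym.symm c').1 - (C.sym.symm c).1) = (C.sym.symm c').2 - (C.sym.symm c).2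
  have h1 : ∀ κ : Key F, ∀ c', h κ c' ≤
      1 + (Fintype.card F : ℝ) * if U κ.1 (C.encrypt κ y) c' then 1 else 0 := by
    rintro ⟨T, p₁, p₂⟩ c'
    split_ifs with hU
    · linarith [hh (T, p₁, p₂) c']
    · rw [hh' _ _ fun h2 => hU ((C.undetected_encrypt_iff T p₁ p₂ y c').1 h2)]
      simp
  calc ∑ κ : Key F, ∑ c', g (C.encrypt κ y) c' * h κ c'
      ≤ ∑ κ : Key F, ∑ c', g (C.encrypt κ y) c' *
        (1 + (Fintype.card F : ℝ) * if U κ.1 (C.encrypt κ y) c' then 1 else 0) := by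
        gcongr with κ _ c' _
        · exact hg _ _
        · exact h1 κ c'
    _ = ∑ T : F, ∑ c, ∑ c', g c c' * (1 + (Fintype.card F : ℝ) * if U T c c' then 1 else 0) := by
        rw [Fintype.sum_prod_type]
        refine Finset.sum_congr rfl fun T _ => ?_
        exact C.sum_encrypt T y fun c =>
          ∑ c', g c c' * (1 + (Fintype.card F : ℝ) * if U T c c' then 1 else 0)
    -- The adversary's weights depend only on the two symbols, so the sum over `T` can be taken
    -- last; it is at most |F| + |F|.
    _ = ∑ c, ∑ c', g c c' *
        ∑ T : F, (1 + (Fintype.card F : ℝ) * if U T c c' then 1 else 0) := by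
        rw [Finset.sum_comm]
        refine Finset.sum_congr rfl fun c _ => ?_
        rw [Finset.sum_comm]
        exact Finset.sum_congr rfl fun c' _ => (Finset.mul_sum _ _ _).symm
    _ ≤ ∑ c, ∑ c', g c c' * (2 * Fintype.card F) := by
        gcongr with c _ c' _
        · exact hg _ _
        · rw [Finset.sum_add_distrib, Finset.sum_const, Finset.card_univ, nsmul_eq_mul, mul_one,
            ← Finset.mul_sum, Finset.sum_boole]
          have : (((Finset.univ : Finset F).filter fun T => U T c c').card : ℝ) ≤ 1 := by
            exact_mod_cast C.card_undetected_le c c'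
          nlinarith
    _ = 2 * (Fintype.card F : ℝ) ^ 3 * γ := by
        simp only [← Finset.sum_mul, hγ, Finset.sum_const, Finset.card_univ, nsmul_eq_mul]
        rw [← Fintype.card_congr C.sym, Fintype.card_prod]
        push_cast
        ring

variable (ρ : Matrix ((A × B × Qubit) × E) ((A × B × Qubit) × E) ℂ)

open Classical in
-- Each undetected corruption is charged a factor |F|, which its rarity over the |F|³ keys
-- compensates up to a factor 2. The four Bell outcomes supply the remaining 4.
lemma sum_weight_next_le (hρ : ρ.PosSemidef) (t : Fin (2 * m)) (s : Run m F A B 𝒜) :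
    ∑ l, weight ρ (s.next C P t l).N * (Fintype.card F : ℝ) ^ (s.next C P t l).cor ≤
      8 * (Fintype.card F : ℝ) ^ 3 * (weight ρ s.N * (Fintype.card F : ℝ) ^ s.cor) := by
  have hL : (1 : ℝ) ≤ Fintype.card F := by exact_mod_cast Fintype.card_pos
  have hQ : ∀ Q : Pauli, ∑ κ : Key F, ∑ x : (𝒜.Z × Fin q) × Fin (𝒜.act t).k,
      weight ρ (s.next C P t ((Q, κ), x)).N * (Fintype.card F : ℝ) ^ (s.next C P t ((Q, κ), x)).cor ≤
        2 * (Fintype.card F : ℝ) ^ 3 * (weight ρ s.N * (Fintype.card F : ℝ) ^ s.cor) := by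
    intro Q
    -- The adversary acts on the symbol alone, so her weight is a function of the symbols before and
    -- after, with the same total for every symbol sent.
    let g : Fin q → Fin q → ℝ := fun c c' =>
      (∑ z', ∑ j, weight ρ ((𝒜.act t).K (s.z t, c) (z', c') j * s.N)) * (Fintype.card F : ℝ) ^ s.cor
    let y := C.codeword (halfIndex t) (s.sendMem C t Q)
    have hg : ∀ c, ∑ c', g c c' = weight ρ s.N * (Fintype.card F : ℝ) ^ s.cor := by
      intro c
      simp only [g]
      rw [← Finset.sum_mul]
      congr 1
      have h1 := sum_weight_mul (Finset.univ : Finset ((𝒜.Z × Fin q) × Fin (𝒜.act t).k))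
        (fun x => (𝒜.act t).K (s.z t, c) x.1 x.2)
        (by rw [Fintype.sum_prod_type]; exact (𝒜.act t).trace_preserving (s.z t, c)) ρ s.N
      rw [← h1, Fintype.sum_prod_type, Fintype.sum_prod_type, Finset.sum_comm]
    have h2 := C.sum_key_le y g (fun c c' => mul_nonneg (Finset.sum_nonneg fun z' _ =>
        Finset.sum_nonneg fun j _ => weight_nonneg hρ _) (by positivity))
      (fun κ c' => (Fintype.card F : ℝ) ^ if C.Undetected κ (C.encrypt κ y) c' then 1 else 0)
      (fun κ c' => by
        split_ifs
        · rw [pow_one]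
        · rw [pow_zero]; exact hL)
      (fun κ c' h => by rw [if_neg h, pow_zero]) hg
    refine le_of_eq_of_le (Finset.sum_congr rfl fun κ _ => ?_) h2
    rw [Fintype.sum_prod_type, Fintype.sum_prod_type, Finset.sum_comm]
    refine Finset.sum_congr rfl fun c' _ => ?_
    simp only [g, Finset.sum_mul]
    refine Finset.sum_congr rfl fun z' _ => Finset.sum_congr rfl fun j _ => ?_
    simp only [Run.next, Run.symbol, pow_add, y]
    rw [← mul_assoc]
    congr
  rw [Fintype.sum_prod_type, Fintype.sum_prod_type]
  refine (Finset.sum_le_sum fun Q _ => hQ Q).trans_eq ?_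
  rw [Finset.sum_const, Finset.card_univ, nsmul_eq_mul]
  simp only [Fintype.card_prod, Fintype.card_fin]
  push_cast
  ring

lemma conjTranspose_mul_start :
    ((Run.start C A B 𝒜).N)ᴴ * (Run.start C A B 𝒜).N = 1 := by
  ext e e'
  rw [Matrix.mul_apply, Fintype.sum_prod_type]
  simp only [Run.start, Matrix.conjTranspose_apply, Matrix.of_apply, apply_ite star, star_one,
    star_zero, Matrix.one_apply]
  rw [Finset.sum_eq_single e (fun b _ hb => by simp [hb]) (by simp),
    Finset.sum_eq_single 𝒜.f0 (fun b _ hb => by simp [hb]) (by simp)]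
  simp

lemma weight_start {ρ : Matrix ((A × B × Qubit) × E) ((A × B × Qubit) × E) ℂ} (hρ : IsDensity ρ) :
    weight ρ (Run.start C A B 𝒜).N = 1 := by
  rw [weight, conjTranspose_mul_start, Matrix.one_kronecker_one, Matrix.one_mul, hρ.2,
    Complex.one_re]

/-- The exponential moment of the number of undetected corruptions. -/
lemma sum_weight_runs_le {ρ : Matrix ((A × B × Qubit) × E) ((A × B × Qubit) × E) ℂ}
    (hρ : IsDensity ρ) {t : ℕ} (ht : t ≤ 2 * m) :
    ((runs C 𝒜 P t).map fun s => weight ρ s.N * (Fintype.card F : ℝ) ^ s.cor).sum ≤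
      (8 * (Fintype.card F : ℝ) ^ 3) ^ t := by
  induction t with
  | zero =>
    rw [runs, Multiset.map_singleton, Multiset.sum_singleton, weight_start C hρ]
    simp [Run.start]
  | succ t ih =>
    rw [sum_runs_succ C P (show t < 2 * m by omega), pow_succ']
    refine (Multiset.sum_map_le_sum_map _ _ fun s _ => sum_weight_next_le C P ρ hρ.1 _ s).trans ?_
    rw [Multiset.sum_map_mul_left]
    exact mul_le_mul_of_nonneg_left (ih (by omega)) (by positivity)

end Chernoff

/-! ### Kraus operators from partial traces. -/

section Slices

variable {G O L I J E : Type} [Fintype G] [Fintype O] [Fintype L] [Fintype I] [Fintype J]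
  [Fintype E] [DecidableEq I] [DecidableEq E]

lemma trace_krausMap_slices (e : G × O ≃ L) (V : Matrix L I ℂ) (ρ : Matrix I I ℂ) :
    (krausMap ((Finset.univ : Finset G).val.map fun g => V.submatrix (fun p => e (g, p)) id)
      ρ).trace = (V * ρ * Vᴴ).trace := by
  rw [trace_krausMap, Multiset.map_map, Matrix.trace, ← e.sum_comp, Fintype.sum_prod_type]
  rfl

/-- The Kraus operators of `1 ⊗ N` after `U`, for each basis state of the traced register. -/
def slice (w : ℂ) (U : Matrix O I ℂ) (N : Matrix J E ℂ) (g : J) : Matrix O (I × E) ℂ :=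
  (w • (U ⊗ₖ N)).submatrix (fun p => (p, g)) id

lemma slice_apply (w : ℂ) (U : Matrix O I ℂ) (N : Matrix J E ℂ) (g : J) (p : O) (i : I × E) :
    slice w U N g p i = w * (U p i.1 * N g i.2) := rfl

/-- After the trace over the adversary's registers, `N` enters only through `Nᴴ * N`. Sums over runs
thus reduce to sums of these products. -/
lemma krausMap_slice_apply [DecidableEq O] (w : ℂ) (U : Matrix O I ℂ) (N : Matrix J E ℂ)
    (ρ : Matrix (I × E) (I × E) ℂ) (p p' : O) :
    krausMap ((Finset.univ : Finset J).val.map (slice w U N)) ρ p p' =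
      w * star w * ∑ e, ∑ e', (Nᴴ * N) e' e *
        ((U ⊗ₖ (1 : Matrix E E ℂ)) * ρ * (U ⊗ₖ (1 : Matrix E E ℂ))ᴴ) (p, e) (p', e') := by
  set τ := (U ⊗ₖ (1 : Matrix E E ℂ)) * ρ * (U ⊗ₖ (1 : Matrix E E ℂ))ᴴ with hτ
  have h1 : (w • (U ⊗ₖ N)) * ρ * (w • (U ⊗ₖ N))ᴴ =
      (w * star w) • (((1 : Matrix O O ℂ) ⊗ₖ N) * τ * ((1 : Matrix O O ℂ) ⊗ₖ N)ᴴ) := by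
    have h2 : U ⊗ₖ N = ((1 : Matrix O O ℂ) ⊗ₖ N) * (U ⊗ₖ (1 : Matrix E E ℂ)) := by
      rw [← Matrix.mul_kronecker_mul, Matrix.one_mul, Matrix.mul_one]
    rw [hτ, h2, Matrix.conjTranspose_smul, Matrix.smul_mul, Matrix.mul_smul, Matrix.smul_mul,
      smul_smul, mul_comm (star w), Matrix.conjTranspose_mul]
    simp only [Matrix.mul_assoc]
  rw [krausMap_apply, Multiset.map_map]
  change ∑ g : J, ((w • (U ⊗ₖ N)) * ρ * (w • (U ⊗ₖ N))ᴴ) (p, g) (p', g) = _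
  rw [h1]
  simp only [Matrix.smul_apply, smul_eq_mul]
  rw [← Finset.mul_sum]
  congr 1
  have h3 : ∀ g : J, (((1 : Matrix O O ℂ) ⊗ₖ N) * τ * ((1 : Matrix O O ℂ) ⊗ₖ N)ᴴ) (p, g) (p', g) =
      ∑ e, ∑ e', N g e * star (N g e') * τ (p, e) (p', e') := by
    intro g
    rw [mul_mul_conjTranspose_apply, Fintype.sum_prod_type, Finset.sum_eq_single p
      (fun x _ hx => by simp [Matrix.kroneckerMap_apply, Matrix.one_apply, Ne.symm hx]) (by simp)]
    refine Finset.sum_congr rfl fun e _ => ?_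
    rw [Fintype.sum_prod_type, Finset.sum_eq_single p'
      (fun x _ hx => by simp [Matrix.kroneckerMap_apply, Ne.symm hx]) (by simp)]
    refine Finset.sum_congr rfl fun e' _ => ?_
    simp only [Matrix.kroneckerMap_apply, Matrix.one_apply_eq, one_mul]
    ring
  simp only [h3]
  rw [Finset.sum_comm]
  refine Finset.sum_congr rfl fun e _ => ?_
  rw [Finset.sum_comm]
  refine Finset.sum_congr rfl fun e' _ => ?_
  rw [Matrix.mul_apply, Finset.sum_mul]
  refine Finset.sum_congr rfl fun g _ => ?_
  rw [Matrix.conjTranspose_apply, mul_comm (star _)]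

end Slices

/-! ### Comparison of the runs with the ideal channel. -/

section Distance

variable {n m q : ℕ} {F : Type} [Field F] [DecidableEq F] [Fintype F] {C : Scheme q F}
  {A B E : Type} [Fintype A] [DecidableEq A] [Fintype B] [DecidableEq B]
  [Fintype E] [DecidableEq E] {𝒜 : Adversary m q E}
  {P : NoiselessProtocol n A B} {ρ : Matrix ((A × B × Qubit) × E) ((A × B × Qubit) × E) ℂ}

variable (P) in
/-- The Kraus operators that a run contributes to the ideal channel. -/
def Run.ideal (s : Run m F A B 𝒜) : Multiset (Matrix (A × B × Qubit) ((A × B × Qubit) × E) ℂ) :=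
  (Finset.univ : Finset (E × 𝒜.F)).val.map (slice (amplitude m F (2 * m)) P.unitary s.N)

/-- The first factor is the inverse dimension of a party's shares; each teleportation contributes
another factor 1/2. -/
lemma amplitude_mul_star (t : ℕ) : amplitude m F t * star (amplitude m F t) =
    ((2 * (Fintype.card F : ℂ) ^ 3) ^ (2 * m))⁻¹ * ((2 : ℂ) ^ t)⁻¹ := by
  have h1 : star (amplitude m F t) = amplitude m F t := by
    simp only [amplitude, star_mul', star_inv₀, star_pow, RCLike.star_def, Complex.conj_ofReal]
  rw [h1, amplitude, mul_mul_mul_comm, ← mul_inv, ← mul_pow, ← mul_inv, ← Complex.ofReal_mul,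
    ← Complex.ofReal_mul, Real.mul_self_sqrt (by positivity), Real.mul_self_sqrt (by positivity),
    inv_pow]
  simp only [Fintype.card_fun, Fintype.card_prod, Fintype.card_fin]
  push_cast
  ring_nf

lemma norm_amplitude_sq : ‖amplitude m F (2 * m)‖ ^ 2 =
    ((4 * (Fintype.card F : ℝ) ^ 3) ^ (2 * m))⁻¹ := by
  have h := amplitude_mul_star (m := m) (F := F) (2 * m)
  rw [RCLike.star_def, Complex.mul_conj, Complex.normSq_eq_norm_sq] at h
  have h2 : ((‖amplitude m F (2 * m)‖ ^ 2 : ℝ) : ℂ) =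
      ((((2 * (Fintype.card F : ℝ) ^ 3) ^ (2 * m))⁻¹ * ((2 : ℝ) ^ (2 * m))⁻¹ : ℝ) : ℂ) := by
    rw [h]; push_cast; rfl
  rw [Complex.ofReal_injective h2, ← mul_inv, ← mul_pow]
  congr 2
  ring

variable (C P) in
-- For each of the 4 |F|³ outcomes of the sender, the adversary's instrument preserves the sum. The
-- squared amplitude after 2m transmissions is exactly the inverse of this constant.
lemma sum_conjTranspose_mul_runs {t : ℕ} (ht : t ≤ 2 * m) :
    ((runs C 𝒜 P t).map fun s => s.Nᴴ * s.N).sum =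
      (4 * (Fintype.card F : ℂ) ^ 3) ^ t • (1 : Matrix E E ℂ) := by
  induction t with
  | zero =>
    rw [runs, Multiset.map_singleton, Multiset.sum_singleton, conjTranspose_mul_start, pow_zero,
      one_smul]
  | succ t ih =>
    have h : t < 2 * m := by omega
    have h1 : ∀ s : Run m F A B 𝒜, ∑ l, ((s.next C P ⟨t, h⟩ l).N)ᴴ * (s.next C P ⟨t, h⟩ l).N =
        (4 * (Fintype.card F : ℂ) ^ 3) • (s.Nᴴ * s.N) := by
      intro s
      rw [Fintype.sum_prod_type]
      have h2 : ∀ l : Pauli × Key F, ∑ x : (𝒜.Z × Fin q) × Fin (𝒜.act ⟨t, h⟩).k,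
          ((s.next C P ⟨t, h⟩ (l, x)).N)ᴴ * (s.next C P ⟨t, h⟩ (l, x)).N = s.Nᴴ * s.N := by
        intro l
        refine sum_conjTranspose_mul_mul _ (fun x : (𝒜.Z × Fin q) × Fin (𝒜.act ⟨t, h⟩).k =>
          (𝒜.act ⟨t, h⟩).K (s.z t, s.symbol C ⟨t, h⟩ l) x.1 x.2) ?_ s.N
        rw [Fintype.sum_prod_type]
        exact (𝒜.act ⟨t, h⟩).trace_preserving _
      simp only [h2]
      rw [Finset.sum_const, Finset.card_univ, ← Nat.cast_smul_eq_nsmul ℂ]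
      congr 1
      simp only [Fintype.card_prod, Fintype.card_fin]
      push_cast
      ring
    rw [sum_runs_succ C P h]
    simp only [h1]
    rw [pow_succ' (4 * (Fintype.card F : ℂ) ^ 3), mul_smul, ← ih (by omega), Multiset.smul_sum,
      Multiset.map_map]
    rfl

variable (C) in
/-- The ideal contributions of all runs add up to the channel induced by the protocol. -/
lemma krausMap_bind_ideal (ρ : Matrix ((A × B × Qubit) × E) ((A × B × Qubit) × E) ℂ) :
    krausMap ((runs C 𝒜 P (2 * m)).bind (Run.ideal P)) ρ = P.channel E ρ := by
  set τ := (P.unitary ⊗ₖ (1 : Matrix E E ℂ)) * ρ * (P.unitary ⊗ₖ (1 : Matrix E E ℂ))ᴴ with hτ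
  ext p p'
  let f : Matrix E E ℂ →+ ℂ :=
    { toFun := fun M => ∑ e, ∑ e', M e' e * τ (p, e) (p', e')
      map_zero' := by simp
      map_add' := by
        intro M M'
        simp only [Matrix.add_apply, add_mul, Finset.sum_add_distrib] }
  let g : Matrix (A × B × Qubit) (A × B × Qubit) ℂ →+ ℂ := Matrix.entryAddMonoidHom ℂ p p'
  have h1 : ∀ s : Run m F A B 𝒜, g (krausMap (s.ideal P) ρ) =
      amplitude m F (2 * m) * star (amplitude m F (2 * m)) * f (s.Nᴴ * s.N) :=
    fun s => krausMap_slice_apply _ _ _ _ _ _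
  rw [krausMap_bind]
  refine (map_multiset_sum g _).trans ?_
  rw [Multiset.map_map]
  simp only [Function.comp_def, h1]
  rw [Multiset.sum_map_mul_left]
  have h2 : ((runs C 𝒜 P (2 * m)).map fun s => f (s.Nᴴ * s.N)).sum =
      f ((4 * (Fintype.card F : ℂ) ^ 3) ^ (2 * m) • (1 : Matrix E E ℂ)) := by
    rw [← sum_conjTranspose_mul_runs C P le_rfl, map_multiset_sum, Multiset.map_map]
    rfl
  have h3 : f ((4 * (Fintype.card F : ℂ) ^ 3) ^ (2 * m) • (1 : Matrix E E ℂ)) =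
      (4 * (Fintype.card F : ℂ) ^ 3) ^ (2 * m) * P.channel E ρ p p' := by
    change ∑ e, ∑ e', _ * _ = _ * ∑ e, τ (p, e) (p', e)
    rw [Finset.mul_sum]
    refine Finset.sum_congr rfl fun e _ => ?_
    rw [Finset.sum_eq_single e (fun x _ hx => by simp [hx]) (by simp)]
    simp
  have hL : (Fintype.card F : ℂ) ≠ 0 := by exact_mod_cast Fintype.card_ne_zero
  rw [h2, h3, amplitude_mul_star, ← mul_assoc, ← mul_inv, ← mul_pow,
    show 2 * (Fintype.card F : ℂ) ^ 3 * 2 = 4 * (Fintype.card F : ℂ) ^ 3 by ring,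
    inv_mul_cancel₀ (by positivity), one_mul]

variable (P) in
lemma trace_krausMap_ideal (s : Run m F A B 𝒜) :
    (krausMap (s.ideal P) ρ).trace.re = ‖amplitude m F (2 * m)‖ ^ 2 * weight ρ s.N := by
  rw [← trace_kronecker_mul_mul_conjTranspose ρ s.N (Matrix.mem_unitaryGroup_iff'.1
    P.unitary_mem_unitaryGroup), ← trace_krausMap_slices (Equiv.prodComm _ _)]
  rfl

lemma trace_krausMap_kraus (s : Run m F A B 𝒜) :
    (krausMap s.kraus ρ).trace.re = ‖amplitude m F (2 * m)‖ ^ 2 * weight ρ s.N := by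
  have hW : (s.X.1 * adjoinOutput (A := A) (B := B))ᴴ * (s.X.1 * adjoinOutput (A := A) (B := B)) =
      1 := by
    rw [Matrix.conjTranspose_mul, Matrix.mul_assoc, ← Matrix.mul_assoc _ s.X.1,
      show (s.X.1)ᴴ * s.X.1 = 1 from Matrix.mem_unitaryGroup_iff'.1 s.X.2, Matrix.one_mul,
      adjoinOutput_isometry]
  let e : (Qubit × (E × 𝒜.F)) × (A × B × Qubit) ≃ Row A B × (E × 𝒜.F) :=
    { toFun := fun x => ((x.2.1, x.2.2.1, x.1.1, x.2.2.2), x.1.2)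
      invFun := fun y => ((y.1.2.2.1, y.2), (y.1.1, y.1.2.1, y.1.2.2.2))
      left_inv := fun _ => rfl
      right_inv := fun _ => rfl }
  rw [← trace_kronecker_mul_mul_conjTranspose ρ s.N hW, ← trace_krausMap_slices e]
  congr 3
  refine Multiset.map_congr rfl fun g _ => ?_
  ext p i
  exact mul_assoc _ _ _

/-- A run that has made enough progress simulates the protocol exactly. -/
lemma Run.Valid.krausMap_kraus {s : Run m F A B 𝒜} (h : s.Valid C P (2 * m))
    (hs : 2 * (n : ℤ) + 4 ≤ potential (wordAfter (s.mem false).log (s.mem true).log m).1) :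
    krausMap s.kraus ρ = krausMap (s.ideal P) ρ := by
  obtain ⟨v, hv, hX⟩ := unitaryAfter_of_potential P hs
  have h1 : s.X = unitaryAfter P (s.mem false).log (s.mem true).log m := by
    have := h.X_eq
    rwa [show (2 * m).bodd = false by simp, Nat.mul_div_cancel_left _ (by norm_num)] at this
  -- The abandoned qubit only contributes the coordinate of a unit vector, which sums to 1 when it
  -- is traced out.
  have h2 : ∀ g : Qubit × (E × 𝒜.F), outputKraus (amplitude m F (2 * m))
      (s.X.1 * adjoinOutput (A := A) (B := B)) s.N g =
        v g.1 • slice (amplitude m F (2 * m)) P.unitary s.N g.2 := by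
    intro g
    ext p i
    rw [Matrix.smul_apply, slice_apply, outputKraus, Matrix.of_apply, h1, hX, smul_eq_mul]
    ring
  simp only [krausMap, Run.kraus, Run.ideal, Multiset.map_map, Function.comp_def, h2]
  change ∑ g : Qubit × (E × 𝒜.F), _ = ∑ g : E × 𝒜.F, _
  rw [Fintype.sum_prod_type, Finset.sum_comm]
  refine Finset.sum_congr rfl fun g _ => ?_
  simp only [Matrix.conjTranspose_smul, Matrix.smul_mul, Matrix.mul_smul, smul_smul]
  rw [← Finset.sum_smul]
  simp only [mul_comm (star _)]
  rw [hv, one_smul]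

end Distance

/-! ### The error of the simulation and its rates. -/

section Success

variable {n m q : ℕ} {F : Type} [Field F] [DecidableEq F] [Fintype F] {C : Scheme q F}

lemma krausMap_bind_filter_add {ι I O : Type} [Fintype I] (s : Multiset ι) (p : ι → Prop)
    [DecidablePred p] (f : ι → Multiset (Matrix O I ℂ)) (ρ : Matrix I I ℂ) :
    krausMap (s.bind f) ρ =
      krausMap ((s.filter p).bind f) ρ + krausMap ((s.filter fun x => ¬ p x).bind f) ρ := by
  conv_lhs => rw [← Multiset.filter_add_not p s]
  simp only [krausMap_bind, Multiset.map_add, Multiset.sum_add]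

lemma re_trace_krausMap_bind {ι I O : Type} [Fintype I] [Fintype O] (s : Multiset ι)
    (f : ι → Multiset (Matrix O I ℂ)) (ρ : Matrix I I ℂ) :
    (krausMap (s.bind f) ρ).trace.re = (s.map fun x => (krausMap (f x) ρ).trace.re).sum := by
  rw [krausMap_bind]
  induction s using Multiset.induction_on with
  | empty => simp
  | cons x s ih => simp only [Multiset.map_cons, Multiset.sum_cons, Matrix.trace_add,
      Complex.add_re, ih]

open Classical in
/-- Few runs make too little progress. -/
lemma sum_weight_bad_le {A B E : Type} [Fintype A] [DecidableEq A] [Fintype B] [DecidableEq B]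
    [Fintype E] [DecidableEq E] {𝒜 : Adversary m q E} (P : NoiselessProtocol n A B)
    {ρ : Matrix ((A × B × Qubit) × E) ((A × B × Qubit) × E) ℂ} (hρ : IsDensity ρ) (hm : 1 ≤ m)
    {a k : ℕ} {ε : ℝ} (hC : IsTreeCode a m C.gen C.label) (h𝒜 : 𝒜.InClass (1 / 2 - ε)) (ha : 0 < a)
    (hεa : 16 ≤ ε * a) (hεm : 2 * n + 6 ≤ ε * m) (hk : 16 * k ≤ ε * m) :
    (((runs C 𝒜 P (2 * m)).filter fun s => ¬ 2 * (n : ℤ) + 4 ≤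
      potential (wordAfter (s.mem false).log (s.mem true).log m).1).map
        fun s => ‖amplitude m F (2 * m)‖ ^ 2 * weight ρ s.N).sum ≤
      4 ^ m / (Fintype.card F : ℝ) ^ (k + 1) := by
  have hL : (1 : ℝ) ≤ Fintype.card F := by exact_mod_cast Fintype.card_pos
  have hL0 : (0 : ℝ) < Fintype.card F := by linarith
  set p : Run m F A B 𝒜 → Prop := fun s =>
    2 * (n : ℤ) + 4 ≤ potential (wordAfter (s.mem false).log (s.mem true).log m).1
  have h1 : ∀ s ∈ (runs C 𝒜 P (2 * m)).filter fun s => ¬ p s, weight ρ s.N ≤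
      weight ρ s.N * (Fintype.card F : ℝ) ^ s.cor * ((Fintype.card F : ℝ) ^ (k + 1))⁻¹ := by
    intro s hs
    obtain ⟨hs, hp⟩ := Multiset.mem_filter.1 hs
    have hV := Run.valid_of_mem_runs le_rfl hs
    -- Runs with vanishing operator may exceed the adversary's budget, but they carry no weight.
    by_cases hN : s.N = 0
    · rw [hN, weight_zero, zero_mul, zero_mul]
    · have hcor : k + 1 ≤ s.cor := by
        by_contra hcor
        exact hp (hV.potential_ge hN hm hC h𝒜 ha hεa hεm hk (by omega))
      rw [mul_assoc]
      refine le_mul_of_one_le_right (weight_nonneg hρ.1 _) ?_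
      rw [← div_eq_mul_inv, one_le_div (by positivity)]
      exact pow_le_pow_right₀ hL hcor
  rw [Multiset.sum_map_mul_left, norm_amplitude_sq]
  -- Markov's inequality. Multiplied by the squared amplitude, the factor 8 against 4 in each of the
  -- 2m transmissions leaves 4^m.
  have h2 : (((runs C 𝒜 P (2 * m)).filter fun s => ¬ p s).map fun s => weight ρ s.N).sum ≤
      (8 * (Fintype.card F : ℝ) ^ 3) ^ (2 * m) * ((Fintype.card F : ℝ) ^ (k + 1))⁻¹ := by
    refine (Multiset.sum_map_le_sum_map _ _ h1).trans ?_
    rw [Multiset.sum_map_mul_right]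
    refine mul_le_mul_of_nonneg_right ?_ (by positivity)
    refine le_trans ?_ (sum_weight_runs_le (𝒜 := 𝒜) C P hρ le_rfl)
    conv_rhs => rw [← Multiset.filter_add_not p (runs C 𝒜 P (2 * m)), Multiset.map_add,
      Multiset.sum_add]
    refine le_add_of_nonneg_left (Multiset.sum_nonneg fun x hx => ?_)
    obtain ⟨s, _, rfl⟩ := Multiset.mem_map.1 hx
    exact mul_nonneg (weight_nonneg hρ.1 _) (by positivity)
  refine (mul_le_mul_of_nonneg_left h2 (by positivity)).trans_eq ?_
  rw [← mul_assoc, inv_mul_eq_div, ← div_pow, div_eq_mul_inv _ ((Fintype.card F : ℝ) ^ (k + 1)),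
    mul_div_mul_right _ _ (by positivity), pow_mul]
  norm_num

/-- The simulation succeeds if the tree code is good enough and there are enough turns. -/
theorem Scheme.simulator_succeeds (hm : 1 ≤ m) {a k : ℕ} {ε η : ℝ}
    (hC : IsTreeCode a m C.gen C.label) (ha : 0 < a) (hεa : 16 ≤ ε * a)
    (hεm : 2 * n + 6 ≤ ε * m) (hk : 16 * k ≤ ε * m)
    (hη : 2 * (4 ^ m / (Fintype.card F : ℝ) ^ (k + 1)) ≤ η) :
    (C.simulator n m).Succeeds (1 / 2 - ε) η := by
  classical
  intro A B E _ _ _ _ _ _ _ _ P 𝒜 h𝒜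
  set p : Run m F A B 𝒜 → Prop := fun s =>
    2 * (n : ℤ) + 4 ≤ potential (wordAfter (s.mem false).log (s.mem true).log m).1
  have hbad := fun {ρ} (hρ : IsDensity ρ) =>
    sum_weight_bad_le P (ρ := ρ) hρ hm hC h𝒜 ha hεa hεm hk
  -- Good runs cancel. On the bad ones the ideal and the actual contributions have the same trace,
  -- each at most half of the error.
  refine diamondNorm_le (((runs C 𝒜 P (2 * m)).filter fun s => ¬ p s).bind (Run.ideal P))
    (((runs C 𝒜 P (2 * m)).filter fun s => ¬ p s).bind Run.kraus) ?_ ?_ ?_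
  · intro ρ
    rw [simChannel_eq C P ρ hm, ← krausMap_bind_ideal C, krausMap_bind_filter_add _ p,
      krausMap_bind_filter_add _ p Run.kraus]
    have h : krausMap (((runs C 𝒜 P (2 * m)).filter p).bind Run.kraus) ρ =
        krausMap (((runs C 𝒜 P (2 * m)).filter p).bind (Run.ideal P)) ρ := by
      rw [krausMap_bind, krausMap_bind]
      refine congrArg _ (Multiset.map_congr rfl fun s hs => ?_)
      obtain ⟨hs, hp⟩ := Multiset.mem_filter.1 hs
      exact (Run.valid_of_mem_runs le_rfl hs).krausMap_kraus hp
    rw [h, add_sub_add_left_eq_sub]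
  · intro ρ hρ
    rw [re_trace_krausMap_bind]
    simp only [trace_krausMap_ideal]
    linarith [hbad hρ]
  · intro ρ hρ
    rw [re_trace_krausMap_bind]
    simp only [trace_krausMap_kraus]
    linarith [hbad hρ]

lemma Simulator.Succeeds.mono {S : Simulator n m q} {δ δ' η : ℝ} (h : S.Succeeds δ η)
    (hδ : δ' ≤ δ) : S.Succeeds δ' η := fun A B E _ _ _ _ _ _ _ _ P 𝒜 h𝒜 =>
  h A B E P 𝒜 fun z hz => (h𝒜 z hz).trans (mul_le_mul_of_nonneg_right hδ (Nat.cast_nonneg _))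

lemma prod_eprPair {k : ℕ} (f g : Fin k → Qubit) : ∏ i, eprPair (f i) (g i) =
    if f = g then ((√(2 ^ k : ℝ) : ℝ) : ℂ)⁻¹ else 0 := by
  split_ifs with h
  · subst h
    simp only [eprPair, if_true, Finset.prod_const, Finset.card_univ, Fintype.card_fin]
    have hk : √(2 ^ k : ℝ) = √2 ^ k := by
      rw [Real.sqrt_eq_iff_mul_self_eq (by positivity) (by positivity), ← mul_pow,
        Real.mul_self_sqrt (by norm_num)]
    rw [hk]
    push_cast
    rw [one_div, inv_pow]
  · obtain ⟨i, hi⟩ := Function.ne_iff.1 h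
    exact Finset.prod_eq_zero (Finset.mem_univ i) (if_neg hi)

lemma card_ent {s : ℕ} (hF : Fintype.card F = 2 ^ s) :
    Fintype.card (Ent m F) = 2 ^ ((1 + 3 * s) * (2 * m)) := by
  simp only [Fintype.card_fun, Fintype.card_prod, Fintype.card_fin, hF]
  rw [pow_mul 2 (1 + 3 * s)]
  congr 1
  ring

variable (C) in
-- A maximally entangled state of local dimension 2^k becomes `k` EPR pairs under any identification
-- of bases, provided that both parties use the same one. A share takes one pair for teleportation
-- and `s` for each of the three parts of the key.
lemma Scheme.usesEPRPairs {s : ℕ} (hF : Fintype.card F = 2 ^ s) :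
    (C.simulator n m).UsesEPRPairs ((1 + 3 * s) * (2 * m)) := by
  have e : Ent m F ≃ (Fin ((1 + 3 * s) * (2 * m)) → Qubit) := Fintype.equivOfCardEq (by
    rw [card_ent hF]; simp)
  refine ⟨e, e, fun a b => ?_⟩
  rw [prod_eprPair]
  change (if a = b then ((√(Fintype.card (Ent m F)) : ℝ) : ℂ)⁻¹ else 0) = _
  rw [card_ent hF]
  refine (ite_eq_ite_of_iff e.injective.eq_iff ?_).symm
  push_cast
  rfl

lemma logb_two_pow (k : ℕ) : Real.logb 2 ((2 ^ k : ℕ) : ℝ) = k := by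
  rw [Nat.cast_pow, Nat.cast_ofNat, ← Real.rpow_natCast, Real.logb_rpow (by norm_num) (by norm_num)]

variable (C) in
lemma Scheme.entRate_simulator {s : ℕ} (hF : Fintype.card F = 2 ^ s) (hm : 1 ≤ m)
    (hq : q = 2 ^ (2 * s)) : (C.simulator n m).entRate = (1 + 3 * s) / (2 * s) := by
  have h : Fintype.card (C.simulator n m).TA = 2 ^ ((1 + 3 * s) * (2 * m)) := card_ent hF
  have hm' : (0 : ℝ) < m := by exact_mod_cast hm
  rw [Simulator.entRate, h, min_self, hq,
    logb_two_pow, logb_two_pow]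
  push_cast
  rw [mul_comm (2 * (m : ℝ)), mul_div_mul_right _ _ (by positivity)]

end Success

/-! ### The choice of the field and of the constants. -/

section Parameters

/-- The field of the authentication tags and of the tree code. -/
abbrev TagField (D : ℕ) : Type := GaloisField 2 (240 * D)

instance (D : ℕ) : Fintype (TagField D) := Fintype.ofFinite _

open Classical in
instance (D : ℕ) : DecidableEq (TagField D) := inferInstance

lemma card_tagField {D : ℕ} (hD : 1 ≤ D) : Fintype.card (TagField D) = 2 ^ (240 * D) := by
  rw [← Nat.card_eq_fintype_card, GaloisField.card 2 _ (by omega)]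

/-- The log alphabet has 4 · 3 · 4 = 48 letters, and 8 · 48² ≤ 2^15. With a = 16 D the tree code
thus exists over a field of size 2^(15 · 16 D) = 2^(240 D). -/
lemma exists_scheme {D : ℕ} (hD : 1 ≤ D) (m : ℕ) :
    ∃ C : Scheme (2 ^ (2 * (240 * D))) (TagField D), IsTreeCode (16 * D) m C.gen C.label := by
  have hF := card_tagField hD
  have hT : Fintype.card TurnLog = 48 := by decide
  have h1 : 2 ^ 240 ≤ 2 ^ (240 * D) := Nat.pow_le_pow_right (by norm_num) (by omega)
  obtain ⟨label⟩ : Nonempty (TurnLog ↪ TagField D) :=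
    Function.Embedding.nonempty_of_card_le (by rw [hT, hF]; exact le_trans (by norm_num) h1)
  obtain ⟨gen, hgen⟩ := exists_treeCode (16 * D) m label label.injective (by
    rw [hT, hF, show 240 * D = 15 * (16 * D) by ring, pow_mul 2 15]
    exact Nat.pow_le_pow_left (by norm_num) _)
  have hq : Fintype.card (TagField D × TagField D) = 2 ^ (2 * (240 * D)) := by
    rw [Fintype.card_prod, hF]
    ring
  exact ⟨⟨Fintype.equivFinOfCardEq hq, gen, label⟩, hgen⟩

/-- In exponents of 2, the left side needs 1 + 16 D n + 2n, while the field supplies at least 120 D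
(n + 1). -/
lemma error_bound {D n : ℕ} (hD : 1 ≤ D) (hn : 1 ≤ n) :
    2 * (4 ^ (8 * D * n) / (Fintype.card (TagField D) : ℝ) ^ (n / 2 + 1)) ≤
      (2 : ℝ) ^ (-(1 * ((2 * n : ℕ) : ℝ))) := by
  rw [one_mul, Real.rpow_neg (by norm_num), Real.rpow_natCast, card_tagField hD, ← mul_div_assoc,
    div_le_iff₀ (by positivity), inv_mul_eq_div, le_div_iff₀ (by positivity)]
  have hDn : n ≤ D * n := Nat.le_mul_of_pos_left n hD
  have h2 : D * (n + 1) ≤ D * (2 * (n / 2 + 1)) := Nat.mul_le_mul_left D (by omega)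
  have h : 2 * 4 ^ (8 * D * n) * 2 ^ (2 * n) ≤ (2 ^ (240 * D)) ^ (n / 2 + 1) := by
    rw [show 4 = 2 ^ 2 by norm_num, ← pow_mul, ← pow_mul, ← pow_succ', ← pow_add]
    refine Nat.pow_le_pow_right (by norm_num) ?_
    nlinarith
  exact_mod_cast h

end Parameters

end NoisyQC

end

theorem mainTheorem1 :
    ∃ c : ℝ, 0 < c ∧ ∀ ε : ℝ, 0 < ε →
      ∃ (R_C : ℝ) (q : ℕ) (R_E : ℝ), 0 < R_C ∧ 2 ≤ q ∧ 0 ≤ R_E ∧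
        ∀ n : ℕ, 1 ≤ n →
          ∃ (m : ℕ) (S : NoisyQC.Simulator n m q),
            S.commRate = R_C ∧ S.entRate = R_E ∧ (∃ k : ℕ, S.UsesEPRPairs k) ∧
              S.Succeeds (1 / 2 - ε) ((2 : ℝ) ^ (-(c * ((2 * n : ℕ) : ℝ)))) := by
  refine ⟨1, one_pos, fun ε hε => ?_⟩
  -- Replacing ε by 1 / D with 1 / D ≤ ε only enlarges the class of adversaries and makes m = 8 D n
  -- an integer multiple of n, so the rates do not depend on n.
  obtain ⟨D₀, hD₀⟩ := exists_nat_one_div_lt hε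
  set D := D₀ + 1 with hD_def
  have hD : 1 ≤ D := Nat.le_add_left 1 D₀
  have hD' : (0 : ℝ) < D := by exact_mod_cast hD
  have hε' : 1 / (D : ℝ) ≤ ε := by rw [hD_def]; push_cast; exact hD₀.le
  refine ⟨1 / (8 * D * (2 * (240 * D))), 2 ^ (2 * (240 * D)),
    (1 + 3 * (240 * D : ℕ)) / (2 * (240 * D : ℕ)), by positivity, ?_, by positivity,
    fun n hn => ?_⟩
  · exact le_self_pow₀ (by norm_num) (by omega)
  have hn' : (1 : ℝ) ≤ n := by exact_mod_cast hn
  have hm : 1 ≤ 8 * D * n := Nat.mul_pos (by omega) hn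
  obtain ⟨C, hC⟩ := NoisyQC.exists_scheme hD (8 * D * n)
  have hF := NoisyQC.card_tagField hD
  have hεm : 1 / (D : ℝ) * ((8 * D * n : ℕ) : ℝ) = 8 * n := by
    push_cast
    field_simp
  refine ⟨8 * D * n, C.simulator n _, ?_, C.entRate_simulator hF hm rfl, ⟨_, C.usesEPRPairs hF⟩,
    NoisyQC.Simulator.Succeeds.mono (δ := 1 / 2 - 1 / (D : ℝ)) ?_ (by linarith)⟩
  · rw [NoisyQC.Simulator.commRate, NoisyQC.logb_two_pow]
    push_cast
    field_simp
  -- With m = 8 D n and ε replaced by 1 / D, the product εm is 8n. This covers both 2n + 6, as n ≥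
  -- 1, and 16 k.
  · refine NoisyQC.Scheme.simulator_succeeds (k := n / 2) hm hC (by omega) ?_ ?_ ?_
      (NoisyQC.error_bound hD hn)
    · push_cast
      field_simp
      rfl
    · rw [hεm]; linarith
    · rw [hεm]
      have : (2 * (n / 2 : ℕ) : ℝ) ≤ n := by exact_mod_cast Nat.mul_div_le n 2
      linarith
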